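/- Let $\mathbf{k}$ be a field of characteristic zero. All dglas are $\mathbb{Z}/2$-graded over $\mathbf{k}$. A pronilpotent dgla is an inverse limit $\mathfrak{g}=\varprojlim_i \mathfrak{g}/\mathfrak{g}_i$ of nilpotent dglas, where $(\mathfrak{g}_i)$ is a (nonempty) directed system of dg ideals; morphisms of pronilpotent dglas are the dgla maps that are continuous for the inverse limit topologies. Let $\mathrm{MC}(\mathfrak{g})$ be the set of odd $\xi$ with $d\xi+\tfrac12[\xi,\xi]=0$; for $\xi\in\mathrm{MC}(\mathfrak{g})$ let $\mathfrak{g}^\xi$ be $\mathfrak{g}$ with the differential $d^\xi=d+\mathrm{ad}(\xi)$. Put $\mathfrak{g}[z,dz]=\varprojlim_i\,(\mathfrak{g}/\mathfrak{g}_i)\otimes\mathbf{k}[z,dz]$ with $|z|=0$, $|dz|=1$, $d(z)=dz$. Two elements $\xi,\eta\in\mathrm{MC}(\mathfrak{g})$ are homotopic if there is $h\in\mathrm{MC}(\mathfrak{g}[z,dz])$ with $h|_{z=0}=\xi$ and $h|_{z=1}=\eta$, and $\mathcal{MC}(\mathfrak{g})$ denotes the set of classes of $\mathrm{MC}(\mathfrak{g})$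 under the equivalence relation generated by homotopy. For even $y$ let $$e^y\cdot\xi=\xi+\sum_{n\ge1}\tfrac1{n!}(\mathrm{ad}\,y)^{n-1}(\mathrm{ad}(y)\xi-dy)$$ be the gauge action, and let $\bullet$ be the Baker–Campbell–Hausdorff product on the even part. Let $f\colon\mathfrak{g}\to\mathfrak{h}$ be a surjective morphism of pronilpotent dglas, $\xi_0\in\mathrm{MC}(\mathfrak{h})$, and $\xi\in\mathrm{MC}(\mathfrak{g})$ with $f(\xi)=\xi_0$. Let $\mathfrak{k}^\xi$ be the kernel of $f$ with the differential $d^\xi$. Then: 1. The product $\bullet$ on the even cocycles of $\mathfrak{h}^{\xi_0}$ descends to $H^0(\mathfrak{h}^{\xi_0})$ and makes $\exp(H^0(\mathfrak{h}^{\xi_0}))=\{e^{c}: c\in H^0(\mathfrak{h}^{\xi_0})\}$ a group, with $e^{[x]}e^{[y]}=e^{[x\bullet y]}$. 2. This group acts on $\mathcal{MC}(\mathfrak{k}^\xi)$ by $e^{[y_0]}\star[\eta]=[e^{y}\cdot(\eta+\xi)-\xi]$, where $y_0$ is an even cocycle of $\mathfrak{h}^{\xi_0}$ and $y\in\mathfrak{g}^0$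 is any element with $f(y)=y_0$ (in particular $e^{y}\cdot(\eta+\xi)-\xi\in\mathrm{MC}(\mathfrak{k}^\xi)$). 3. The map $[\eta]\mapsto[\eta+\xi]$ induces a bijection from the orbit set $\mathcal{MC}(\mathfrak{k}^\xi)/\exp(H^0(\mathfrak{h}^{\xi_0}))$ onto the fibre of $\mathcal{MC}(\mathfrak{g})\to\mathcal{MC}(\mathfrak{h})$ over the class of $\xi_0$. -/

import Mathlib

universe u v w v' w'

/-! ## Differential graded Lie algebras, graded by `ℤ/2` -/

/-- A differential `ℤ/2`-graded Lie algebra `𝔤 = 𝔤⁰ ⊕ 𝔤¹` over a field `k` (of characteristic zero in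
all uses).  `Ev` is the even part, `Od` the odd part.  The bracket is given by its components
`lieEE x y = [x, y]`, `lieEO x u = [x, u]`, `lieOO u v = [u, v]` for `x, y` even and `u, v` odd; the
remaining component is `[u, x] = -[x, u]`.  The laws are graded antisymmetry, the graded Jacobi
identity, `d² = 0` and the graded Leibniz rule `d[a, b] = [da, b] + (-1)^|a| [a, db]`, parity by
parity. -/
structure DGLA (k : Type u) [Field k] where
  Ev : Type v
  Od : Type v
  [acgEv : AddCommGroup Ev]
  [acgOd : AddCommGroup Od]
  [modEv : Module k Ev]
  [modOd : Module k Od]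
  lieEE : Ev →ₗ[k] Ev →ₗ[k] Ev
  lieEO : Ev →ₗ[k] Od →ₗ[k] Od
  lieOO : Od →ₗ[k] Od →ₗ[k] Ev
  skew : ∀ x y, lieEE x y = -lieEE y x
  symm : ∀ u v, lieOO u v = lieOO v u
  jacEEE : ∀ x y z, lieEE x (lieEE y z) = lieEE (lieEE x y) z + lieEE y (lieEE x z)
  jacEEO : ∀ x y u, lieEO x (lieEO y u) = lieEO (lieEE x y) u + lieEO y (lieEO x u)
  jacEOO : ∀ x u v, lieEE x (lieOO u v) = lieOO (lieEO x u) v + lieOO u (lieEO x v)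
  jacOOO : ∀ u v w, lieEO (lieOO u v) w + lieEO (lieOO v w) u + lieEO (lieOO w u) v = 0
  dE : Ev →ₗ[k] Od
  dO : Od →ₗ[k] Ev
  dO_dE : ∀ x, dO (dE x) = 0
  dE_dO : ∀ u, dE (dO u) = 0
  leibEE : ∀ x y, dE (lieEE x y) = -lieEO y (dE x) + lieEO x (dE y)
  leibEO : ∀ x u, dO (lieEO x u) = lieOO (dE x) u + lieEE x (dO u)
  leibOO : ∀ u v, dE (lieOO u v) = lieEO (dO u) v + lieEO (dO v) u

attribute [instance] DGLA.acgEv DGLA.acgOd DGLA.modEv DGLA.modOd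

namespace DGLA

variable {k : Type u} [Field k]

/-- The set `MC(𝔤)` of Maurer–Cartan elements: odd `ξ` with `dξ + ½[ξ, ξ] = 0`. -/
abbrev MC (A : DGLA.{u, v} k) : Type v :=
  {ξ : A.Od // A.dO ξ + (2 : k)⁻¹ • A.lieOO ξ ξ = 0}

/-- The lower central series `C⁰ = 𝔤`, `Cⁿ⁺¹ = [𝔤, Cⁿ]`, as the pair of its even and odd parts. -/
def lcs (A : DGLA.{u, v} k) : ℕ → Submodule k A.Ev × Submodule k A.Od
  | 0 => (⊤, ⊤)
  | n + 1 =>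
    (Submodule.span k ({z | ∃ x, ∃ y ∈ (lcs A n).1, z = A.lieEE x y} ∪
        {z | ∃ u, ∃ v ∈ (lcs A n).2, z = A.lieOO u v}),
      Submodule.span k ({z | ∃ x, ∃ v ∈ (lcs A n).2, z = A.lieEO x v} ∪
        {z | ∃ y ∈ (lcs A n).1, ∃ u, z = A.lieEO y u}))

/-- The differential `d^ξ = d + ad ξ` on the even part: `d^ξ x = dx + [ξ, x] = dx - [x, ξ]`. -/
def twistE (A : DGLA.{u, v} k) (ξ : A.Od) : A.Ev →ₗ[k] A.Od := A.dE - A.lieEO.flip ξ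

/-- The differential `d^ξ = d + ad ξ` on the odd part. -/
def twistO (A : DGLA.{u, v} k) (ξ : A.Od) : A.Od →ₗ[k] A.Ev := A.dO + A.lieOO ξ

@[simp] lemma twistE_apply (A : DGLA.{u, v} k) (ξ : A.Od) (x : A.Ev) :
    A.twistE ξ x = A.dE x - A.lieEO x ξ := rfl

@[simp] lemma twistO_apply (A : DGLA.{u, v} k) (ξ : A.Od) (x : A.Od) :
    A.twistO ξ x = A.dO x + A.lieOO ξ x := rfl

/-- The twisted dgla `𝔤^ξ`: same graded Lie algebra, differential `d^ξ = d + ad ξ`. -/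
abbrev twist [CharZero k] (A : DGLA.{u, v} k) (ξ : A.MC) : DGLA.{u, v} k :=
  { A with
    dE := A.twistE ξ.1
    dO := A.twistO ξ.1
    dO_dE := by
      intro x
      have h1 : A.dO ξ.1 = -((2 : k)⁻¹ • A.lieOO ξ.1 ξ.1) := eq_neg_of_add_eq_zero_left ξ.2
      have h2 := A.jacEOO x ξ.1 ξ.1
      rw [A.symm (A.lieEO x ξ.1) ξ.1, ← two_smul k] at h2
      have h3 : A.lieEE x (A.dO ξ.1) = -A.lieOO ξ.1 (A.lieEO x ξ.1) := by
        rw [h1, map_neg, map_smul, h2, smul_smul, inv_mul_cancel₀ two_ne_zero, one_smul]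
      simp only [twistE_apply, twistO_apply, map_sub, A.dO_dE, A.leibEO, h3, A.symm (A.dE x) ξ.1]
      abel
    dE_dO := by
      intro u
      have h1 : A.dO ξ.1 = -((2 : k)⁻¹ • A.lieOO ξ.1 ξ.1) := eq_neg_of_add_eq_zero_left ξ.2
      have h2 := A.jacOOO ξ.1 ξ.1 u
      rw [A.symm u ξ.1, add_assoc, ← two_smul k] at h2
      have h3 : A.lieEO (A.dO ξ.1) u = A.lieEO (A.lieOO ξ.1 u) ξ.1 := by
        rw [h1, map_neg, map_smul, LinearMap.neg_apply, LinearMap.smul_apply,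
          eq_neg_of_add_eq_zero_left h2, smul_neg, neg_neg, smul_smul,
          inv_mul_cancel₀ two_ne_zero, one_smul]
      simp only [twistE_apply, twistO_apply, map_add, A.dE_dO, A.leibOO, h3]
      abel
    leibEE := by
      intro x y
      have h := A.jacEEO x y ξ.1
      simp only [twistE_apply, map_sub, A.leibEE, h]
      abel
    leibEO := by
      intro x u
      have h := A.jacEOO x ξ.1 u
      simp only [twistE_apply, twistO_apply, map_sub, map_add, A.leibEO, h, LinearMap.sub_apply]
      abel
    leibOO := by
      intro u v
      have h := A.jacOOO ξ.1 u v
      rw [A.symm v ξ.1] at h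
      have h' : A.lieEO (A.lieOO u v) ξ.1 =
          -(A.lieEO (A.lieOO ξ.1 u) v) - A.lieEO (A.lieOO ξ.1 v) u := by
        rw [← sub_eq_zero, ← h]; abel
      simp only [twistE_apply, twistO_apply, map_add, A.leibOO, h', LinearMap.add_apply]
      abel }

/-- For an even derivation `∂ = (∂E, ∂O)` of `𝔞` commuting with the differential, the dgla
`𝔞 ⊕ 𝔞 dz` with `dz` odd, `(dz)² = 0` and differential `a ↦ da + (-1)^|a| ∂a dz`,
`b dz ↦ (db) dz`.  The bracket follows the Koszul rule
`[a ⊗ α, b ⊗ β] = (-1)^(|α||b|) [a, b] ⊗ αβ`.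
An even element is a pair `(x, u)` standing for `x + u dz` with `x` even and `u` odd, an odd element
is a pair `(u, x)` standing for `u + x dz`. -/
abbrev adjoinDz (A : DGLA.{u, v} k) (pE : A.Ev →ₗ[k] A.Ev) (pO : A.Od →ₗ[k] A.Od)
    (hEE : ∀ x y, pE (A.lieEE x y) = A.lieEE (pE x) y + A.lieEE x (pE y))
    (hEO : ∀ x u, pO (A.lieEO x u) = A.lieEO (pE x) u + A.lieEO x (pO u))
    (hOO : ∀ u v, pE (A.lieOO u v) = A.lieOO (pO u) v + A.lieOO u (pO v))
    (hdE : ∀ x, pO (A.dE x) = A.dE (pE x)) (hdO : ∀ u, pE (A.dO u) = A.dO (pO u)) :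
    DGLA.{u, v} k where
  Ev := A.Ev × A.Od
  Od := A.Od × A.Ev
  lieEE := LinearMap.mk₂ k
    (fun a b => (A.lieEE a.1 b.1, A.lieEO a.1 b.2 - A.lieEO b.1 a.2))
    (by intros; ext <;> simp; abel) (by intros; ext <;> simp [smul_sub])
    (by intros; ext <;> simp; abel) (by intros; ext <;> simp [smul_sub])
  lieEO := LinearMap.mk₂ k
    (fun a u => (A.lieEO a.1 u.1, A.lieEE a.1 u.2 - A.lieOO a.2 u.1))
    (by intros; ext <;> simp; abel) (by intros; ext <;> simp [smul_sub])
    (by intros; ext <;> simp; abel) (by intros; ext <;> simp [smul_sub])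
  lieOO := LinearMap.mk₂ k
    (fun u v => (A.lieOO u.1 v.1, -(A.lieEO v.2 u.1 + A.lieEO u.2 v.1)))
    (by intros; ext <;> simp; abel) (by intros; ext <;> simp [smul_add])
    (by intros; ext <;> simp; abel) (by intros; ext <;> simp [smul_add])
  skew := by
    rintro ⟨a, b⟩ ⟨a', b'⟩
    ext
    · simpa using A.skew a a'
    · simp
  symm := by
    rintro ⟨a, b⟩ ⟨a', b'⟩
    ext
    · simpa using A.symm a a'
    · simp [add_comm]
  jacEEE := by
    rintro ⟨a, b⟩ ⟨a', b'⟩ ⟨a'', b''⟩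
    ext
    · simpa using A.jacEEE a a' a''
    · simp only [LinearMap.mk₂_apply, map_sub, Prod.snd_add, A.jacEEO a a' b'',
        A.jacEEO a a'' b', A.jacEEO a' a'' b]
      abel
  jacEEO := by
    rintro ⟨a, b⟩ ⟨a', b'⟩ ⟨u, x⟩
    ext
    · simpa using A.jacEEO a a' u
    · simp only [LinearMap.mk₂_apply, map_sub, Prod.snd_add, LinearMap.sub_apply,
        A.jacEEE a a' x, A.jacEOO a b' u, A.jacEOO a' b u]
      abel
  jacEOO := by
    rintro ⟨a, b⟩ ⟨u, x⟩ ⟨v, y⟩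
    ext
    · simpa using A.jacEOO a u v
    · have h := A.jacOOO b u v
      rw [A.symm v b] at h
      have h' : A.lieEO (A.lieOO u v) b =
          -(A.lieEO (A.lieOO b u) v) - A.lieEO (A.lieOO b v) u := by
        rw [← sub_eq_zero, ← h]; abel
      simp only [LinearMap.mk₂_apply, map_sub, map_add, map_neg, Prod.snd_add,
        LinearMap.sub_apply, A.jacEEO a x v, A.jacEEO a y u, h']
      abel
  jacOOO := by
    rintro ⟨u, x⟩ ⟨v, y⟩ ⟨w, z⟩
    ext
    · simpa using A.jacOOO u v w
    · simp only [LinearMap.mk₂_apply, map_add, map_neg, Prod.snd_add, Prod.snd_zero,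
        LinearMap.add_apply, LinearMap.neg_apply]
      rw [A.skew (A.lieOO u v) z, A.skew (A.lieOO v w) x, A.skew (A.lieOO w u) y,
        A.jacEOO x v w, A.jacEOO y w u, A.jacEOO z u v]
      simp only [A.symm u (A.lieEO _ _), A.symm v (A.lieEO _ _), A.symm w (A.lieEO _ _)]
      abel
  dE :=
    { toFun := fun a => (A.dE a.1, A.dO a.2 + pE a.1)
      map_add' := by intros; ext <;> simp; abel
      map_smul' := by intros; ext <;> simp }
  dO :=
    { toFun := fun u => (A.dO u.1, A.dE u.2 - pO u.1)
      map_add' := by intros; ext <;> simp; abel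
      map_smul' := by intros; ext <;> simp [smul_sub] }
  dO_dE := by
    rintro ⟨a, b⟩
    ext
    · simpa using A.dO_dE a
    · simp [A.dE_dO, hdE]
  dE_dO := by
    rintro ⟨u, x⟩
    ext
    · simpa using A.dE_dO u
    · simp [A.dO_dE, hdO]
  leibEE := by
    rintro ⟨a, b⟩ ⟨a', b'⟩
    ext
    · simpa using A.leibEE a a'
    · simp only [LinearMap.mk₂_apply, LinearMap.coe_mk, AddHom.coe_mk, map_sub, map_add,
        Prod.snd_add, Prod.snd_neg, A.leibEO, hEE]
      rw [A.symm b (A.dE a'), A.skew a' (A.dO b), A.skew a' (pE a)]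
      rw [A.symm b' (A.dE a)]
      abel
  leibEO := by
    rintro ⟨a, b⟩ ⟨u, x⟩
    ext
    · simpa using A.leibEO a u
    · simp only [LinearMap.mk₂_apply, LinearMap.coe_mk, AddHom.coe_mk, map_sub, map_add,
        Prod.snd_add, A.leibEE, A.leibOO, hEO, LinearMap.add_apply]
      abel
  leibOO := by
    rintro ⟨u, x⟩ ⟨v, y⟩
    ext
    · simpa using A.leibOO u v
    · simp only [LinearMap.mk₂_apply, LinearMap.coe_mk, AddHom.coe_mk, map_sub, map_add, map_neg,
        Prod.snd_add, A.leibEO, hOO]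
      rw [A.skew y (A.dO u), A.skew x (A.dO v), A.symm u (pO v)]
      simp only [LinearMap.sub_apply]
      abel

/-- Morphisms of dglas. -/
structure Hom (A : DGLA.{u, v} k) (B : DGLA.{u, v'} k) where
  mapE : A.Ev →ₗ[k] B.Ev
  mapO : A.Od →ₗ[k] B.Od
  map_lieEE : ∀ x y, mapE (A.lieEE x y) = B.lieEE (mapE x) (mapE y)
  map_lieEO : ∀ x u, mapO (A.lieEO x u) = B.lieEO (mapE x) (mapO u)
  map_lieOO : ∀ u v, mapE (A.lieOO u v) = B.lieOO (mapO u) (mapO v)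
  map_dE : ∀ x, mapO (A.dE x) = B.dE (mapE x)
  map_dO : ∀ u, mapE (A.dO u) = B.dO (mapO u)

namespace Hom

/-- The map `MC(𝔤) → MC(𝔥)` induced by a morphism `𝔤 → 𝔥`. -/
def mapMC {A : DGLA.{u, v} k} {B : DGLA.{u, v'} k} (f : Hom A B) (ξ : A.MC) : B.MC :=
  ⟨f.mapO ξ.1, by
    have h := congrArg f.mapE ξ.2
    simpa only [map_add, map_smul, f.map_dO, f.map_lieOO, map_zero] using h⟩

/-- The same map, viewed as a morphism `𝔤^ξ → 𝔥^(f ξ)`. -/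
abbrev twist [CharZero k] {A : DGLA.{u, v} k} {B : DGLA.{u, v'} k} (f : Hom A B) (ξ : A.MC) :
    Hom (A.twist ξ) (B.twist (f.mapMC ξ)) where
  mapE := f.mapE
  mapO := f.mapO
  map_lieEE := f.map_lieEE
  map_lieEO := f.map_lieEO
  map_lieOO := f.map_lieOO
  map_dE x := by
    change f.mapO (A.dE x - A.lieEO x ξ.1) = B.dE (f.mapE x) - B.lieEO (f.mapE x) (f.mapO ξ.1)
    rw [map_sub, f.map_dE, f.map_lieEO]
  map_dO u := by
    change f.mapE (A.dO u + A.lieOO ξ.1 u) = B.dO (f.mapO u) + B.lieOO (f.mapO ξ.1) (f.mapO u)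
    rw [map_add, f.map_dO, f.map_lieOO]

/-- The kernel of a morphism of dglas. -/
abbrev ker {A : DGLA.{u, v} k} {B : DGLA.{u, v'} k} (f : Hom A B) : DGLA.{u, v} k where
  Ev := LinearMap.ker f.mapE
  Od := LinearMap.ker f.mapO
  lieEE := LinearMap.mk₂ k
    (fun x y => ⟨A.lieEE x.1 y.1, by
      rw [LinearMap.mem_ker, f.map_lieEE, LinearMap.mem_ker.1 x.2]; simp⟩)
    (by intros; ext; simp) (by intros; ext; simp) (by intros; ext; simp) (by intros; ext; simp)
  lieEO := LinearMap.mk₂ k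
    (fun x u => ⟨A.lieEO x.1 u.1, by
      rw [LinearMap.mem_ker, f.map_lieEO, LinearMap.mem_ker.1 x.2]; simp⟩)
    (by intros; ext; simp) (by intros; ext; simp) (by intros; ext; simp) (by intros; ext; simp)
  lieOO := LinearMap.mk₂ k
    (fun u v => ⟨A.lieOO u.1 v.1, by
      rw [LinearMap.mem_ker, f.map_lieOO, LinearMap.mem_ker.1 u.2]; simp⟩)
    (by intros; ext; simp) (by intros; ext; simp) (by intros; ext; simp) (by intros; ext; simp)
  skew x y := Subtype.ext (A.skew x.1 y.1)
  symm u v := Subtype.ext (A.symm u.1 v.1)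
  jacEEE x y z := Subtype.ext (A.jacEEE x.1 y.1 z.1)
  jacEEO x y u := Subtype.ext (A.jacEEO x.1 y.1 u.1)
  jacEOO x u v := Subtype.ext (A.jacEOO x.1 u.1 v.1)
  jacOOO u v w := Subtype.ext (A.jacOOO u.1 v.1 w.1)
  dE := A.dE.restrict fun x hx => by
    rw [LinearMap.mem_ker, f.map_dE, LinearMap.mem_ker.1 hx, map_zero]
  dO := A.dO.restrict fun x hx => by
    rw [LinearMap.mem_ker, f.map_dO, LinearMap.mem_ker.1 hx, map_zero]
  dO_dE x := Subtype.ext (A.dO_dE x.1)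
  dE_dO u := Subtype.ext (A.dE_dO u.1)
  leibEE x y := Subtype.ext (A.leibEE x.1 y.1)
  leibEO x u := Subtype.ext (A.leibEO x.1 u.1)
  leibOO u v := Subtype.ext (A.leibOO u.1 v.1)

end Hom

/-- The even cocycles. -/
abbrev Z0 (A : DGLA.{u, v} k) : Submodule k A.Ev := LinearMap.ker A.dE

/-- The even cohomology `H⁰(𝔤) = ker (d : 𝔤⁰ → 𝔤¹) / im (d : 𝔤¹ → 𝔤⁰)`. -/
abbrev H0 (A : DGLA.{u, v} k) : Type v :=
  A.Z0 ⧸ (LinearMap.range A.dO).comap A.Z0.subtype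

/-- The right-nested bracket `[x₁, [x₂, […, [xₙ₋₁, xₙ]…]]]` of even elements. -/
def nested (A : DGLA.{u, v} k) : List A.Ev → A.Ev
  | [] => 0
  | [x] => x
  | x :: y :: l => A.lieEE x (nested A (y :: l))

/-- The homogeneous component of degree `n` of the Baker–Campbell–Hausdorff series, by Dynkin's
formula: the sum over `1 ≤ m ≤ n` and over all `(r₁, s₁), …, (r_m, s_m)` with `rᵢ + sᵢ > 0` and
`∑ (rᵢ + sᵢ) = n` of `(-1)^(m+1) / m · 1 / (n ∏ rᵢ! sᵢ!) · [x^r₁ y^s₁ ⋯ x^r_m y^s_m]`. -/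
def bchTerm (A : DGLA.{u, v} k) (n : ℕ) (x y : A.Ev) : A.Ev :=
  ∑ m ∈ Finset.Icc 1 n, ((-1 : k) ^ (m + 1) / (m : k)) •
    ∑ p ∈ (Fintype.piFinset fun _ : Fin m =>
        Finset.range (n + 1) ×ˢ Finset.range (n + 1)) with
        (∀ i, 0 < (p i).1 + (p i).2) ∧ ∑ i, ((p i).1 + (p i).2) = n,
      ((n : k) * ∏ i, (((p i).1.factorial : k) * ((p i).2.factorial : k)))⁻¹ •
        A.nested (List.ofFn fun i =>
          List.replicate (p i).1 x ++ List.replicate (p i).2 y).flatten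

lemma nested_mem_lcs (A : DGLA.{u, v} k) (l : List A.Ev) :
    A.nested l ∈ (A.lcs (l.length - 1)).1 := by
  induction l with
  | nil => exact Submodule.mem_top
  | cons x l ih =>
    cases l with
    | nil => exact Submodule.mem_top
    | cons y l => exact Submodule.subset_span (Or.inl ⟨x, _, ih, rfl⟩)

lemma bchTerm_mem (A : DGLA.{u, v} k) (n : ℕ) (x y : A.Ev) (S : Submodule k A.Ev)
    (h : ∀ l : List A.Ev, l.length = n → (∀ z ∈ l, z = x ∨ z = y) → A.nested l ∈ S) :
    A.bchTerm n x y ∈ S := by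
  refine S.sum_mem fun m _ => S.smul_mem _ (S.sum_mem fun p hp => S.smul_mem _ (h _ ?_ ?_))
  · rw [← (Finset.mem_filter.1 hp).2.2]
    simp [List.length_flatten, List.map_ofFn, Function.comp_def, List.sum_ofFn]
  · intro z hz
    simp only [List.mem_flatten, List.mem_ofFn] at hz
    obtain ⟨_, ⟨i, rfl⟩, hz⟩ := hz
    simp only [List.mem_append, List.mem_replicate] at hz
    tauto

lemma lieEO_pow_mem_lcs (A : DGLA.{u, v} k) (y : A.Ev) (u : A.Od) (n : ℕ) :
    (A.lieEO y ^ n) u ∈ (A.lcs n).2 := by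
  induction n with
  | zero => exact Submodule.mem_top
  | succ n ih =>
    rw [pow_succ', Module.End.mul_apply]
    exact Submodule.subset_span (Or.inl ⟨y, _, ih, rfl⟩)

lemma lcs_anti (A : DGLA.{u, v} k) (n : ℕ) :
    (A.lcs (n + 1)).1 ≤ (A.lcs n).1 ∧ (A.lcs (n + 1)).2 ≤ (A.lcs n).2 := by
  induction n with
  | zero => exact ⟨le_top, le_top⟩
  | succ n ih =>
    refine ⟨Submodule.span_mono (Set.union_subset_union ?_ ?_),
      Submodule.span_mono (Set.union_subset_union ?_ ?_)⟩
    · rintro z ⟨x, y, hy, rfl⟩; exact ⟨x, y, ih.1 hy, rfl⟩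
    · rintro z ⟨x, y, hy, rfl⟩; exact ⟨x, y, ih.2 hy, rfl⟩
    · rintro z ⟨x, y, hy, rfl⟩; exact ⟨x, y, ih.2 hy, rfl⟩
    · rintro z ⟨y, hy, x, rfl⟩; exact ⟨y, ih.1 hy, x, rfl⟩

lemma lcs_antitone (A : DGLA.{u, v} k) {m n : ℕ} (h : m ≤ n) :
    (A.lcs n).1 ≤ (A.lcs m).1 ∧ (A.lcs n).2 ≤ (A.lcs m).2 := by
  induction h with
  | refl => exact ⟨le_rfl, le_rfl⟩
  | step _ ih => exact ⟨(A.lcs_anti _).1.trans ih.1, (A.lcs_anti _).2.trans ih.2⟩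

/-- A morphism maps the lower central series into the lower central series. -/
lemma lcs_map {A : DGLA.{u, v} k} {B : DGLA.{u, v'} k} (fE : A.Ev →ₗ[k] B.Ev)
    (fO : A.Od →ₗ[k] B.Od) (hEE : ∀ x y, fE (A.lieEE x y) = B.lieEE (fE x) (fE y))
    (hEO : ∀ x u, fO (A.lieEO x u) = B.lieEO (fE x) (fO u))
    (hOO : ∀ u v, fE (A.lieOO u v) = B.lieOO (fO u) (fO v)) (n : ℕ) :
    (A.lcs n).1 ≤ (B.lcs n).1.comap fE ∧ (A.lcs n).2 ≤ (B.lcs n).2.comap fO := by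
  induction n with
  | zero => exact ⟨fun _ _ => Submodule.mem_top, fun _ _ => Submodule.mem_top⟩
  | succ n ih =>
    constructor <;> refine Submodule.span_le.2 ?_
    · rintro z (⟨x, y, hy, rfl⟩ | ⟨x, y, hy, rfl⟩)
      · exact Submodule.subset_span (Or.inl ⟨_, _, ih.1 hy, hEE x y⟩)
      · exact Submodule.subset_span (Or.inr ⟨_, _, ih.2 hy, hOO x y⟩)
    · rintro z (⟨x, y, hy, rfl⟩ | ⟨y, hy, x, rfl⟩)
      · exact Submodule.subset_span (Or.inl ⟨_, _, ih.2 hy, hEO x y⟩)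
      · exact Submodule.subset_span (Or.inr ⟨_, ih.1 hy, _, hEO y x⟩)

end DGLA

/-! ## Linear filtrations, convergent sums and restricted series -/

namespace Filtered

variable {k : Type u} [Field k] {ι : Type w} {M : Type v} [AddCommGroup M] [Module k M]

/-- `∑ₙ uₙ = s` for the linear topology given by the subspaces `I i`. -/
def IsSum (I : ι → Submodule k M) (a : ℕ → M) (s : M) : Prop :=
  ∀ i, ∃ N, ∀ n ≥ N, s - ∑ m ∈ Finset.range n, a m ∈ I i

open Classical in
/-- The sum `∑ₙ aₙ`; it is `0` by convention if the series diverges. -/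
noncomputable def tsum (I : ι → Submodule k M) (a : ℕ → M) : M :=
  if h : ∃ s, IsSum I a s then h.choose else 0

/-- The sequences which tend to `0`, that is, for every `i` almost all terms lie in `I i`. -/
def nullSeq (I : ι → Submodule k M) : Submodule k (ℕ → M) where
  carrier := {a | ∀ i, ∃ N, ∀ n ≥ N, a n ∈ I i}
  add_mem' := by
    intro a b ha hb i
    obtain ⟨N, hN⟩ := ha i
    obtain ⟨N', hN'⟩ := hb i
    exact ⟨max N N', fun n hn => (I i).add_mem (hN n (le_trans (le_max_left _ _) hn))
      (hN' n (le_trans (le_max_right _ _) hn))⟩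
  zero_mem' := fun i => ⟨0, fun n _ => (I i).zero_mem⟩
  smul_mem' := by
    intro c a ha i
    obtain ⟨N, hN⟩ := ha i
    exact ⟨N, fun n hn => (I i).smul_mem c (hN n hn)⟩

/-- `M` is the inverse limit of the quotients `M / I i`. -/
structure IsLimit [Preorder ι] (I : ι → Submodule k M) : Prop where
  separated : ∀ x, (∀ i, x ∈ I i) → x = 0
  complete : ∀ x : ι → M, (∀ i j, i ≤ j → x j - x i ∈ I i) → ∃ y, ∀ i, y - x i ∈ I i

section sums

variable [Preorder ι] {I : ι → Submodule k M}

lemma IsSum.unique (hI : IsLimit I) {a : ℕ → M} {s t : M} (hs : IsSum I a s) (ht : IsSum I a t) :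
    s = t := by
  rw [← sub_eq_zero]
  refine hI.separated _ fun i => ?_
  obtain ⟨N, hN⟩ := hs i
  obtain ⟨N', hN'⟩ := ht i
  have := (I i).sub_mem (hN _ (le_max_left N N')) (hN' _ (le_max_right N N'))
  simpa using this

lemma IsSum.tsum_eq (hI : IsLimit I) {a : ℕ → M} {s : M} (hs : IsSum I a s) : tsum I a = s := by
  have h : ∃ s, IsSum I a s := ⟨s, hs⟩
  rw [tsum, dif_pos h]
  exact IsSum.unique hI h.choose_spec hs

lemma sum_sub_sum_mem {J : Submodule k M} {a : ℕ → M} {N : ℕ} (h : ∀ n ≥ N, a n ∈ J) {n : ℕ}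
    (hn : N ≤ n) : ∑ m ∈ Finset.range n, a m - ∑ m ∈ Finset.range N, a m ∈ J := by
  rw [← Finset.sum_Ico_eq_sub _ hn]
  exact J.sum_mem fun m hm => h m (Finset.mem_Ico.1 hm).1

/-- Every series whose terms tend to `0` converges. -/
lemma isSum_tsum (hI : IsLimit I) (hanti : ∀ i j, i ≤ j → I j ≤ I i) {a : ℕ → M}
    (ha : a ∈ nullSeq I) : IsSum I a (tsum I a) := by
  choose N hN using ha
  have key : ∀ i, ∀ n ≥ N i,
      ∑ m ∈ Finset.range n, a m - ∑ m ∈ Finset.range (N i), a m ∈ I i := fun i n hn =>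
    sum_sub_sum_mem (hN i) hn
  obtain ⟨y, hy⟩ := hI.complete (fun i => ∑ m ∈ Finset.range (N i), a m) (by
    intro i j hij
    have h1 := key i _ (le_max_left (N i) (N j))
    have h2 := hanti i j hij (key j _ (le_max_right (N i) (N j)))
    have := (I i).sub_mem h1 h2
    simpa using this)
  have hs : IsSum I a y := fun i => ⟨N i, fun n hn => by
    have := (I i).sub_mem (hy i) (key i n hn)
    simpa using this⟩
  rwa [hs.tsum_eq hI]

end sums

section maps

variable {κ : Type w'} {M' : Type v'} [AddCommGroup M'] [Module k M']

/-- Continuity of a linear map for the linear topologies. -/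
def Cont (I : ι → Submodule k M) (J : κ → Submodule k M') (f : M →ₗ[k] M') : Prop :=
  ∀ j, ∃ i, ∀ x ∈ I i, f x ∈ J j

lemma IsSum.map {I : ι → Submodule k M} {J : κ → Submodule k M'} {f : M →ₗ[k] M'}
    (hf : Cont I J f) {a : ℕ → M} {s : M} (hs : IsSum I a s) : IsSum J (fun n => f (a n)) (f s) := by
  intro j
  obtain ⟨i, hi⟩ := hf j
  obtain ⟨N, hN⟩ := hs i
  exact ⟨N, fun n hn => by simpa using hi _ (hN n hn)⟩

/-- A continuous linear map applied termwise to null sequences. -/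
def seqMap {I : ι → Submodule k M} {J : κ → Submodule k M'} (f : M →ₗ[k] M')
    (hf : Cont I J f) : nullSeq I →ₗ[k] nullSeq J where
  toFun a := ⟨fun n => f (a.1 n), fun j => by
    obtain ⟨i, hi⟩ := hf j
    obtain ⟨N, hN⟩ := a.2 i
    exact ⟨N, fun n hn => hi _ (hN n hn)⟩⟩
  map_add' a b := by ext n; simp
  map_smul' c a := by ext n; simp

@[simp] lemma seqMap_apply {I : ι → Submodule k M} {J : κ → Submodule k M'} (f : M →ₗ[k] M')
    (hf : Cont I J f) (a : nullSeq I) (n : ℕ) : (seqMap f hf a).1 n = f (a.1 n) := rfl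

/-- The formal derivative `∑ aₙ zⁿ ↦ ∑ (n + 1) aₙ₊₁ zⁿ`. -/
def deriv (I : ι → Submodule k M) : nullSeq I →ₗ[k] nullSeq I where
  toFun a := ⟨fun n => ((n : k) + 1) • a.1 (n + 1), fun i => by
    obtain ⟨N, hN⟩ := a.2 i
    exact ⟨N, fun n hn => (I i).smul_mem _ (hN _ (by omega))⟩⟩
  map_add' a b := by ext n; simp
  map_smul' c a := by ext n; exact smul_comm _ _ _

@[simp] lemma deriv_apply (I : ι → Submodule k M) (a : nullSeq I) (n : ℕ) :
    (deriv I a).1 n = ((n : k) + 1) • a.1 (n + 1) := rfl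

end maps

section mul

variable {M₁ M₂ M₃ : Type v} [AddCommGroup M₁] [Module k M₁] [AddCommGroup M₂] [Module k M₂]
  [AddCommGroup M₃] [Module k M₃]

/-- The product of series `(∑ aₙ zⁿ, ∑ bₙ zⁿ) ↦ ∑ₙ (∑_{p + q = n} B(a_p, b_q)) zⁿ` induced by a
bilinear map `B` for which the subspaces `I i` behave as ideals. -/
def seqMul {I : ι → Submodule k M₁} {J : ι → Submodule k M₂} {K : ι → Submodule k M₃}
    (B : M₁ →ₗ[k] M₂ →ₗ[k] M₃) (hl : ∀ i, ∀ x ∈ I i, ∀ y, B x y ∈ K i)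
    (hr : ∀ i, ∀ x, ∀ y ∈ J i, B x y ∈ K i) : nullSeq I →ₗ[k] nullSeq J →ₗ[k] nullSeq K :=
  LinearMap.mk₂ k
    (fun a b => ⟨fun n => ∑ p ∈ Finset.HasAntidiagonal.antidiagonal n, B (a.1 p.1) (b.1 p.2), fun i => by
      obtain ⟨N, hN⟩ := a.2 i
      obtain ⟨N', hN'⟩ := b.2 i
      refine ⟨N + N', fun n hn => (K i).sum_mem fun p hp => ?_⟩
      have hp := Finset.HasAntidiagonal.mem_antidiagonal.1 hp
      by_cases h : N ≤ p.1
      · exact hl i _ (hN _ h) _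
      · exact hr i _ _ (hN' _ (by omega))⟩)
    (by intros; ext n; simp [Finset.sum_add_distrib])
    (by intros; ext n; simp [Finset.smul_sum])
    (by intros; ext n; simp [Finset.sum_add_distrib])
    (by intros; ext n; simp [Finset.smul_sum])

@[simp] lemma seqMul_apply {I : ι → Submodule k M₁} {J : ι → Submodule k M₂}
    {K : ι → Submodule k M₃} (B : M₁ →ₗ[k] M₂ →ₗ[k] M₃)
    (hl : ∀ i, ∀ x ∈ I i, ∀ y, B x y ∈ K i) (hr : ∀ i, ∀ x, ∀ y ∈ J i, B x y ∈ K i)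
    (a : nullSeq I) (b : nullSeq J) (n : ℕ) :
    (seqMul B hl hr a b).1 n = ∑ p ∈ Finset.HasAntidiagonal.antidiagonal n, B (a.1 p.1) (b.1 p.2) := rfl

/-- The derivative obeys the Leibniz rule. -/
lemma deriv_seqMul {I : ι → Submodule k M₁} {J : ι → Submodule k M₂} {K : ι → Submodule k M₃}
    (B : M₁ →ₗ[k] M₂ →ₗ[k] M₃) (hl : ∀ i, ∀ x ∈ I i, ∀ y, B x y ∈ K i)
    (hr : ∀ i, ∀ x, ∀ y ∈ J i, B x y ∈ K i) (a : nullSeq I) (b : nullSeq J) :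
    deriv K (seqMul B hl hr a b) =
      seqMul B hl hr (deriv I a) b + seqMul B hl hr a (deriv J b) := by
  ext n
  have h1 : ∑ p ∈ Finset.HasAntidiagonal.antidiagonal (n + 1), (p.1 : k) • B (a.1 p.1) (b.1 p.2) =
      ∑ p ∈ Finset.HasAntidiagonal.antidiagonal n, ((p.1 : k) + 1) • B (a.1 (p.1 + 1)) (b.1 p.2) := by
    rw [Finset.Nat.sum_antidiagonal_succ]
    simp
  have h2 : ∑ p ∈ Finset.HasAntidiagonal.antidiagonal (n + 1), (p.2 : k) • B (a.1 p.1) (b.1 p.2) =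
      ∑ p ∈ Finset.HasAntidiagonal.antidiagonal n, ((p.2 : k) + 1) • B (a.1 p.1) (b.1 (p.2 + 1)) := by
    rw [Finset.Nat.sum_antidiagonal_succ']
    simp
  have h3 : ((n : k) + 1) • ∑ p ∈ Finset.HasAntidiagonal.antidiagonal (n + 1), B (a.1 p.1) (b.1 p.2) =
      ∑ p ∈ Finset.HasAntidiagonal.antidiagonal (n + 1), (p.1 : k) • B (a.1 p.1) (b.1 p.2) +
      ∑ p ∈ Finset.HasAntidiagonal.antidiagonal (n + 1), (p.2 : k) • B (a.1 p.1) (b.1 p.2) := by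
    rw [Finset.smul_sum, ← Finset.sum_add_distrib]
    refine Finset.sum_congr rfl fun p hp => ?_
    rw [← add_smul, ← Nat.cast_add, Finset.HasAntidiagonal.mem_antidiagonal.1 hp, Nat.cast_add, Nat.cast_one]
  simp only [deriv_apply, seqMul_apply, Submodule.coe_add, Pi.add_apply, h3, h1, h2, map_smul,
    LinearMap.smul_apply]

/-- The sum over all `i + j + l = n`, used to compare iterated products of series. -/
def tri (F : ℕ → ℕ → ℕ → M) (n : ℕ) : M :=
  ∑ p ∈ Finset.HasAntidiagonal.antidiagonal n, ∑ q ∈ Finset.HasAntidiagonal.antidiagonal p.2, F p.1 q.1 q.2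

lemma tri_left (F : ℕ → ℕ → ℕ → M) (n : ℕ) :
    ∑ p ∈ Finset.HasAntidiagonal.antidiagonal n, ∑ q ∈ Finset.HasAntidiagonal.antidiagonal p.1, F q.1 q.2 p.2 = tri F n := by
  rw [tri, Finset.sum_sigma', Finset.sum_sigma']
  refine Finset.sum_nbij' (fun s => ⟨(s.2.1, s.2.2 + s.1.2), (s.2.2, s.1.2)⟩)
    (fun s => ⟨(s.1.1 + s.2.1, s.2.2), (s.1.1, s.2.1)⟩) ?_ ?_ ?_ ?_ ?_ <;>
    (rintro ⟨⟨a, b⟩, ⟨c, d⟩⟩ h; simp at h ⊢; try grind)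

lemma tri_swap (F : ℕ → ℕ → ℕ → M) (n : ℕ) : tri (fun i j l => F j i l) n = tri F n := by
  rw [← tri_left, ← tri_left F]
  exact Finset.sum_congr rfl fun p _ =>
    Finset.Nat.sum_antidiagonal_swap (f := fun q : ℕ × ℕ => F q.1 q.2 p.2)

lemma seqMap_seqMul {κ : Type w'} {M₁' M₂' M₃' : Type v'} [AddCommGroup M₁'] [Module k M₁']
    [AddCommGroup M₂'] [Module k M₂'] [AddCommGroup M₃'] [Module k M₃']
    {I : ι → Submodule k M₁} {J : ι → Submodule k M₂} {K : ι → Submodule k M₃}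
    {I' : κ → Submodule k M₁'} {J' : κ → Submodule k M₂'} {K' : κ → Submodule k M₃'}
    (B : M₁ →ₗ[k] M₂ →ₗ[k] M₃) (hl : ∀ i, ∀ x ∈ I i, ∀ y, B x y ∈ K i)
    (hr : ∀ i, ∀ x, ∀ y ∈ J i, B x y ∈ K i) (B' : M₁' →ₗ[k] M₂' →ₗ[k] M₃')
    (hl' : ∀ i, ∀ x ∈ I' i, ∀ y, B' x y ∈ K' i) (hr' : ∀ i, ∀ x, ∀ y ∈ J' i, B' x y ∈ K' i)
    (f₁ : M₁ →ₗ[k] M₁') (f₂ : M₂ →ₗ[k] M₂') (f₃ : M₃ →ₗ[k] M₃') (h₁ : Cont I I' f₁)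
    (h₂ : Cont J J' f₂) (h₃ : Cont K K' f₃) (h : ∀ x y, f₃ (B x y) = B' (f₁ x) (f₂ y))
    (a : nullSeq I) (b : nullSeq J) :
    seqMap f₃ h₃ (seqMul B hl hr a b) = seqMul B' hl' hr' (seqMap f₁ h₁ a) (seqMap f₂ h₂ b) := by
  ext n
  simp only [seqMap_apply, seqMul_apply, map_sum, h]

section iterated

variable {M₀ M₄ M₅ : Type v} [AddCommGroup M₀] [Module k M₀] [AddCommGroup M₄] [Module k M₄]
  [AddCommGroup M₅] [Module k M₅] {I₀ : ι → Submodule k M₀} {I₁ : ι → Submodule k M₁}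
  {I₂ : ι → Submodule k M₂} {I₄ : ι → Submodule k M₄} {I₅ : ι → Submodule k M₅}

lemma seqMul_right (B : M₀ →ₗ[k] M₄ →ₗ[k] M₅) (hl : ∀ i, ∀ x ∈ I₀ i, ∀ y, B x y ∈ I₅ i)
    (hr : ∀ i, ∀ x, ∀ y ∈ I₄ i, B x y ∈ I₅ i) (C : M₁ →ₗ[k] M₂ →ₗ[k] M₄)
    (hl' : ∀ i, ∀ x ∈ I₁ i, ∀ y, C x y ∈ I₄ i) (hr' : ∀ i, ∀ x, ∀ y ∈ I₂ i, C x y ∈ I₄ i)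
    (a : nullSeq I₀) (b : nullSeq I₁) (c : nullSeq I₂) (n : ℕ) :
    (seqMul B hl hr a (seqMul C hl' hr' b c)).1 n =
      tri (fun i j l => B (a.1 i) (C (b.1 j) (c.1 l))) n := by
  simp only [seqMul_apply, map_sum, tri]

lemma seqMul_left (B : M₄ →ₗ[k] M₀ →ₗ[k] M₅) (hl : ∀ i, ∀ x ∈ I₄ i, ∀ y, B x y ∈ I₅ i)
    (hr : ∀ i, ∀ x, ∀ y ∈ I₀ i, B x y ∈ I₅ i) (C : M₁ →ₗ[k] M₂ →ₗ[k] M₄)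
    (hl' : ∀ i, ∀ x ∈ I₁ i, ∀ y, C x y ∈ I₄ i) (hr' : ∀ i, ∀ x, ∀ y ∈ I₂ i, C x y ∈ I₄ i)
    (a : nullSeq I₁) (b : nullSeq I₂) (c : nullSeq I₀) (n : ℕ) :
    (seqMul B hl hr (seqMul C hl' hr' a b) c).1 n =
      tri (fun i j l => B (C (a.1 i) (b.1 j)) (c.1 l)) n := by
  rw [← tri_left]
  simp only [seqMul_apply, map_sum, LinearMap.sum_apply]

end iterated

lemma tri_rot (F : ℕ → ℕ → ℕ → M) (n : ℕ) : tri (fun i j l => F l i j) n = tri F n := by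
  rw [← tri_left, tri, ← Finset.Nat.sum_antidiagonal_swap]
  rfl

lemma tri_add (F G : ℕ → ℕ → ℕ → M) (n : ℕ) :
    tri (fun i j l => F i j l + G i j l) n = tri F n + tri G n := by
  simp only [tri, Finset.sum_add_distrib]

end mul

end Filtered

/-! ## Pronilpotent dglas -/

/-- A pronilpotent dgla: a dgla `𝔤` with a nonempty directed system of differential graded ideals
`𝔤_i = (filE i, filO i)` such that each `𝔤 / 𝔤_i` is nilpotent (that is, `𝔤_i` contains a term of the
lower central series) and `𝔤` is the inverse limit of the `𝔤 / 𝔤_i`. -/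
structure PronilpotentDGLA (k : Type u) [Field k] extends DGLA.{u, v} k where
  ι : Type w
  [preord : Preorder ι]
  [directed : IsDirectedOrder ι]
  [nonempty : Nonempty ι]
  filE : ι → Submodule k Ev
  filO : ι → Submodule k Od
  antiE : ∀ i j, i ≤ j → filE j ≤ filE i
  antiO : ∀ i j, i ≤ j → filO j ≤ filO i
  idealEE : ∀ i x, ∀ y ∈ filE i, lieEE x y ∈ filE i
  idealEO : ∀ i x, ∀ u ∈ filO i, lieEO x u ∈ filO i
  idealEO' : ∀ i, ∀ x ∈ filE i, ∀ u, lieEO x u ∈ filO i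
  idealOO : ∀ i u, ∀ v ∈ filO i, lieOO u v ∈ filE i
  dE_mem : ∀ i, ∀ x ∈ filE i, dE x ∈ filO i
  dO_mem : ∀ i, ∀ u ∈ filO i, dO u ∈ filE i
  nilpotent : ∀ i, ∃ N, (toDGLA.lcs N).1 ≤ filE i ∧ (toDGLA.lcs N).2 ≤ filO i
  limitE : Filtered.IsLimit filE
  limitO : Filtered.IsLimit filO

attribute [instance] PronilpotentDGLA.preord PronilpotentDGLA.directed
  PronilpotentDGLA.nonempty

namespace PronilpotentDGLA

open Filtered

variable {k : Type u} [Field k]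

lemma idealEE' (A : PronilpotentDGLA.{u, v, w} k) (i : A.ι) (x : A.Ev) (hx : x ∈ A.filE i)
    (y : A.Ev) : A.lieEE x y ∈ A.filE i := by
  rw [A.skew]; exact (A.filE i).neg_mem (A.idealEE i y x hx)

lemma idealOO' (A : PronilpotentDGLA.{u, v, w} k) (i : A.ι) (u : A.Od) (hu : u ∈ A.filO i)
    (v : A.Od) : A.lieOO u v ∈ A.filE i := by
  rw [A.symm]; exact A.idealOO i v u hu

lemma cont_dE (A : PronilpotentDGLA.{u, v, w} k) : Cont A.filE A.filO A.dE :=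
  fun i => ⟨i, A.dE_mem i⟩

lemma cont_dO (A : PronilpotentDGLA.{u, v, w} k) : Cont A.filO A.filE A.dO :=
  fun i => ⟨i, A.dO_mem i⟩

/-- The twisted dgla `𝔤^ξ` with the same system of ideals. -/
abbrev twist [CharZero k] (A : PronilpotentDGLA.{u, v, w} k) (ξ : A.MC) :
    PronilpotentDGLA.{u, v, w} k :=
  { A.toDGLA.twist ξ with
    ι := A.ι
    nonempty := A.nonempty
    filE := A.filE
    filO := A.filO
    antiE := A.antiE
    antiO := A.antiO
    idealEE := A.idealEE
    idealEO := A.idealEO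
    idealEO' := A.idealEO'
    idealOO := A.idealOO
    dE_mem := fun i x hx => (A.filO i).sub_mem (A.dE_mem i x hx) (A.idealEO' i x hx _)
    dO_mem := fun i u hu => (A.filE i).add_mem (A.dO_mem i u hu) (A.idealOO i _ u hu)
    nilpotent := fun i => by
      obtain ⟨N, h1, h2⟩ := A.nilpotent i
      have h := DGLA.lcs_map (A := A.toDGLA.twist ξ) (B := A.toDGLA) LinearMap.id LinearMap.id
        (fun _ _ => rfl) (fun _ _ => rfl) (fun _ _ => rfl) N
      exact ⟨N, h.1.trans h1, h.2.trans h2⟩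
    limitE := A.limitE
    limitO := A.limitO }

/-- Morphisms of pronilpotent dglas: continuous morphisms of dglas. -/
structure Hom (A : PronilpotentDGLA.{u, v, w} k) (B : PronilpotentDGLA.{u, v', w'} k) extends
    DGLA.Hom A.toDGLA B.toDGLA where
  contE : Cont A.filE B.filE mapE
  contO : Cont A.filO B.filO mapO

namespace Hom

variable {A : PronilpotentDGLA.{u, v, w} k} {B : PronilpotentDGLA.{u, v', w'} k}

/-- The same map, viewed as a morphism `𝔤^ξ → 𝔥^(f ξ)`. -/
abbrev twist [CharZero k] (f : Hom A B) (ξ : A.MC) : Hom (A.twist ξ) (B.twist (f.mapMC ξ)) :=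
  { f.toHom.twist ξ with
    contE := f.contE
    contO := f.contO }

lemma isLimit_ker {ι : Type w} {κ : Type w'} [Preorder ι] [IsDirectedOrder ι] [Preorder κ]
    {M : Type v} {M' : Type v'} [AddCommGroup M] [Module k M] [AddCommGroup M'] [Module k M']
    {I : ι → Submodule k M} {J : κ → Submodule k M'} (hI : IsLimit I) (hJ : IsLimit J)
    (f : M →ₗ[k] M') (hf : Cont I J f) :
    IsLimit fun i => (I i).comap (LinearMap.ker f).subtype where
  separated x hx := Subtype.ext (hI.separated x.1 hx)
  complete x hx := by
    obtain ⟨y, hy⟩ := hI.complete (fun i => (x i).1) hx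
    have hy0 : f y = 0 := by
      refine hJ.separated _ fun j => ?_
      obtain ⟨i, hi⟩ := hf j
      have := hi _ (hy i)
      rwa [map_sub, LinearMap.mem_ker.1 (x i).2, sub_zero] at this
    exact ⟨⟨y, hy0⟩, hy⟩

/-- The kernel of a morphism of pronilpotent dglas, with the induced system of ideals. -/
abbrev ker (f : Hom A B) : PronilpotentDGLA.{u, v, w} k :=
  { f.toHom.ker with
    ι := A.ι
    nonempty := A.nonempty
    filE := fun i => (A.filE i).comap (LinearMap.ker f.mapE).subtype
    filO := fun i => (A.filO i).comap (LinearMap.ker f.mapO).subtype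
    antiE := fun i j h _ hx => A.antiE i j h hx
    antiO := fun i j h _ hx => A.antiO i j h hx
    idealEE := fun i x y hy => A.idealEE i x.1 y.1 hy
    idealEO := fun i x y hy => A.idealEO i x.1 y.1 hy
    idealEO' := fun i x hx u => A.idealEO' i x.1 hx u.1
    idealOO := fun i x y hy => A.idealOO i x.1 y.1 hy
    dE_mem := fun i x hx => A.dE_mem i x.1 hx
    dO_mem := fun i x hx => A.dO_mem i x.1 hx
    nilpotent := fun i => by
      obtain ⟨N, h1, h2⟩ := A.nilpotent i
      have h := DGLA.lcs_map (A := f.toHom.ker) (B := A.toDGLA) (LinearMap.ker f.mapE).subtype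
        (LinearMap.ker f.mapO).subtype (fun _ _ => rfl) (fun _ _ => rfl) (fun _ _ => rfl) N
      exact ⟨N, h.1.trans (Submodule.comap_mono h1), h.2.trans (Submodule.comap_mono h2)⟩
    limitE := isLimit_ker A.limitE B.limitE f.mapE f.contE
    limitO := isLimit_ker A.limitO B.limitO f.mapO f.contO }

end Hom

/-! ## Polynomial homotopies and the Maurer–Cartan moduli set -/

/-- The dgla `lim (𝔤 / 𝔤_i)[z]` of restricted series `∑ aₙ zⁿ` with `aₙ → 0`, with `z` constant. -/
abbrev series (A : PronilpotentDGLA.{u, v, w} k) : DGLA.{u, v} k where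
  Ev := nullSeq A.filE
  Od := nullSeq A.filO
  lieEE := seqMul A.lieEE A.idealEE' A.idealEE
  lieEO := seqMul A.lieEO A.idealEO' A.idealEO
  lieOO := seqMul A.lieOO A.idealOO' A.idealOO
  skew a b := by
    ext n
    rw [seqMul_apply, Submodule.coe_neg, Pi.neg_apply, seqMul_apply, ← Finset.sum_neg_distrib,
      ← Finset.Nat.sum_antidiagonal_swap]
    exact Finset.sum_congr rfl fun p _ => A.skew _ _
  symm a b := by
    ext n
    rw [seqMul_apply, seqMul_apply, ← Finset.Nat.sum_antidiagonal_swap]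
    exact Finset.sum_congr rfl fun p _ => A.symm _ _
  jacEEE a b c := by
    ext n
    have h := tri_swap (fun i j l => A.lieEE (b.1 i) (A.lieEE (a.1 j) (c.1 l))) n
    rw [Submodule.coe_add, Pi.add_apply, seqMul_right, seqMul_left, seqMul_right, ← h, ← tri_add]
    exact congrArg (tri · n) (by funext i j l; exact A.jacEEE _ _ _)
  jacEEO a b c := by
    ext n
    have h := tri_swap (fun i j l => A.lieEO (b.1 i) (A.lieEO (a.1 j) (c.1 l))) n
    rw [Submodule.coe_add, Pi.add_apply, seqMul_right, seqMul_left, seqMul_right, ← h, ← tri_add]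
    exact congrArg (tri · n) (by funext i j l; exact A.jacEEO _ _ _)
  jacEOO a b c := by
    ext n
    have h := tri_swap (fun i j l => A.lieOO (b.1 i) (A.lieEO (a.1 j) (c.1 l))) n
    rw [Submodule.coe_add, Pi.add_apply, seqMul_right, seqMul_left, seqMul_right, ← h, ← tri_add]
    exact congrArg (tri · n) (by funext i j l; exact A.jacEOO _ _ _)
  jacOOO a b c := by
    ext n
    rw [Submodule.coe_add, Submodule.coe_add, Pi.add_apply, Pi.add_apply, seqMul_left,
      seqMul_left, seqMul_left, ← tri_rot (fun i j l => A.lieEO (A.lieOO (c.1 i) (a.1 j)) (b.1 l)),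
      ← tri_rot (fun i j l => A.lieEO (A.lieOO (b.1 i) (c.1 j)) (a.1 l)),
      ← tri_rot (fun i j l => A.lieEO (A.lieOO (b.1 l) (c.1 i)) (a.1 j)), ← tri_add, ← tri_add]
    simp only [A.jacOOO, tri, Finset.sum_const_zero]
    rfl
  dE := seqMap A.dE A.cont_dE
  dO := seqMap A.dO A.cont_dO
  dO_dE a := by ext n; exact A.dO_dE _
  dE_dO a := by ext n; exact A.dE_dO _
  leibEE a b := by
    ext n
    simp only [seqMul_apply, seqMap_apply, map_sum, Submodule.coe_add, Submodule.coe_neg,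
      Pi.add_apply, Pi.neg_apply, A.leibEE, Finset.sum_add_distrib, Finset.sum_neg_distrib]
    rw [← Finset.Nat.sum_antidiagonal_swap]
    rfl
  leibEO a b := by
    ext n
    simp only [seqMul_apply, seqMap_apply, map_sum, Submodule.coe_add,
      Pi.add_apply, A.leibEO, Finset.sum_add_distrib]
  leibOO a b := by
    ext n
    simp only [seqMul_apply, seqMap_apply, map_sum, Submodule.coe_add,
      Pi.add_apply, A.leibOO, Finset.sum_add_distrib]
    congr 1
    rw [← Finset.Nat.sum_antidiagonal_swap]
    rfl

/-- The dgla `𝔤[z, dz] = lim (𝔤 / 𝔤_i) ⊗ k[z, dz]`, where `|z| = 0`, `|dz| = 1` and `d(z) = dz`. -/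
abbrev forms (A : PronilpotentDGLA.{u, v, w} k) : DGLA.{u, v} k :=
  A.series.adjoinDz (deriv A.filE) (deriv A.filO) (deriv_seqMul A.lieEE A.idealEE' A.idealEE)
    (deriv_seqMul A.lieEO A.idealEO' A.idealEO) (deriv_seqMul A.lieOO A.idealOO' A.idealOO)
    (fun x => by ext n; exact (map_smul A.dE _ _).symm)
    (fun x => by ext n; exact (map_smul A.dO _ _).symm)

/-- The value `h|₀` of an odd element `h = ∑ aₙ zⁿ + (∑ bₙ zⁿ) dz` of `𝔤[z, dz]`. -/
def evalZero (A : PronilpotentDGLA.{u, v, w} k) (h : A.forms.Od) : A.Od :=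
  (h : nullSeq A.filO × nullSeq A.filE).1.1 0

/-- The value `h|₁ = ∑ aₙ` of an odd element `h = ∑ aₙ zⁿ + (∑ bₙ zⁿ) dz` of `𝔤[z, dz]`. -/
noncomputable def evalOne (A : PronilpotentDGLA.{u, v, w} k) (h : A.forms.Od) : A.Od :=
  Filtered.tsum A.filO (h : nullSeq A.filO × nullSeq A.filE).1.1

/-- Homotopy of Maurer–Cartan elements. -/
def Homotopic (A : PronilpotentDGLA.{u, v, w} k) (ξ η : A.MC) : Prop :=
  ∃ h : A.forms.MC, A.evalZero h.1 = ξ.1 ∧ A.evalOne h.1 = η.1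

/-- The Maurer–Cartan moduli set: Maurer–Cartan elements modulo the equivalence relation generated
by homotopy. -/
def MCmod (A : PronilpotentDGLA.{u, v, w} k) : Type v := Quot A.Homotopic

/-- The class of a Maurer–Cartan element in the moduli set. -/
def cls (A : PronilpotentDGLA.{u, v, w} k) (ξ : A.MC) : A.MCmod := Quot.mk _ ξ

namespace Hom

variable {A : PronilpotentDGLA.{u, v, w} k} {B : PronilpotentDGLA.{u, v', w'} k}

lemma seq_lieEE (f : Hom A B) (a b : A.series.Ev) :
    seqMap f.mapE f.contE (A.series.lieEE a b) =
      B.series.lieEE (seqMap f.mapE f.contE a) (seqMap f.mapE f.contE b) :=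
  seqMap_seqMul A.lieEE A.idealEE' A.idealEE B.lieEE B.idealEE' B.idealEE _ _ _ f.contE f.contE
    f.contE f.map_lieEE a b

lemma seq_lieEO (f : Hom A B) (a : A.series.Ev) (b : A.series.Od) :
    seqMap f.mapO f.contO (A.series.lieEO a b) =
      B.series.lieEO (seqMap f.mapE f.contE a) (seqMap f.mapO f.contO b) :=
  seqMap_seqMul A.lieEO A.idealEO' A.idealEO B.lieEO B.idealEO' B.idealEO _ _ _ f.contE f.contO
    f.contO f.map_lieEO a b

lemma seq_lieOO (f : Hom A B) (a b : A.series.Od) :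
    seqMap f.mapE f.contE (A.series.lieOO a b) =
      B.series.lieOO (seqMap f.mapO f.contO a) (seqMap f.mapO f.contO b) :=
  seqMap_seqMul A.lieOO A.idealOO' A.idealOO B.lieOO B.idealOO' B.idealOO _ _ _ f.contO f.contO
    f.contE f.map_lieOO a b

/-- The morphism `𝔤[z, dz] → 𝔥[z, dz]` induced by `𝔤 → 𝔥`. -/
def mapForms (f : Hom A B) : DGLA.Hom A.forms B.forms where
  mapE := LinearMap.prodMap (seqMap f.mapE f.contE) (seqMap f.mapO f.contO)
  mapO := LinearMap.prodMap (seqMap f.mapO f.contO) (seqMap f.mapE f.contE)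
  map_lieEE x y := by
    refine Prod.ext (f.seq_lieEE _ _)
      ((map_sub (seqMap f.mapO f.contO) _ _).trans (congrArg₂ _ ?_ ?_)) <;>
    exact f.seq_lieEO _ _
  map_lieEO x u := by
    refine Prod.ext (f.seq_lieEO _ _)
      ((map_sub (seqMap f.mapE f.contE) _ _).trans (congrArg₂ _ ?_ ?_))
    · exact f.seq_lieEE _ _
    · exact f.seq_lieOO _ _
  map_lieOO u v := by
    refine Prod.ext (f.seq_lieOO _ _)
      ((map_neg (seqMap f.mapO f.contO) _).trans (congrArg _
        ((map_add (seqMap f.mapO f.contO) _ _).trans (congrArg₂ _ ?_ ?_)))) <;>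
    exact f.seq_lieEO _ _
  map_dE x := by
    refine Prod.ext ?_ ((map_add (seqMap f.mapE f.contE) _ _).trans (congrArg₂ _ ?_ ?_))
    · ext n; exact f.map_dE _
    · ext n; exact f.map_dO _
    · ext n; exact map_smul f.mapE _ _
  map_dO u := by
    refine Prod.ext ?_ ((map_sub (seqMap f.mapO f.contO) _ _).trans (congrArg₂ _ ?_ ?_))
    · ext n; exact f.map_dO _
    · ext n; exact f.map_dE _
    · ext n; exact map_smul f.mapO _ _

/-- The map `MCmod(𝔤) → MCmod(𝔥)` induced by `𝔤 → 𝔥`. -/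
def mapMCmod (f : Hom A B) : A.MCmod → B.MCmod :=
  Quot.map f.mapMC (by
    rintro ξ η ⟨h, h0, h1⟩
    refine ⟨f.mapForms.mapMC h, ?_, ?_⟩
    · exact congrArg f.mapO h0
    · have := (isSum_tsum A.limitO A.antiO h.1.1.2).map f.contO
      exact (this.tsum_eq B.limitO).trans (congrArg f.mapO h1))

end Hom

/-! ## The gauge action and the group `exp(H⁰)` -/

/-- The gauge action
`e^y · ξ = ξ + ∑_{n ≥ 1} (1 / n!) (ad y)^(n-1) (ad(y) ξ - dy)` of an even element `y`. -/
noncomputable def gauge (A : PronilpotentDGLA.{u, v, w} k) (y : A.Ev) (ξ : A.Od) : A.Od :=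
  ξ + Filtered.tsum A.filO fun n =>
    (((n + 1).factorial : k))⁻¹ • (A.lieEO y ^ n) (A.lieEO y ξ - A.dE y)

/-- The series in the definition of the gauge action converges. -/
lemma gauge_isSum (A : PronilpotentDGLA.{u, v, w} k) (y : A.Ev) (ξ : A.Od) :
    IsSum A.filO (fun n => (((n + 1).factorial : k))⁻¹ • (A.lieEO y ^ n) (A.lieEO y ξ - A.dE y))
      (A.gauge y ξ - ξ) := by
  rw [gauge, add_sub_cancel_left]
  refine isSum_tsum A.limitO A.antiO fun i => ?_
  obtain ⟨N, hN⟩ := A.nilpotent i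
  exact ⟨N, fun n hn => (A.filO i).smul_mem _
    (hN.2 ((A.lcs_antitone hn).2 (A.lieEO_pow_mem_lcs _ _ n)))⟩

/-- The Baker–Campbell–Hausdorff product `x • y` on the even part. -/
noncomputable def bch (A : PronilpotentDGLA.{u, v, w} k) (x y : A.Ev) : A.Ev :=
  Filtered.tsum A.filE fun n => A.bchTerm n x y

/-- The Baker–Campbell–Hausdorff series converges. -/
lemma bch_isSum (A : PronilpotentDGLA.{u, v, w} k) (x y : A.Ev) :
    IsSum A.filE (fun n => A.bchTerm n x y) (A.bch x y) := by
  refine isSum_tsum A.limitE A.antiE fun i => ?_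
  obtain ⟨N, hN⟩ := A.nilpotent i
  refine ⟨N + 1, fun n hn => hN.1 ?_⟩
  refine A.bchTerm_mem n x y _ fun l hl _ => ?_
  exact (A.lcs_antitone (by omega)).1 (A.nested_mem_lcs l)

lemma dE_nested (A : DGLA.{u, v} k) (l : List A.Ev) (h : ∀ z ∈ l, A.dE z = 0) :
    A.dE (A.nested l) = 0 := by
  induction l with
  | nil => exact map_zero _
  | cons x l ih =>
    cases l with
    | nil => exact h x (by simp)
    | cons y l =>
      have h1 := ih fun z hz => h z (List.mem_cons_of_mem _ hz)
      have h2 := h x (by simp)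
      change A.dE (A.lieEE x (A.nested (y :: l))) = 0
      rw [A.leibEE, h1, h2, map_zero, map_zero, neg_zero, add_zero]

/-- The Baker–Campbell–Hausdorff product of two cocycles is a cocycle. -/
lemma bch_mem_Z0 (A : PronilpotentDGLA.{u, v, w} k) (x y : A.Z0) : A.bch x y ∈ A.Z0 := by
  have h := (A.bch_isSum x y).map (J := A.filO) (f := A.dE) A.cont_dE
  have h0 : ∀ n, A.dE (A.bchTerm n x y) = 0 := fun n =>
    A.bchTerm_mem n x.1 y.1 A.Z0 fun l _ hl => dE_nested _ l fun z hz => by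
      rcases hl z hz with rfl | rfl
      exacts [x.2, y.2]
  simp only [h0] at h
  refine IsSum.unique A.limitO h fun i => ⟨0, fun n _ => ?_⟩
  simp

/-- The Baker–Campbell–Hausdorff product on the Lie algebra of even cocycles. -/
noncomputable def bchZ (A : PronilpotentDGLA.{u, v, w} k) (x y : A.Z0) : A.Z0 :=
  ⟨A.bch x y, A.bch_mem_Z0 x y⟩

/-- The set `exp(H⁰(𝔤)) = {e^c : c ∈ H⁰(𝔤)}` of formal exponentials. -/
@[ext] structure ExpH0 (A : PronilpotentDGLA.{u, v, w} k) where
  log : A.H0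

/-- The element `e^[x]` for an even cocycle `x`. -/
def expCls (A : PronilpotentDGLA.{u, v, w} k) (x : A.Z0) : A.ExpH0 := ⟨Submodule.Quotient.mk x⟩

/-! ## The twisted kernel -/

variable [CharZero k]

/-- The twisted kernel `𝔨^ξ`: the kernel of `f` with the differential `d^ξ = d + ad ξ`. -/
abbrev twistedKer {A : PronilpotentDGLA.{u, v, w} k} {B : PronilpotentDGLA.{u, v', w'} k}
    (f : Hom A B) (ξ : A.MC) : PronilpotentDGLA.{u, v, w} k := (f.twist ξ).ker

/-- The element of `𝔤` underlying an odd element of `𝔨^ξ`. -/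
def inclO {A : PronilpotentDGLA.{u, v, w} k} {B : PronilpotentDGLA.{u, v', w'} k}
    (f : Hom A B) (ξ : A.MC) (η : (twistedKer f ξ).Od) : A.Od :=
  (show LinearMap.ker f.mapO from η).1

/-- The map `MC(𝔨^ξ) → MC(𝔤)`, `η ↦ η + ξ`. -/
def lift {A : PronilpotentDGLA.{u, v, w} k} {B : PronilpotentDGLA.{u, v', w'} k}
    (f : Hom A B) (ξ : A.MC) (η : (twistedKer f ξ).MC) : A.MC :=
  ⟨inclO f ξ η.1 + ξ.1, by
    have h1 : A.dO (inclO f ξ η.1) + A.lieOO ξ.1 (inclO f ξ η.1) +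
        (2 : k)⁻¹ • A.lieOO (inclO f ξ η.1) (inclO f ξ η.1) = 0 := congrArg Subtype.val η.2
    have h2 := ξ.2
    generalize inclO f ξ η.1 = e at h1
    have h3 : (2 : k)⁻¹ • A.lieOO (e + ξ.1) (e + ξ.1) = (2 : k)⁻¹ • A.lieOO e e + A.lieOO ξ.1 e +
        (2 : k)⁻¹ • A.lieOO ξ.1 ξ.1 := by
      have : A.lieOO (e + ξ.1) (e + ξ.1) =
          A.lieOO e e + (2 : k) • A.lieOO ξ.1 e + A.lieOO ξ.1 ξ.1 := by
        simp only [map_add, LinearMap.add_apply, A.symm e ξ.1, two_smul]; abel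
      rw [this, smul_add, smul_add, smul_smul, inv_mul_cancel₀ two_ne_zero, one_smul]
    have h4 := congrArg₂ (· + ·) h1 h2
    simp only [add_zero] at h4
    rw [h3, map_add]
    refine Eq.trans ?_ h4
    abel⟩

end PronilpotentDGLA

/-! Two facts carry the theorem: homotopy of Maurer–Cartan elements is the same relation as gauge
equivalence (`cls_eq_iff`), and `e^(x • y) · ξ = e^x · (e^y · ξ)` (`gauge_bch`). Granting them, the
rest is a statement about orbits. Translation by `ξ` identifies `MC(𝔨^ξ)` with the elements of
`MC(𝔤)` lying strictly over `ξ₀`, and it turns the classes of `𝔨^ξ` into orbits of `exp(ker f)`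
(`exists_lift_eq`, `cls_twistedKer_eq_iff`). An element `e^y` preserves this fibre exactly when
`e^(f y)` fixes `ξ₀`, that is, when `f y` is a cocycle of `𝔥^ξ₀`. A coboundary `d^ξ₀ u` lifts to
`d^ζ u'` for any `ζ` over `ξ₀`, and such an element fixes `ζ`; hence only the class of `f y` in `H⁰`
matters (`cls_gauge_eq`). Any element over the class of `ξ₀` can be moved strictly over `ξ₀` by
lifting a gauge transformation along the surjection `f`.

For the two facts, the affine gauge action is made linear: on `W = 𝔤⁰ ⊕ 𝔤¹ ⊕ k` the operator
`e^ρ(y)` sends `(0, ξ, 1)` to `(0, e^y · ξ, 1)`. The basic computation is the derivative of the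
exponential (`comm_expW`): if `[D, ρ(y)] = ρ(x)`, then `D e^y = ρ(φ(y) x) e^y + e^y D` with `φ(y) =
(e^(ad y) - 1) / ad y`. With `D = d/dz` on restricted series, paths of gauge transformations are
governed by the equation `φ(w) w' = b`, `w(0) = 0`, which has a unique solution by a contraction
argument (`existsUnique_phi_deriv`).

For `b = x + e^(z ad x) y` the solution satisfies `e^w = e^(zx) e^(zy)`. Inverting `φ` through the
logarithm series in `e^(ad w) - 1` gives `w' = ∑ (-1)^m / (m + 1) (e^(z ad x) e^(z ad y) - 1)^m b`,
whose coefficients are Dynkin's (`coeff_eq_bchTerm`); the value at `z = 1` yields the composition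
law. For a homotopy `a + b dz`, the solution for `-b` in place of `b` exhibits `a` as the path `e^w
· ξ`.

Associativity of `•` is read off from the gauge action in the auxiliary dgla `𝔤⁰[z] ⊕ 𝔤⁰[z] dz`,
where the orbit of `0` records `φ(w) w'` and therefore `w`. -/

namespace Filtered

open Finset

variable {k : Type u} [Field k] {ι : Type w} {M : Type v} [AddCommGroup M] [Module k M]

/-! ### Convergent series, contractions and Cauchy products in a linear topology -/

section sums

variable {I : ι → Submodule k M} {a b : ℕ → M} {s t : M}

lemma IsSum.sub_sum_mem (hs : IsSum I a s) {i : ι} {N : ℕ} (h : ∀ n ≥ N, a n ∈ I i) :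
    s - ∑ m ∈ range N, a m ∈ I i := by
  obtain ⟨K, hK⟩ := hs i
  simpa using (I i).add_mem (hK _ (le_max_left K N)) (sum_sub_sum_mem h (le_max_right K N))

lemma IsSum.mem (hs : IsSum I a s) {J : Submodule k M} {i : ι} (hJ : I i ≤ J)
    (h : ∀ n, a n ∈ J) : s ∈ J := by
  obtain ⟨K, hK⟩ := hs i
  simpa using J.add_mem (hJ (hK K le_rfl)) (J.sum_mem fun m (_ : m ∈ range K) => h m)

lemma IsSum.add (hs : IsSum I a s) (ht : IsSum I b t) : IsSum I (fun n => a n + b n) (s + t) := by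
  intro i
  obtain ⟨N, hN⟩ := hs i
  obtain ⟨N', hN'⟩ := ht i
  refine ⟨max N N', fun n hn => ?_⟩
  have := (I i).add_mem (hN n (le_of_max_le_left hn)) (hN' n (le_of_max_le_right hn))
  rw [sum_add_distrib]
  convert this using 1
  abel

lemma IsSum.smul (c : k) (hs : IsSum I a s) : IsSum I (fun n => c • a n) (c • s) := by
  intro i
  obtain ⟨N, hN⟩ := hs i
  refine ⟨N, fun n hn => ?_⟩
  rw [← smul_sum, ← smul_sub]
  exact (I i).smul_mem c (hN n hn)

lemma IsSum.sub (hs : IsSum I a s) (ht : IsSum I b t) : IsSum I (fun n => a n - b n) (s - t) := by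
  simpa [sub_eq_add_neg] using hs.add (ht.smul (-1))

lemma isSum_of_eventually_zero {N : ℕ} (h : ∀ n ≥ N, a n = 0) :
    IsSum I a (∑ m ∈ range N, a m) := fun i => ⟨N, fun n hn => by
  rw [← (I i).neg_mem_iff, neg_sub]
  exact sum_sub_sum_mem (fun m hm => by rw [h m hm]; exact (I i).zero_mem) hn⟩

lemma IsSum.of_succ (hs : IsSum I (fun n => a (n + 1)) s) : IsSum I a (a 0 + s) := by
  intro i
  obtain ⟨N, hN⟩ := hs i
  refine ⟨N + 1, fun n hn => ?_⟩
  obtain ⟨n, rfl⟩ : ∃ m, n = m + 1 := ⟨n - 1, by omega⟩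
  rw [sum_range_succ', add_comm (a 0), add_sub_add_right_eq_sub]
  exact hN n (by omega)

lemma IsSum.mem_nullSeq (hs : IsSum I a s) : a ∈ nullSeq I := by
  intro i
  obtain ⟨N, hN⟩ := hs i
  refine ⟨N, fun n hn => ?_⟩
  have := (I i).sub_mem (hN n hn) (hN (n + 1) (by omega))
  rwa [sum_range_succ, sub_sub_sub_cancel_left, add_sub_cancel_left] at this

/-- Summation of a double series along antidiagonals. -/
lemma IsSum.double {F : ℕ → ℕ → M} (hF : ∀ i, ∃ N, ∀ p q, N ≤ p ∨ N ≤ q → F p q ∈ I i)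
    {r : ℕ → M} (hr : ∀ p, IsSum I (F p) (r p)) (hs : IsSum I r s) :
    IsSum I (fun n => ∑ p ∈ HasAntidiagonal.antidiagonal n, F p.1 p.2) s := by
  intro i
  obtain ⟨N, hN⟩ := hF i
  have h1 : s - ∑ p ∈ range N, r p ∈ I i :=
    hs.sub_sum_mem fun p hp => (hr p).mem le_rfl fun q => hN p q (Or.inl hp)
  have h2 : ∑ p ∈ range N, r p - ∑ p ∈ range N, ∑ q ∈ range N, F p q ∈ I i := by
    rw [← sum_sub_distrib]
    exact (I i).sum_mem fun p _ => (hr p).sub_sum_mem fun q hq => hN p q (Or.inr hq)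
  -- The antidiagonals below `n ≥ 2N` cover the square `N × N`, and every further term on them has
  -- an index at least `N`.
  refine ⟨N + N, fun n hn => ?_⟩
  have h3 : ∑ m ∈ range n, ∑ p ∈ HasAntidiagonal.antidiagonal m, F p.1 p.2 -
      ∑ p ∈ range N, ∑ q ∈ range N, F p q ∈ I i := by
    rw [← sum_product', ← sum_fiberwise_of_maps_to (t := range n) (g := fun p : ℕ × ℕ => p.1 + p.2)
      (fun p hp => by simp at hp ⊢; omega), ← sum_sub_distrib]
    refine (I i).sum_mem fun m _ => ?_
    have hsub : (range N ×ˢ range N).filter (fun p : ℕ × ℕ => p.1 + p.2 = m) ⊆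
        HasAntidiagonal.antidiagonal m := fun p hp => by simp at hp ⊢; omega
    rw [← sum_sdiff hsub, add_sub_cancel_right]
    refine (I i).sum_mem fun p hp => hN _ _ ?_
    simp at hp
    omega
  have := (I i).sub_mem ((I i).add_mem h1 h2) h3
  convert this using 1
  abel

end sums

section limits

variable [Preorder ι] {I : ι → Submodule k M}

/-- Two vectors agree if they agree modulo all members of the filtration. -/
lemma IsLimit.eq (hI : IsLimit I) {x y : M} (h : ∀ i, x - y ∈ I i) : x = y :=
  sub_eq_zero.1 (hI.separated _ h)

/-- The sum of a null sequence, as a linear map. -/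
noncomputable def sumMap (hI : IsLimit I) (hanti : ∀ i j, i ≤ j → I j ≤ I i) :
    nullSeq I →ₗ[k] M where
  toFun a := tsum I a.1
  map_add' a b := ((isSum_tsum hI hanti a.2).add (isSum_tsum hI hanti b.2)).tsum_eq hI
  map_smul' c a := ((isSum_tsum hI hanti a.2).smul c).tsum_eq hI

lemma isSum_sumMap (hI : IsLimit I) (hanti : ∀ i j, i ≤ j → I j ≤ I i) (a : nullSeq I) :
    IsSum I a.1 (sumMap hI hanti a) := isSum_tsum hI hanti a.2

/-- A contraction with respect to chains of subspaces refining the filtration has a unique fixed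
point. -/
lemma exists_fixedPoint (hI : IsLimit I) (hanti : ∀ i j, i ≤ j → I j ≤ I i) (Φ : M → M)
    (K : ι → ℕ → Submodule k M) (h0 : ∀ i, K i 0 = ⊤) (hK : ∀ i n, I i ≤ K i n)
    (hN : ∀ i, ∃ N, ∀ n ≥ N, K i n ≤ I i)
    (hΦ : ∀ i n x y, x - y ∈ K i n → Φ x - Φ y ∈ K i (n + 1)) : ∃! x, Φ x = x := by
  -- The increments of the iteration tend to `0`, and their sum telescopes to the limit of the
  -- iterates. The condition `K i 0 = ⊤` starts the induction.
  have hit : ∀ i n, Φ^[n + 1] 0 - Φ^[n] 0 ∈ K i n := by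
    intro i n
    induction n with
    | zero => rw [h0]; trivial
    | succ n ih =>
      rw [Function.iterate_succ_apply' _ (n + 1), Function.iterate_succ_apply' _ n]
      rw [Function.iterate_succ_apply' _ n] at ih
      exact hΦ i n _ _ ih
  have hnull : (fun n => Φ^[n + 1] 0 - Φ^[n] 0) ∈ nullSeq I := fun i => by
    obtain ⟨N, hN⟩ := hN i
    exact ⟨N, fun n hn => hN n hn (hit i n)⟩
  have hs := isSum_tsum hI hanti hnull
  set s := tsum I (fun n => Φ^[n + 1] 0 - Φ^[n] 0)
  have hsum : ∀ n, ∑ m ∈ range n, (Φ^[m + 1] 0 - Φ^[m] 0) = Φ^[n] 0 := fun n =>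
    (sum_range_sub (fun m => Φ^[m] (0 : M)) n).trans (sub_zero _)
  -- Modulo `I i`, the limit `s` agrees with two consecutive late iterates; since `Φ` contracts, `Φ
  -- s` agrees with the later of the two.
  have hfix : Φ s = s := hI.eq fun i => by
    obtain ⟨N, hN⟩ := hN i
    obtain ⟨N', hN'⟩ := hs i
    have h1 := hN' N' le_rfl
    have h2 := hN' (N' + 1) (by omega)
    rw [hsum] at h1 h2
    rw [Function.iterate_succ_apply'] at h2
    simpa using (I i).sub_mem (hN (N + 1) (by omega) (hΦ i N _ _ (hK i N h1))) h2
  refine ⟨s, hfix, fun y hy => hI.eq fun i => ?_⟩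
  have : ∀ n, y - s ∈ K i n := by
    intro n
    induction n with
    | zero => rw [h0]; trivial
    | succ n ih => rw [← hfix, ← hy]; exact hΦ i n _ _ ih
  obtain ⟨N, hN⟩ := hN i
  exact hN N le_rfl (this N)

end limits

section cauchy

variable {M₁ : Type*} {M₂ : Type*} [AddCommGroup M₁] [Module k M₁] [AddCommGroup M₂] [Module k M₂]
  {J : ι → Submodule k M₁} {K : ι → Submodule k M₂} {I : ι → Submodule k M}

/-- The Cauchy product of convergent series. -/
lemma IsSum.cauchy (B : M₁ →ₗ[k] M₂ →ₗ[k] M) (hl : ∀ i, ∀ x ∈ J i, ∀ y, B x y ∈ I i)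
    (hr : ∀ i, ∀ x, ∀ y ∈ K i, B x y ∈ I i) {a : ℕ → M₁} {b : ℕ → M₂} {s : M₁} {t : M₂}
    (ha : IsSum J a s) (hb : IsSum K b t) :
    IsSum I (fun n => ∑ p ∈ HasAntidiagonal.antidiagonal n, B (a p.1) (b p.2)) (B s t) := by
  refine IsSum.double (F := fun p q => B (a p) (b q)) (r := fun p => B (a p) t) (fun i => ?_)
    (fun p => hb.map (f := B (a p)) fun i => ⟨i, hr i _⟩)
    (ha.map (f := B.flip t) fun i => ⟨i, fun x hx => hl i x hx t⟩)
  obtain ⟨N, hN⟩ := ha.mem_nullSeq i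
  obtain ⟨N', hN'⟩ := hb.mem_nullSeq i
  refine ⟨max N N', fun p q h => ?_⟩
  rcases h with h | h
  · exact hl i _ (hN p (le_of_max_le_left h)) _
  · exact hr i _ _ (hN' q (le_of_max_le_right h))

end cauchy

/-! ### Power series in a topologically nilpotent operator -/

/-- An operator which preserves the filtration and whose powers tend to `0` uniformly. -/
structure TopNil (I : ι → Submodule k M) (T : Module.End k M) : Prop where
  stable : ∀ i, ∀ v ∈ I i, T v ∈ I i
  nil : ∀ i, ∃ N, ∀ n ≥ N, ∀ v, (T ^ n) v ∈ I i

section operators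

variable {I : ι → Submodule k M} {T : Module.End k M}

lemma TopNil.pow_stable (hT : TopNil I T) (n : ℕ) (i : ι) (v : M) (hv : v ∈ I i) :
    (T ^ n) v ∈ I i := by
  induction n with
  | zero => exact hv
  | succ n ih => rw [pow_succ', Module.End.mul_apply]; exact hT.stable i _ ih

lemma TopNil.null (hT : TopNil I T) (p : PowerSeries k) (v : M) :
    (fun n => p.coeff n • (T ^ n) v) ∈ nullSeq I := fun i => by
  obtain ⟨N, hN⟩ := hT.nil i
  exact ⟨N, fun n hn => (I i).smul_mem _ (hN n hn v)⟩

variable [Preorder ι]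

/-- The operator `p(T) = ∑ pₙ Tⁿ`. -/
noncomputable def opSum (hI : IsLimit I) (hanti : ∀ i j, i ≤ j → I j ≤ I i) (hT : TopNil I T)
    (p : PowerSeries k) : Module.End k M where
  toFun v := tsum I fun n => p.coeff n • (T ^ n) v
  map_add' v w := by
    have := (isSum_tsum hI hanti (hT.null p v)).add (isSum_tsum hI hanti (hT.null p w))
    simp only [← smul_add, ← map_add] at this
    exact this.tsum_eq hI
  map_smul' c v := by
    have := (isSum_tsum hI hanti (hT.null p v)).smul c
    simp only [smul_comm c (p.coeff _), ← map_smul (T ^ _) c] at this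
    exact this.tsum_eq hI

variable (hI : IsLimit I) (hanti : ∀ i j, i ≤ j → I j ≤ I i) (hT : TopNil I T)

lemma opSum_isSum (p : PowerSeries k) (v : M) :
    IsSum I (fun n => p.coeff n • (T ^ n) v) (opSum hI hanti hT p v) :=
  isSum_tsum hI hanti (hT.null p v)

lemma opSum_eq {p : PowerSeries k} {v s : M} (h : IsSum I (fun n => p.coeff n • (T ^ n) v) s) :
    opSum hI hanti hT p v = s := h.tsum_eq hI

lemma opSum_add (p q : PowerSeries k) :
    opSum hI hanti hT (p + q) = opSum hI hanti hT p + opSum hI hanti hT q := by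
  ext v
  refine opSum_eq hI hanti hT ?_
  have := (opSum_isSum hI hanti hT p v).add (opSum_isSum hI hanti hT q v)
  simpa only [map_add, add_smul, LinearMap.add_apply] using this

lemma opSum_smul (c : k) (p : PowerSeries k) :
    opSum hI hanti hT (c • p) = c • opSum hI hanti hT p := by
  ext v
  refine opSum_eq hI hanti hT ?_
  have := (opSum_isSum hI hanti hT p v).smul c
  simpa only [map_smul, smul_eq_mul, mul_smul, LinearMap.smul_apply] using this

/-- The double series `pₘ qₙ Tᵐ⁺ⁿ v` is summed by rows on one side and by antidiagonals on the
other. This transports identities between formal power series, such as inverses, to operators. -/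
lemma opSum_mul (p q : PowerSeries k) :
    opSum hI hanti hT (p * q) = opSum hI hanti hT p * opSum hI hanti hT q := by
  ext v
  refine opSum_eq hI hanti hT ?_
  have h := IsSum.double (I := I) (F := fun m n => p.coeff m • (T ^ m) (q.coeff n • (T ^ n) v))
    (fun i => ?_) (fun m => (opSum_isSum hI hanti hT q v).map (J := I) (f := p.coeff m • T ^ m)
      fun i => ⟨i, fun x hx => (I i).smul_mem _ (hT.pow_stable m i x hx)⟩)
    (opSum_isSum hI hanti hT p (opSum hI hanti hT q v))
  · rw [Module.End.mul_apply]
    convert h using 2 with n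
    rw [PowerSeries.coeff_mul, sum_smul]
    refine sum_congr rfl fun x hx => ?_
    rw [map_smul, smul_smul, ← Module.End.mul_apply, ← pow_add, HasAntidiagonal.mem_antidiagonal.1 hx]
  · obtain ⟨N, hN⟩ := hT.nil i
    refine ⟨N, fun m n h => (I i).smul_mem _ ?_⟩
    rcases h with h | h
    · exact hN m h _
    · exact hT.pow_stable m i _ ((I i).smul_mem _ (hN n h v))

lemma opSum_X_pow (n : ℕ) : opSum hI hanti hT (PowerSeries.X ^ n) = T ^ n := by
  ext v
  refine opSum_eq hI hanti hT ?_
  have := isSum_of_eventually_zero (I := I) (N := n + 1)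
    (a := fun m => (PowerSeries.X ^ n : PowerSeries k).coeff m • (T ^ m) v) fun m hm => by
      simp only [PowerSeries.coeff_X_pow, if_neg (show m ≠ n by omega), zero_smul]
  simpa [PowerSeries.coeff_X_pow, sum_range_succ,
    sum_eq_zero fun m (hm : m ∈ range n) => show (if m = n then (1 : k) else 0) • (T ^ m) v = 0 by
      rw [if_neg (mem_range.1 hm).ne, zero_smul]] using this

lemma opSum_X : opSum hI hanti hT PowerSeries.X = T := by
  simpa using opSum_X_pow hI hanti hT 1

lemma opSum_one : opSum hI hanti hT 1 = 1 := by simpa using opSum_X_pow hI hanti hT 0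

lemma opSum_pow (p : PowerSeries k) (n : ℕ) :
    opSum hI hanti hT (p ^ n) = opSum hI hanti hT p ^ n := by
  induction n with
  | zero => simpa using opSum_one hI hanti hT
  | succ n ih => rw [pow_succ, pow_succ, opSum_mul, ih]

lemma opSum_sum {σ : Type*} (s : Finset σ) (p : σ → PowerSeries k) :
    opSum hI hanti hT (∑ i ∈ s, p i) = ∑ i ∈ s, opSum hI hanti hT (p i) := by
  classical
  induction s using Finset.induction_on with
  | empty => simpa using opSum_smul hI hanti hT 0 0
  | insert a s ha ih => rw [sum_insert ha, sum_insert ha, opSum_add, ih]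

/-- A vector killed by `T` is multiplied by the constant coefficient. -/
lemma opSum_of_apply_eq_zero (p : PowerSeries k) {v : M} (hv : T v = 0) :
    opSum hI hanti hT p v = p.coeff 0 • v := by
  refine opSum_eq hI hanti hT ?_
  have := isSum_of_eventually_zero (I := I) (N := 1)
    (a := fun m => p.coeff m • (T ^ m) v) fun m hm => by
      obtain ⟨m, rfl⟩ : ∃ j, m = j + 1 := ⟨m - 1, by omega⟩
      rw [pow_succ, Module.End.mul_apply, hv, map_zero, smul_zero]
  simpa using this

/-- Naturality of the functional calculus. -/
lemma map_opSum {κ : Type w'} [Preorder κ] {M' : Type v'} [AddCommGroup M'] [Module k M']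
    {J : κ → Submodule k M'} {T' : Module.End k M'} (hJ : IsLimit J)
    (hanti' : ∀ i j, i ≤ j → J j ≤ J i) (hT' : TopNil J T') (f : M →ₗ[k] M') (hf : Cont I J f)
    (h : ∀ v, f (T v) = T' (f v)) (p : PowerSeries k) (v : M) :
    f (opSum hI hanti hT p v) = opSum hJ hanti' hT' p (f v) := by
  symm
  refine opSum_eq hJ hanti' hT' ?_
  have hp : ∀ n v, f ((T ^ n) v) = (T' ^ n) (f v) := by
    intro n
    induction n with
    | zero => intro v; rfl
    | succ n ih => intro v; rw [pow_succ, pow_succ, Module.End.mul_apply, ih, h]; rfl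
  have := (opSum_isSum hI hanti hT p v).map hf
  simpa only [map_smul, hp] using this

end operators

/-! ### The exponential series and its logarithm -/

section series

open PowerSeries

variable (k)

/-- `e^X`. -/
def expS : PowerSeries k := PowerSeries.mk fun n => ((n.factorial : k))⁻¹

/-- `(e^X - 1) / X`. -/
def phiS : PowerSeries k := PowerSeries.mk fun n => (((n + 1).factorial : k))⁻¹

/-- The truncation `∑_{m < N} (-1)^m / (m + 1) (e^X - 1)^m` of `X / (e^X - 1)`. -/
noncomputable def logS (N : ℕ) : PowerSeries k :=
  ∑ m ∈ range N, ((-1 : k) ^ m / ((m + 1 : ℕ) : k)) • (expS k - 1) ^ m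

@[simp] lemma coeff_expS (n : ℕ) : (expS k).coeff n = ((n.factorial : k))⁻¹ := coeff_mk _ _

@[simp] lemma coeff_phiS (n : ℕ) : (phiS k).coeff n = (((n + 1).factorial : k))⁻¹ := coeff_mk _ _

lemma X_mul_phiS : X * phiS k = expS k - 1 := by
  ext n
  cases n with
  | zero => simp [coeff_zero_X_mul, -coeff_zero_eq_constantCoeff]
  | succ n => simp [coeff_succ_X_mul, coeff_one]

variable [CharZero k]

lemma derivative_expS : derivative k (expS k) = expS k := by
  ext n
  rw [coeff_derivative, coeff_expS, coeff_expS, Nat.factorial_succ]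
  have : ((n + 1 : ℕ) : k) ≠ 0 := Nat.cast_ne_zero.2 (by omega)
  push_cast at this ⊢
  field_simp

/-- The constant coefficient is `1`. Invertibility makes `φ(T)` injective, which recovers cocycles
from stabilisers of the gauge action. -/
lemma isUnit_phiS : IsUnit (phiS k) := by
  rw [PowerSeries.isUnit_iff_constantCoeff, ← coeff_zero_eq_constantCoeff_apply]
  simp

/-- Multiplied by `X`, the left side is the truncated series of `log (1 + (e^X - 1))`. Its
derivative is `e^X` times a geometric sum, namely `1 - (1 - e^X)^N`, which is `1` modulo `X^N`. In
characteristic zero the truncated logarithm is therefore `X` modulo `X^(N+1)`, and one factor `X`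
cancels. -/
lemma phiS_mul_logS (N : ℕ) : ∃ r, phiS k * logS k N = 1 + X ^ N * r := by
  have hP : derivative k (X * phiS k * logS k N) = 1 - (1 - expS k) ^ N := by
    have hterm : ∀ m : ℕ, derivative k (((-1 : k) ^ m / ((m + 1 : ℕ) : k)) • (expS k - 1) ^ (m + 1)) =
        (1 - expS k) ^ m * expS k := by
      intro m
      rw [Derivation.map_smul, Derivation.leibniz_pow, map_sub, derivative_expS, Derivation.map_one_eq_zero, sub_zero,
        Nat.add_sub_cancel, ← Nat.cast_smul_eq_nsmul k, smul_smul,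
        div_mul_cancel₀ _ (Nat.cast_ne_zero.2 (Nat.succ_ne_zero m)), smul_eq_mul,
        ← neg_sub (expS k) 1, neg_pow (expS k - 1), PowerSeries.smul_eq_C_mul]
      simp [mul_assoc]
    rw [X_mul_phiS, logS, mul_sum]
    simp_rw [mul_smul_comm, ← pow_succ']
    rw [map_sum, sum_congr rfl fun m _ => hterm m, ← sum_mul, ← mul_neg_geom_sum, mul_comm]
    congr 1
    ring
  have hdvd : X ^ (N + 1) ∣ X * phiS k * logS k N - X := by
    rw [X_pow_dvd_iff]
    intro m hm
    cases m with
    | zero => simp [mul_assoc]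
    | succ m =>
      have h1 := congrArg (coeff m) hP
      have h2 : (coeff m) ((1 - expS k) ^ N) = 0 := by
        refine X_pow_dvd_iff.1 (pow_dvd_pow_of_dvd ?_ N) m (by omega)
        rw [← neg_sub, ← X_mul_phiS]
        exact (Dvd.intro _ rfl).neg_right
      rw [coeff_derivative, map_sub, h2, sub_zero, coeff_one] at h1
      rw [map_sub, coeff_X]
      have : ((m : k) + 1) ≠ 0 := by exact_mod_cast Nat.succ_ne_zero m
      by_cases h : m = 0
      · subst h
        simpa [sub_eq_zero] using h1
      · rw [if_neg h] at h1
        rw [if_neg (by omega), sub_zero]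
        exact (mul_eq_zero.1 h1).resolve_right this
  obtain ⟨r, hr⟩ := hdvd
  refine ⟨r, ?_⟩
  have : (X : PowerSeries k) * (phiS k * logS k N) = X * (1 + X ^ N * r) := by
    rw [← mul_assoc, ← sub_add_cancel (X * phiS k * logS k N) X, hr]
    ring
  exact mul_left_cancel₀ X_ne_zero this

end series

end Filtered

namespace Filtered

open Finset

/-! ### Restricted series -/

section restricted

variable {k : Type u} [Field k] {ι : Type w} {M : Type v} [AddCommGroup M] [Module k M]
  (I : ι → Submodule k M)

/-- The restricted series with coefficients in a given subspace. -/
def coeffIn (J : Submodule k M) : Submodule k (nullSeq I) where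
  carrier := {a | ∀ n, a.1 n ∈ J}
  add_mem' ha hb n := J.add_mem (ha n) (hb n)
  zero_mem' _ := J.zero_mem
  smul_mem' c _ ha n := J.smul_mem c (ha n)

/-- The `n`-th coefficient of a restricted series. -/
def coeffMap (n : ℕ) : nullSeq I →ₗ[k] M where
  toFun a := a.1 n
  map_add' _ _ := rfl
  map_smul' _ _ := rfl

@[simp] lemma coeffMap_apply (n : ℕ) (a : nullSeq I) : coeffMap I n a = a.1 n := rfl

lemma coeffMap_cont (n : ℕ) : Cont (fun i => coeffIn I (I i)) I (coeffMap I n) :=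
  fun i => ⟨i, fun _ hx => hx n⟩

/-- Limits are formed coefficient by coefficient. The result is again a null sequence because modulo
`I i` it agrees with the null sequence `x i`. -/
lemma isLimit_coeffIn {I : ι → Submodule k M} [Preorder ι] (hI : IsLimit I) :
    IsLimit fun i => coeffIn I (I i) where
  separated x hx := Subtype.ext (funext fun n => hI.separated _ fun i => hx i n)
  complete x hx := by
    choose y hy using fun n => hI.complete (fun i => (x i).1 n) fun i j hij => hx i j hij n
    refine ⟨⟨y, fun i => ?_⟩, fun i n => hy n i⟩
    obtain ⟨N, hN⟩ := (x i).2 i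
    exact ⟨N, fun n hn => by simpa using (I i).add_mem (hy n i) (hN n hn)⟩

lemma coeffIn_mono {J J' : Submodule k M} (h : J ≤ J') : coeffIn I J ≤ coeffIn I J' :=
  fun _ ha n => h (ha n)

/-- The monomial `x zⁿ`. -/
def mon (n : ℕ) : M →ₗ[k] nullSeq I where
  toFun x := ⟨fun m => if m = n then x else 0, fun i => ⟨n + 1, fun m hm => by
    simp only [if_neg (show m ≠ n by omega), (I i).zero_mem]⟩⟩
  map_add' x y := by ext m; by_cases h : m = n <;> simp [h]
  map_smul' c x := by ext m; by_cases h : m = n <;> simp [h]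

lemma mon_apply (n : ℕ) (x : M) (m : ℕ) : (mon I n x).1 m = if m = n then x else 0 := rfl

/-- The formal integral `∑ aₙ zⁿ ↦ ∑ aₙ / (n + 1) zⁿ⁺¹`. -/
def integral : nullSeq I →ₗ[k] nullSeq I where
  toFun a := ⟨fun n => Nat.casesOn n 0 fun m => ((m : k) + 1)⁻¹ • a.1 m, fun i => by
    obtain ⟨N, hN⟩ := a.2 i
    refine ⟨N + 1, fun n hn => ?_⟩
    obtain ⟨n, rfl⟩ : ∃ m, n = m + 1 := ⟨n - 1, by omega⟩
    exact (I i).smul_mem _ (hN n (by omega))⟩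
  map_add' a b := by ext n; cases n <;> simp
  map_smul' c a := by ext n; cases n <;> simp [smul_comm c]

@[simp] lemma integral_zero (a : nullSeq I) : (integral I a).1 0 = 0 := rfl

@[simp] lemma integral_succ (a : nullSeq I) (n : ℕ) :
    (integral I a).1 (n + 1) = ((n : k) + 1)⁻¹ • a.1 n := rfl

lemma integral_mem {J : Submodule k M} {a : nullSeq I} (ha : a ∈ coeffIn I J) :
    integral I a ∈ coeffIn I J := by
  intro n
  cases n with
  | zero => exact J.zero_mem
  | succ n => exact J.smul_mem _ (ha n)

lemma deriv_mem {J : Submodule k M} {a : nullSeq I} (ha : a ∈ coeffIn I J) :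
    deriv I a ∈ coeffIn I J := fun n => J.smul_mem _ (ha (n + 1))

@[simp] lemma deriv_mon_zero (x : M) : deriv I (mon I 0 x) = 0 := by
  ext n; simp [mon_apply]

@[simp] lemma deriv_mon_one (x : M) : deriv I (mon I 1 x) = mon I 0 x := by
  ext n; by_cases h : n = 0 <;> simp [mon_apply, h]

lemma seqMap_deriv {κ : Type w'} {M' : Type v'} [AddCommGroup M'] [Module k M']
    {J : κ → Submodule k M'} (f : M →ₗ[k] M') (hf : Cont I J f) (a : nullSeq I) :
    seqMap f hf (deriv I a) = deriv J (seqMap f hf a) := by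
  ext n; exact map_smul f _ _

section char

variable [CharZero k]

lemma deriv_integral (a : nullSeq I) : deriv I (integral I a) = a := by
  ext n
  have : ((n : k) + 1) ≠ 0 := by exact_mod_cast Nat.succ_ne_zero n
  simp [smul_smul, this]

lemma integral_deriv {a : nullSeq I} (h : a.1 0 = 0) : integral I (deriv I a) = a := by
  ext n
  cases n with
  | zero => exact h.symm
  | succ n =>
    have : ((n : k) + 1) ≠ 0 := by exact_mod_cast Nat.succ_ne_zero n
    simp [smul_smul, this]

end char

section sum

variable {I} [Preorder ι] (hI : IsLimit I) (hanti : ∀ i j, i ≤ j → I j ≤ I i)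

lemma sumMap_mem {i : ι} {a : nullSeq I} (ha : a ∈ coeffIn I (I i)) : sumMap hI hanti a ∈ I i :=
  (isSum_sumMap hI hanti a).mem le_rfl ha

lemma sumMap_mon (n : ℕ) (x : M) : sumMap hI hanti (mon I n x) = x := by
  refine IsSum.tsum_eq hI ?_
  have := isSum_of_eventually_zero (I := I) (N := n + 1) (a := (mon I n x).1) fun m hm => by
    rw [mon_apply, if_neg (by omega)]
  simpa [mon_apply] using this

end sum

section mul

variable {M₁ M₂ M₃ : Type v} [AddCommGroup M₁] [Module k M₁] [AddCommGroup M₂] [Module k M₂]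
  [AddCommGroup M₃] [Module k M₃] {I : ι → Submodule k M₁} {J : ι → Submodule k M₂}
  {K : ι → Submodule k M₃} (B : M₁ →ₗ[k] M₂ →ₗ[k] M₃) (hl : ∀ i, ∀ x ∈ I i, ∀ y, B x y ∈ K i)
  (hr : ∀ i, ∀ x, ∀ y ∈ J i, B x y ∈ K i)

lemma seqMul_mem {J₁ : Submodule k M₁} {J₂ : Submodule k M₂} {J₃ : Submodule k M₃}
    (h : ∀ x ∈ J₁, ∀ y ∈ J₂, B x y ∈ J₃) {a : nullSeq I} {b : nullSeq J}
    (ha : a ∈ coeffIn I J₁) (hb : b ∈ coeffIn J J₂) :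
    seqMul B hl hr a b ∈ coeffIn K J₃ := by
  intro n
  rw [seqMul_apply]
  exact J₃.sum_mem fun p _ => h _ (ha p.1) _ (hb p.2)

lemma seqMul_zero (a : nullSeq I) (b : nullSeq J) :
    (seqMul B hl hr a b).1 0 = B (a.1 0) (b.1 0) := by simp

lemma seqMul_mon_one (x : M₁) (b : nullSeq J) (n : ℕ) :
    (seqMul B hl hr (mon I 1 x) b).1 (n + 1) = B x (b.1 n) := by
  rw [seqMul_apply, sum_eq_single (1, n)]
  · rfl
  · rintro ⟨p, q⟩ hp hne
    have := HasAntidiagonal.mem_antidiagonal.1 hp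
    rw [mon_apply, if_neg (fun h => hne (Prod.ext h (by simp at h this ⊢; omega))), map_zero, LinearMap.zero_apply]
  · simp [add_comm]

/-- A linear differential equation `a' = b a` has at most one solution with given initial value. -/
lemma eq_zero_of_deriv_eq [CharZero k] (B : M₁ →ₗ[k] M₂ →ₗ[k] M₂)
    (hl : ∀ i, ∀ x ∈ I i, ∀ y, B x y ∈ J i) (hr : ∀ i, ∀ x, ∀ y ∈ J i, B x y ∈ J i)
    {b : nullSeq I} {a : nullSeq J} (h : deriv J a = seqMul B hl hr b a) (h0 : a.1 0 = 0) :
    a = 0 := by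
  ext n
  induction n using Nat.strong_induction_on with
  | _ n ih =>
    cases n with
    | zero => exact h0
    | succ n =>
      -- The coefficient of `zⁿ` expresses `(n + 1) aₙ₊₁` through `a₀, …, aₙ`, which vanish by
      -- induction.
      have h1 := congrFun (congrArg Subtype.val h) n
      rw [deriv_apply, seqMul_apply, sum_eq_zero fun p hp => ?_] at h1
      · have : ((n : k) + 1) ≠ 0 := by exact_mod_cast Nat.succ_ne_zero n
        exact (smul_eq_zero.1 h1).resolve_left this
      · have := HasAntidiagonal.mem_antidiagonal.1 hp
        rw [ih p.2 (by omega)]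
        exact map_zero _

/-- The Cauchy product formula; it makes evaluation at `z = 1` compatible with all brackets. -/
lemma sumMap_seqMul [Preorder ι] (hI : IsLimit I) (hI' : ∀ i j, i ≤ j → I j ≤ I i)
    (hJ : IsLimit J) (hJ' : ∀ i j, i ≤ j → J j ≤ J i) (hK : IsLimit K)
    (hK' : ∀ i j, i ≤ j → K j ≤ K i) (a : nullSeq I) (b : nullSeq J) :
    sumMap hK hK' (seqMul B hl hr a b) = B (sumMap hI hI' a) (sumMap hJ hJ' b) :=
  (IsSum.cauchy B hl hr (isSum_sumMap hI hI' a) (isSum_sumMap hJ hJ' b)).tsum_eq hK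

end mul

end restricted

end Filtered

/-! ### The pronilpotent dgla of restricted series and its evaluations -/

namespace PronilpotentDGLA

open Filtered Finset

variable {k : Type u} [Field k] (A : PronilpotentDGLA.{u, v, w} k)

/-- Each coefficient of a bracket of series is a finite sum of brackets of coefficients, so
nilpotency modulo `𝔤_i` passes from `𝔤` to the series. -/
lemma lcs_series (n : ℕ) :
    (A.series.lcs n).1 ≤ coeffIn A.filE (A.lcs n).1 ∧
      (A.series.lcs n).2 ≤ coeffIn A.filO (A.lcs n).2 := by
  induction n with
  | zero => exact ⟨fun _ _ _ => Submodule.mem_top, fun _ _ _ => Submodule.mem_top⟩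
  | succ n ih =>
    constructor <;> refine Submodule.span_le.2 ?_
    · rintro z (⟨x, y, hy, rfl⟩ | ⟨x, y, hy, rfl⟩)
      · exact seqMul_mem A.lieEE A.idealEE' A.idealEE (J₁ := ⊤) (fun x _ y hy =>
          Submodule.subset_span (Or.inl ⟨x, y, hy, rfl⟩)) (fun _ => trivial) (ih.1 hy)
      · exact seqMul_mem A.lieOO A.idealOO' A.idealOO (J₁ := ⊤) (fun x _ y hy =>
          Submodule.subset_span (Or.inr ⟨x, y, hy, rfl⟩)) (fun _ => trivial) (ih.2 hy)
    · rintro z (⟨x, y, hy, rfl⟩ | ⟨y, hy, x, rfl⟩)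
      · exact seqMul_mem A.lieEO A.idealEO' A.idealEO (J₁ := ⊤) (fun x _ y hy =>
          Submodule.subset_span (Or.inl ⟨x, y, hy, rfl⟩)) (fun _ => trivial) (ih.2 hy)
      · exact seqMul_mem A.lieEO A.idealEO' A.idealEO (J₂ := ⊤) (fun x hx y _ =>
          Submodule.subset_span (Or.inr ⟨x, hx, y, rfl⟩)) (ih.1 hy) (fun _ => trivial)

/-- The pronilpotent dgla of restricted series `∑ aₙ zⁿ`, with `z` constant. -/
abbrev seriesP : PronilpotentDGLA.{u, v, w} k :=
  { A.series with
    ι := A.ι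
    filE := fun i => coeffIn A.filE (A.filE i)
    filO := fun i => coeffIn A.filO (A.filO i)
    antiE := fun i j h => coeffIn_mono _ (A.antiE i j h)
    antiO := fun i j h => coeffIn_mono _ (A.antiO i j h)
    idealEE := fun i x y hy => seqMul_mem A.lieEE A.idealEE' A.idealEE (J₁ := ⊤) (fun x _ y hy => A.idealEE i x y hy)
      (fun _ => trivial) hy
    idealEO := fun i x y hy => seqMul_mem A.lieEO A.idealEO' A.idealEO (J₁ := ⊤) (fun x _ y hy => A.idealEO i x y hy)
      (fun _ => trivial) hy
    idealEO' := fun i x hx y => seqMul_mem A.lieEO A.idealEO' A.idealEO (J₂ := ⊤)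
      (fun x hx y _ => A.idealEO' i x hx y) hx (fun _ => trivial)
    idealOO := fun i x y hy => seqMul_mem A.lieOO A.idealOO' A.idealOO (J₁ := ⊤) (fun x _ y hy => A.idealOO i x y hy)
      (fun _ => trivial) hy
    dE_mem := fun i _ hx n => A.dE_mem i _ (hx n)
    dO_mem := fun i _ hx n => A.dO_mem i _ (hx n)
    nilpotent := fun i => by
      obtain ⟨N, h1, h2⟩ := A.nilpotent i
      exact ⟨N, (A.lcs_series N).1.trans (coeffIn_mono _ h1),
        (A.lcs_series N).2.trans (coeffIn_mono _ h2)⟩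
    limitE := isLimit_coeffIn A.limitE
    limitO := isLimit_coeffIn A.limitO }

/-- Evaluation of restricted series at `z = 0`. -/
def atZero : Hom A.seriesP A where
  mapE := coeffMap A.filE 0
  mapO := coeffMap A.filO 0
  map_lieEE a b := seqMul_zero A.lieEE A.idealEE' A.idealEE a b
  map_lieEO a b := seqMul_zero A.lieEO A.idealEO' A.idealEO a b
  map_lieOO a b := seqMul_zero A.lieOO A.idealOO' A.idealOO a b
  map_dE _ := rfl
  map_dO _ := rfl
  contE := coeffMap_cont _ 0
  contO := coeffMap_cont _ 0

/-- Evaluation of restricted series at `z = 1`. -/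
noncomputable def atOne : Hom A.seriesP A where
  mapE := sumMap A.limitE A.antiE
  mapO := sumMap A.limitO A.antiO
  map_lieEE := sumMap_seqMul A.lieEE A.idealEE' A.idealEE _ _ _ _ _ _
  map_lieEO := sumMap_seqMul A.lieEO A.idealEO' A.idealEO _ _ _ _ _ _
  map_lieOO := sumMap_seqMul A.lieOO A.idealOO' A.idealOO _ _ _ _ _ _
  map_dE a := ((isSum_sumMap A.limitE A.antiE a).map A.cont_dE).tsum_eq A.limitO
  map_dO a := ((isSum_sumMap A.limitO A.antiO a).map A.cont_dO).tsum_eq A.limitE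
  contE i := ⟨i, fun _ hx => sumMap_mem _ _ hx⟩
  contO i := ⟨i, fun _ hx => sumMap_mem _ _ hx⟩

end PronilpotentDGLA

/-! ### Commuting an operator past powers of another -/

namespace Filtered

variable {k : Type u} [Field k] {ι : Type w} {M : Type v} [AddCommGroup M] [Module k M]
  [Preorder ι] {I : ι → Submodule k M} {T : Module.End k M}
  (hI : IsLimit I) (hanti : ∀ i j, i ≤ j → I j ≤ I i) (hT : TopNil I T)

lemma opSum_expS (v : M) :
    opSum hI hanti hT (expS k) v = v + opSum hI hanti hT (phiS k) (T v) := by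
  have h : expS k = 1 + phiS k * PowerSeries.X := by rw [mul_comm, X_mul_phiS]; ring
  rw [h, opSum_add, opSum_one, opSum_mul, opSum_X]
  rfl

/-- The binomial expansion of `D Tⁿ⁺¹` in terms of the iterated commutators of `T` with `D`. -/
lemma mul_pow_eq_add_sum {E : Type*} [Ring E] [Algebra k E] {T D : E} {X : ℕ → E}
    (h0 : D * T = T * D + X 0) (hX : ∀ p, X (p + 1) = T * X p - X p * T) (n : ℕ) :
    D * T ^ (n + 1) = T ^ (n + 1) * D + ∑ p ∈ Finset.HasAntidiagonal.antidiagonal n,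
      (n + 1).choose (p.1 + 1) • (X p.1 * T ^ p.2) := by
  -- Left multiplication is the sum of the commuting operators `L - R` and `R`, and `(L - R)^(p+1) D
  -- = -X p`. The binomial theorem for `L^(n+1) = ((L - R) + R)^(n+1)`, applied to `D`, is the
  -- claim.
  set L : Module.End k E := LinearMap.mulLeft k T
  set R : Module.End k E := LinearMap.mulRight k T
  have hLR : Commute L R := LinearMap.commute_mulLeft_right _ _
  have hc : Commute (L - R) R := hLR.sub_left (Commute.refl R)
  have h1 : ∀ p, ((L - R) ^ (p + 1)) D = -X p := by
    intro p
    induction p with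
    | zero => simp [L, R, h0]
    | succ p ih =>
      rw [pow_succ' _ (p + 1), Module.End.mul_apply, ih, hX]
      simp [L, R]
      abel
  have hR : ∀ (q : ℕ) (z : E), (R ^ q) z = z * T ^ q := fun q z => by
    simp only [R, LinearMap.pow_mulRight, LinearMap.mulRight_apply]
  have h2 := congrArg (fun F : Module.End k E => F D) (hc.add_pow' (n + 1))
  have h3 : ∀ p q, ((L - R) ^ p * R ^ q) D = ((L - R) ^ p) D * T ^ q := fun p q => by
    rw [((hc.pow_left p).pow_right q).eq, Module.End.mul_apply, hR]
  simp only [sub_add_cancel, Finset.Nat.sum_antidiagonal_succ, LinearMap.add_apply,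
    LinearMap.sum_apply, LinearMap.smul_apply, h3, h1] at h2
  simp only [L, LinearMap.pow_mulLeft, LinearMap.mulLeft_apply, pow_zero, Module.End.one_apply,
    Nat.choose_zero_right, one_smul, neg_mul, smul_neg, Finset.sum_neg_distrib] at h2
  rw [h2]
  abel

end Filtered

namespace PronilpotentDGLA

open Filtered Finset

variable {k : Type u} [Field k] (A : PronilpotentDGLA.{u, v, w} k)

/-! ### The affine representation -/

/-- The module `𝔤⁰ ⊕ 𝔤¹ ⊕ k` of the Lie algebra `𝔤⁰`, which combines the adjoint representation with
the affine action `ξ ↦ [y, ξ] - dy` on `𝔤¹`. -/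
abbrev W : Type max u v := A.Ev × A.Od × k

/-- The filtration of `𝔤⁰ ⊕ 𝔤¹ ⊕ k`. -/
def filW (i : A.ι) : Submodule k A.W := (A.filE i).prod ((A.filO i).prod ⊥)

lemma antiW (i j : A.ι) (h : i ≤ j) : A.filW j ≤ A.filW i :=
  fun _ hv => ⟨A.antiE i j h hv.1, A.antiO i j h hv.2.1, hv.2.2⟩

lemma limitW : IsLimit A.filW where
  separated v hv := Prod.ext (A.limitE.separated _ fun i => (hv i).1)
    (Prod.ext (A.limitO.separated _ fun i => (hv i).2.1) (hv (Classical.arbitrary _)).2.2)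
  complete x hx := by
    obtain ⟨a, ha⟩ := A.limitE.complete (fun i => (x i).1) fun i j h => (hx i j h).1
    obtain ⟨b, hb⟩ := A.limitO.complete (fun i => (x i).2.1) fun i j h => (hx i j h).2.1
    refine ⟨(a, b, (x (Classical.arbitrary _)).2.2), fun i => ⟨ha i, hb i, ?_⟩⟩
    -- The filtration is zero on the summand `k`, so a compatible family has a constant last
    -- component: two indices are compared through a common upper bound.
    obtain ⟨j, h1, h2⟩ := exists_ge_ge i (Classical.arbitrary A.ι)
    have e1 : (x j).2.2 - (x i).2.2 = 0 := (hx i j h1).2.2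
    have e2 : (x j).2.2 - (x (Classical.arbitrary _)).2.2 = 0 := (hx _ j h2).2.2
    change (x (Classical.arbitrary _)).2.2 - (x i).2.2 = 0
    rw [← sub_eq_zero.1 e2, e1]

/-- The action of `𝔤⁰` on `𝔤⁰ ⊕ 𝔤¹ ⊕ k`. -/
def rho : A.Ev →ₗ[k] A.W →ₗ[k] A.W :=
  LinearMap.mk₂ k (fun y v => (A.lieEE y v.1, A.lieEO y v.2.1 - v.2.2 • A.dE y, 0))
    (by intros; ext <;> simp; abel)
    (fun c y v => by ext <;> simp [smul_sub, smul_comm c v.2.2])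
    (by intros; ext <;> simp [add_smul]; abel) (by intros; ext <;> simp [smul_sub, mul_smul])

lemma rho_apply (y : A.Ev) (v : A.W) :
    A.rho y v = (A.lieEE y v.1, A.lieEO y v.2.1 - v.2.2 • A.dE y, 0) := rfl

/-- On the odd summand this combines the Jacobi identity with the Leibniz rule for `d[x, y]`; the
latter accounts for the affine term `-dy`. -/
lemma rho_lie (x y : A.Ev) (v : A.W) :
    A.rho (A.lieEE x y) v = A.rho x (A.rho y v) - A.rho y (A.rho x v) := by
  refine Prod.ext ?_ (Prod.ext ?_ ?_)
  · simp [rho_apply, A.jacEEE x y]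
  · simp only [rho_apply, A.leibEE, Prod.snd_sub, Prod.fst_sub, map_sub, map_smul, A.jacEEO x y,
      zero_smul, sub_zero, smul_add, smul_neg]
    abel
  · simp [rho_apply]

lemma rho_mem_left (i : A.ι) (y : A.Ev) (hy : y ∈ A.filE i) (v : A.W) : A.rho y v ∈ A.filW i :=
  ⟨A.idealEE' i y hy _, (A.filO i).sub_mem (A.idealEO' i y hy _)
    ((A.filO i).smul_mem _ (A.dE_mem i y hy)), rfl⟩

lemma rho_mem_right (i : A.ι) (y : A.Ev) (v : A.W) (hv : v ∈ A.filW i) : A.rho y v ∈ A.filW i := by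
  have : v.2.2 = 0 := hv.2.2
  refine ⟨A.idealEE i y _ hv.1, ?_, rfl⟩
  rw [rho_apply, this, zero_smul, sub_zero]
  exact A.idealEO i y _ hv.2.1

/-- The first application of `ρ(y)` removes the scalar component and may produce `dy`, which need
not be a bracket. Only the remaining `n` applications descend the lower central series, whence the
shift by one. -/
lemma rho_pow_mem (y : A.Ev) (v : A.W) (n : ℕ) :
    ((A.rho y ^ (n + 1)) v).1 ∈ (A.lcs n).1 ∧ ((A.rho y ^ (n + 1)) v).2.1 ∈ (A.lcs n).2 ∧
      ((A.rho y ^ (n + 1)) v).2.2 = 0 := by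
  induction n with
  | zero => exact ⟨trivial, trivial, rfl⟩
  | succ n ih =>
    rw [pow_succ', Module.End.mul_apply]
    refine ⟨Submodule.subset_span (Or.inl ⟨_, _, ih.1, rfl⟩), ?_, rfl⟩
    rw [rho_apply, ih.2.2, zero_smul, sub_zero]
    exact Submodule.subset_span (Or.inl ⟨_, _, ih.2.1, rfl⟩)

lemma lieEE_pow_mem_lcs (y x : A.Ev) (n : ℕ) : (A.lieEE y ^ n) x ∈ (A.lcs n).1 := by
  induction n with
  | zero => exact trivial
  | succ n ih =>
    rw [pow_succ', Module.End.mul_apply]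
    exact Submodule.subset_span (Or.inl ⟨y, _, ih, rfl⟩)

lemma topNil_rho (y : A.Ev) : TopNil A.filW (A.rho y) where
  stable i v hv := A.rho_mem_right i y v hv
  nil i := by
    obtain ⟨N, h1, h2⟩ := A.nilpotent i
    refine ⟨N + 1, fun n hn v => ?_⟩
    obtain ⟨n, rfl⟩ : ∃ m, n = m + 1 := ⟨n - 1, by omega⟩
    have := A.rho_pow_mem y v n
    have hle := A.lcs_antitone (show N ≤ n by omega)
    exact ⟨h1 (hle.1 this.1), h2 (hle.2 this.2.1), this.2.2⟩

lemma topNil_ad (y : A.Ev) : TopNil A.filE (A.lieEE y) where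
  stable i v hv := A.idealEE i y v hv
  nil i := by
    obtain ⟨N, h1, -⟩ := A.nilpotent i
    exact ⟨N, fun n hn v => h1 ((A.lcs_antitone hn).1 (A.lieEE_pow_mem_lcs y v n))⟩

/-- A power series in `ad y` on the even part. -/
noncomputable abbrev adSum (y : A.Ev) (p : PowerSeries k) : Module.End k A.Ev :=
  opSum A.limitE A.antiE (A.topNil_ad y) p

/-- `e^{ad y}` on the even part. -/
noncomputable def expAd (y : A.Ev) : Module.End k A.Ev := A.adSum y (expS k)

/-- `(e^{ad y} - 1) / ad y` on the even part. -/
noncomputable def phi (y : A.Ev) : Module.End k A.Ev := A.adSum y (phiS k)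

/-- The action of `e^y` on `𝔤⁰ ⊕ 𝔤¹ ⊕ k`. -/
noncomputable def expW (y : A.Ev) : Module.End k A.W :=
  opSum A.limitW A.antiW (A.topNil_rho y) (expS k)

lemma lieEE_self [CharZero k] (x : A.Ev) : A.lieEE x x = 0 := by
  have h := A.skew x x
  rw [eq_neg_iff_add_eq_zero, ← two_smul k] at h
  exact (smul_eq_zero.1 h).resolve_left two_ne_zero

lemma phi_self [CharZero k] {x y : A.Ev} (h : A.lieEE y x = 0) : A.phi y x = x := by
  rw [phi, opSum_of_apply_eq_zero _ _ _ _ h]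
  simp

lemma expAd_eq (y a : A.Ev) : A.expAd y a = a + A.phi y (A.lieEE y a) :=
  opSum_expS A.limitE A.antiE (A.topNil_ad y) a

/-- After its zeroth term, the exponential series of `ρ(y)` at `(0, ξ, 1)` is the gauge series.
Identities between the linear operators `expW` thereby become identities for the affine gauge
action. -/
lemma expW_apply_one (y : A.Ev) (ξ : A.Od) : A.expW y (0, ξ, 1) = (0, A.gauge y ξ, 1) := by
  refine opSum_eq _ _ _ ?_
  have hp : ∀ n, (A.rho y ^ (n + 1)) (0, ξ, 1) =
      (0, (A.lieEO y ^ n) (A.lieEO y ξ - A.dE y), 0) := by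
    intro n
    induction n with
    | zero => simp [rho_apply]
    | succ n ih => rw [pow_succ', Module.End.mul_apply, ih, rho_apply, pow_succ' _ n]; simp
  have h := (A.gauge_isSum y ξ).map (J := A.filW)
    (f := LinearMap.inr k A.Ev (A.Od × k) ∘ₗ LinearMap.inl k A.Od k)
    fun i => ⟨i, fun x hx => ⟨(A.filE i).zero_mem, hx, rfl⟩⟩
  have h2 := IsSum.of_succ
    (a := fun n => (expS k).coeff n • (A.rho y ^ n) ((0, ξ, 1) : A.W)) (I := A.filW)
    (s := (0, A.gauge y ξ - ξ, 0)) (by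
      convert h using 2 with n
      · rw [hp]
        simp
      all_goals rfl)
  simpa using h2

/-- The same on the even summand. -/
lemma expW_inl (y x : A.Ev) : A.expW y (x, 0, 0) = (A.expAd y x, 0, 0) :=
  (map_opSum A.limitE A.antiE (A.topNil_ad y) A.limitW A.antiW (A.topNil_rho y)
    (LinearMap.inl k A.Ev (A.Od × k)) (fun i => ⟨i, fun x hx => ⟨hx, (A.filO i).zero_mem, rfl⟩⟩)
    (fun v => by simp [rho_apply]; rfl) (expS k) x).symm

@[simp] lemma expW_zero (v : A.W) : A.expW 0 v = v := by
  rw [expW, opSum_of_apply_eq_zero _ _ _ _ (by simp)]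
  simp

section comm

variable {A}
variable {y x : A.Ev} {D : Module.End k A.W}

/-- Since `ρ` is a representation, the iterated commutators in `mul_pow_eq_add_sum` are the
operators `ρ((ad y)^p x)`. -/
lemma comm_rho_pow (hD : ∀ v, D (A.rho y v) = A.rho y (D v) + A.rho x v) (n : ℕ) (v : A.W) :
    D ((A.rho y ^ (n + 1)) v) = (A.rho y ^ (n + 1)) (D v) +
      ∑ p ∈ HasAntidiagonal.antidiagonal n, (n + 1).choose (p.1 + 1) •
        A.rho ((A.lieEE y ^ p.1) x) ((A.rho y ^ p.2) v) := by
  have h := mul_pow_eq_add_sum (k := k) (T := A.rho y) (D := D)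
    (X := fun p => A.rho ((A.lieEE y ^ p) x))
    (LinearMap.ext fun v => by simp [hD]) (fun p => LinearMap.ext fun v => by
      rw [pow_succ', Module.End.mul_apply, rho_lie]
      rfl) n
  have h2 := congrArg (fun F : Module.End k A.W => F v) h
  simpa [LinearMap.sum_apply] using h2

/-- The derivative of the exponential: if `[D, ρ(y)] = ρ(x)` then
`D e^y = ρ((e^{ad y} - 1) / ad y (x)) e^y + e^y D`. -/
lemma comm_expW [CharZero k] (hD : ∀ v, D (A.rho y v) = A.rho y (D v) + A.rho x v)
    (hc : Cont A.filW A.filW D) (v : A.W) :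
    D (A.expW y v) = A.rho (A.phi y x) (A.expW y v) + A.expW y (D v) := by
  have h1 := (opSum_isSum A.limitW A.antiW (A.topNil_rho y) (expS k) v).map hc
  have h2 := opSum_isSum A.limitW A.antiW (A.topNil_rho y) (expS k) (D v)
  have h3 : IsSum A.filW _ (A.rho (A.phi y x) (A.expW y v)) := IsSum.cauchy A.rho A.rho_mem_left A.rho_mem_right
    (opSum_isSum A.limitE A.antiE (A.topNil_ad y) (phiS k) x)
    (opSum_isSum A.limitW A.antiW (A.topNil_rho y) (expS k) v)
  have h4 := (h1.sub h2).unique A.limitW (IsSum.of_succ (I := A.filW) (s := A.rho (A.phi y x) (A.expW y v)) ?_)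
  · simpa [sub_eq_iff_eq_add, expW] using h4
  -- The zeroth terms of the two exponentials cancel. In degree `n + 1`, the identity `choose (n +
  -- 1) (p + 1) / (n + 1)! = 1 / ((p + 1)! q!)` for `p + q = n` turns the commutator terms into the
  -- Cauchy product of `φ(y) x` with `e^y v`.
  · convert h3 using 2 with n
    rw [map_smul, comm_rho_pow hD, smul_add, add_sub_cancel_left, smul_sum]
    refine sum_congr rfl fun p hp => ?_
    have hp := HasAntidiagonal.mem_antidiagonal.1 hp
    rw [map_smul, map_smul, LinearMap.smul_apply, smul_smul, ← Nat.cast_smul_eq_nsmul k, smul_smul]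
    congr 1
    simp only [coeff_expS, coeff_phiS]
    have hf := Nat.choose_mul_factorial_mul_factorial (show p.1 + 1 ≤ n + 1 by omega)
    rw [show n + 1 - (p.1 + 1) = p.2 by omega] at hf
    rw [← hf]
    have e1 : ((p.1 + 1).factorial : k) ≠ 0 := Nat.cast_ne_zero.2 (Nat.factorial_ne_zero _)
    have e2 : (p.2.factorial : k) ≠ 0 := Nat.cast_ne_zero.2 (Nat.factorial_ne_zero _)
    have e3 : ((n + 1).choose (p.1 + 1) : k) ≠ 0 :=
      Nat.cast_ne_zero.2 (Nat.choose_pos (by omega)).ne'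
    push_cast
    field_simp

/-- `e^y ρ(a) = ρ(e^{ad y} a) e^y`. -/
lemma expW_rho [CharZero k] (y a : A.Ev) (v : A.W) :
    A.expW y (A.rho a v) = A.rho (A.expAd y a) (A.expW y v) := by
  -- With `D = ρ(a)` the commutator is `ρ([a, y]) = -ρ([y, a])`, and `e^(ad y) a = a + φ(y) [y, a]`.
  have h := comm_expW (A := A) (y := y) (x := A.lieEE a y) (D := A.rho a)
    (fun v => by rw [rho_lie]; abel) (fun i => ⟨i, A.rho_mem_right i a⟩) v
  rw [A.skew a y, map_neg, map_neg, LinearMap.neg_apply] at h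
  rw [expAd_eq, map_add, LinearMap.add_apply, h]
  abel

end comm

section hom

variable {A} {B : PronilpotentDGLA.{u, v', w'} k} (f : Hom A B)

/-- The map induced by a morphism on `𝔤⁰ ⊕ 𝔤¹ ⊕ k`. -/
def Hom.mapW : A.W →ₗ[k] B.W := f.mapE.prodMap (f.mapO.prodMap LinearMap.id)

lemma Hom.mapW_apply (v : A.W) : f.mapW v = (f.mapE v.1, f.mapO v.2.1, v.2.2) := rfl

lemma Hom.mapW_expW (y : A.Ev) (v : A.W) : f.mapW (A.expW y v) = B.expW (f.mapE y) (f.mapW v) := by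
  refine map_opSum A.limitW A.antiW (A.topNil_rho y) B.limitW B.antiW (B.topNil_rho _) f.mapW
    (fun j => ?_) (fun v => ?_) _ v
  · obtain ⟨i, hi⟩ := f.contE j
    obtain ⟨i', hi'⟩ := f.contO j
    obtain ⟨l, h1, h2⟩ := exists_ge_ge i i'
    exact ⟨l, fun v hv => ⟨hi _ (A.antiE _ _ h1 hv.1), hi' _ (A.antiO _ _ h2 hv.2.1), hv.2.2⟩⟩
  · simp [rho_apply, Hom.mapW_apply, f.map_lieEE, f.map_lieEO, f.map_dE]

lemma Hom.map_gauge (y : A.Ev) (ξ : A.Od) :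
    f.mapO (A.gauge y ξ) = B.gauge (f.mapE y) (f.mapO ξ) := by
  have h := f.mapW_expW y (0, ξ, 1)
  rw [expW_apply_one, Hom.mapW_apply, Hom.mapW_apply, map_zero, expW_apply_one] at h
  exact congrArg (fun v => v.2.1) h

end hom

/-! ### Differentiation in the parameter `z` -/

/-- The derivative on `𝔤⁰ ⊕ 𝔤¹ ⊕ k` for restricted series. -/
def derivW : Module.End k A.seriesP.W :=
  (deriv A.filE).prodMap ((deriv A.filO).prodMap 0)

lemma derivW_apply (v : A.seriesP.W) : A.derivW v = (deriv A.filE v.1, deriv A.filO v.2.1, 0) := rfl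

lemma derivW_cont : Cont A.seriesP.filW A.seriesP.filW A.derivW := fun i =>
  ⟨i, fun _ hv => ⟨deriv_mem _ hv.1, deriv_mem _ hv.2.1, rfl⟩⟩

/-- The derivation `d/dz` commutes with `d` and is zero on the scalars, so its commutator with
`ρ(y)` is `ρ(y')`. This is the hypothesis of `comm_expW` for paths. -/
lemma derivW_rho (y : A.seriesP.Ev) (v : A.seriesP.W) :
    A.derivW (A.seriesP.rho y v) =
      A.seriesP.rho y (A.derivW v) + A.seriesP.rho (deriv A.filE y) v := by
  refine Prod.ext ?_ (Prod.ext ?_ ?_)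
  · refine (deriv_seqMul A.lieEE A.idealEE' A.idealEE y v.1).trans (add_comm _ _)
  · have h1 := deriv_seqMul A.lieEO A.idealEO' A.idealEO y v.2.1
    have h2 := seqMap_deriv A.filE A.dE A.cont_dE y
    change deriv A.filO (A.seriesP.lieEO y v.2.1 - v.2.2 • A.seriesP.dE y) =
      A.seriesP.lieEO y (deriv A.filO v.2.1) - (0 : k) • A.seriesP.dE y +
        (A.seriesP.lieEO (deriv A.filE y) v.2.1 - v.2.2 • A.seriesP.dE (deriv A.filE y))
    rw [map_sub, map_smul]
    refine (congrArg₂ _ h1 (congrArg _ h2.symm)).trans ?_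
    rw [zero_smul, sub_zero, add_comm (seqMul _ _ _ _ _)]
    exact add_sub_assoc _ _ _
  · exact (add_zero (0 : k)).symm

variable [CharZero k]

lemma derivW_expW (y : A.seriesP.Ev) (v : A.seriesP.W) :
    A.derivW (A.seriesP.expW y v) =
      A.seriesP.rho (A.seriesP.phi y (deriv A.filE y)) (A.seriesP.expW y v) +
        A.seriesP.expW y (A.derivW v) :=
  comm_expW (A.derivW_rho y) A.derivW_cont v

end PronilpotentDGLA

/-! ### Chains for the contraction argument, and exponentials of `zx` -/

namespace PronilpotentDGLA

open Filtered Finset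

variable {k : Type u} [Field k] (A : PronilpotentDGLA.{u, v, w} k)

/-- The lower central series modulo a member of the filtration. -/
def chain (i : A.ι) (n : ℕ) : Submodule k A.Ev := (A.lcs n).1 ⊔ A.filE i

lemma lie_mem_chain_right (i : A.ι) (n : ℕ) (y : A.Ev) {x : A.Ev} (hx : x ∈ A.chain i n) :
    A.lieEE y x ∈ A.chain i (n + 1) := by
  obtain ⟨a, ha, b, hb, rfl⟩ := Submodule.mem_sup.1 hx
  rw [map_add]
  exact add_mem (Submodule.mem_sup_left (Submodule.subset_span (Or.inl ⟨y, a, ha, rfl⟩)))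
    (Submodule.mem_sup_right (A.idealEE i y b hb))

lemma lie_mem_chain_left (i : A.ι) (n : ℕ) (y : A.Ev) {x : A.Ev} (hx : x ∈ A.chain i n) :
    A.lieEE x y ∈ A.chain i (n + 1) := by
  rw [A.skew]
  exact neg_mem (A.lie_mem_chain_right i n y hx)

lemma chain_anti (i : A.ι) (n : ℕ) : A.chain i (n + 1) ≤ A.chain i n :=
  sup_le_sup_right (A.lcs_anti n).1 _

lemma phi_eq_add (y x : A.Ev) : A.phi y x = x + A.adSum y (phiS k - 1) x := by
  have h : phiS k = 1 + (phiS k - 1) := by ring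
  rw [phi, adSum, h, opSum_add, opSum_one, ← h]
  rfl

lemma mapW_atZero_expW (w : A.seriesP.Ev) (h : w.1 0 = 0) (v : A.seriesP.W) :
    A.atZero.mapW (A.seriesP.expW w v) = A.atZero.mapW v := by
  rw [Hom.mapW_expW, show A.atZero.mapE w = 0 from h, expW_zero]

lemma seriesP_lie_pow_mon (x : A.Ev) (a : A.seriesP.Ev) (m n : ℕ) :
    ((A.seriesP.lieEE (mon A.filE 1 x) ^ m) a).1 n =
      if m ≤ n then (A.lieEE x ^ m) (a.1 (n - m)) else 0 := by
  induction m generalizing n with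
  | zero => simp
  | succ m ih =>
    rw [pow_succ', Module.End.mul_apply]
    cases n with
    | zero =>
      rw [if_neg (by omega)]
      exact (seqMul_zero A.lieEE A.idealEE' A.idealEE _ _).trans (by simp [mon_apply])
    | succ n =>
      refine (seqMul_mon_one A.lieEE A.idealEE' A.idealEE _ _ _).trans ?_
      rw [ih]
      by_cases h : m ≤ n
      · rw [if_pos h, if_pos (by omega), pow_succ', Module.End.mul_apply, Nat.succ_sub_succ]
      · rw [if_neg h, if_neg (by omega), map_zero]

lemma seriesP_expAd_mon (x : A.Ev) (a : A.seriesP.Ev) (n : ℕ) :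
    (A.seriesP.expAd (mon A.filE 1 x) a).1 n = ∑ p ∈ HasAntidiagonal.antidiagonal n,
      ((p.1.factorial : k))⁻¹ • (A.lieEE x ^ p.1) (a.1 p.2) := by
  have h := (opSum_isSum A.seriesP.limitE A.seriesP.antiE (A.seriesP.topNil_ad (mon A.filE 1 x))
    (expS k) a).map (coeffMap_cont A.filE n)
  have hz : ∀ m, coeffMap A.filE n ((expS k).coeff m •
      (A.seriesP.lieEE (mon A.filE 1 x) ^ m) a) =
      if m ≤ n then ((m.factorial : k))⁻¹ • (A.lieEE x ^ m) (a.1 (n - m)) else 0 := by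
    intro m
    rw [map_smul, coeffMap_apply, seriesP_lie_pow_mon, coeff_expS]
    split <;> simp
  simp only [hz] at h
  -- Each application of `ad (zx)` raises the degree in `z` by one, so only the powers `m ≤ n` reach
  -- the coefficient of `zⁿ`.
  have h2 := h.unique A.limitE (isSum_of_eventually_zero (N := n + 1) fun m hm => by
    rw [if_neg (by omega)])
  refine h2.trans ?_
  rw [Finset.Nat.sum_antidiagonal_eq_sum_range_succ
    (fun p q => ((p.factorial : k))⁻¹ • (A.lieEE x ^ p) (a.1 q))]
  exact sum_congr rfl fun m hm => if_pos (by simpa [Nat.lt_succ_iff] using hm)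

/-- The component of degree `i` of `e^{ad x} e^{ad y}`. -/
def expExp (x y : A.Ev) (i : ℕ) : Module.End k A.Ev :=
  ∑ a ∈ HasAntidiagonal.antidiagonal i,
    ((a.1.factorial : k) * (a.2.factorial : k))⁻¹ • (A.lieEE x ^ a.1 * A.lieEE y ^ a.2)

lemma seriesP_expAd_expAd_mon (x y : A.Ev) (a : A.seriesP.Ev) (n : ℕ) :
    (A.seriesP.expAd (mon A.filE 1 x) (A.seriesP.expAd (mon A.filE 1 y) a)).1 n =
      ∑ p ∈ HasAntidiagonal.antidiagonal n, A.expExp x y p.1 (a.1 p.2) := by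
  have h := tri_left (fun i j l => ((i.factorial : k) * (j.factorial : k))⁻¹ •
    (A.lieEE x ^ i) ((A.lieEE y ^ j) (a.1 l))) n
  refine ((A.seriesP_expAd_mon x _ n).trans (sum_congr rfl fun p _ => ?_)).trans
    (h.symm.trans (sum_congr rfl fun p _ => ?_))
  · refine (congrArg (fun z => ((p.1.factorial : k))⁻¹ • (A.lieEE x ^ p.1) z)
      (A.seriesP_expAd_mon y a p.2)).trans ?_
    simp only [map_sum, smul_sum, map_smul, smul_smul, mul_inv]
  · simp [expExp, LinearMap.sum_apply]

/-! ### The differential equation of the Baker–Campbell–Hausdorff series -/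

lemma seriesP_lie_mon (x y : A.Ev) :
    A.seriesP.lieEE (mon A.filE 1 x) (mon A.filE 0 y) = mon A.filE 1 (A.lieEE x y) := by
  ext n
  cases n with
  | zero => exact (seqMul_zero A.lieEE A.idealEE' A.idealEE _ _).trans (by simp [mon_apply])
  | succ n =>
    refine (seqMul_mon_one A.lieEE A.idealEE' A.idealEE _ _ _).trans ?_
    by_cases h : n = 0 <;> simp [mon_apply, h]

/-- The logarithmic derivative of `e^{zx} e^{zy}`. -/
noncomputable def bchDeriv (x y : A.Ev) : A.seriesP.Ev :=
  mon A.filE 0 x + A.seriesP.expAd (mon A.filE 1 x) (mon A.filE 0 y)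

lemma bchDeriv_coeff (x y : A.Ev) (n : ℕ) : (A.bchDeriv x y).1 n =
    (if n = 0 then x else 0) + ((n.factorial : k))⁻¹ • (A.lieEE x ^ n) y := by
  refine congrArg₂ (· + ·) (mon_apply A.filE 0 x n) ((A.seriesP_expAd_mon x _ n).trans ?_)
  rw [sum_eq_single (n, 0)]
  · simp [mon_apply]
  · rintro ⟨p, q⟩ hp hne
    have := HasAntidiagonal.mem_antidiagonal.1 hp
    rw [mon_apply, if_neg (fun h => hne (Prod.ext (by simp at h this ⊢; omega) h)), map_zero, smul_zero]
  · simp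

variable [CharZero k]

/-- Uniqueness for linear differential equations of operators. -/
lemma eq_zero_of_derivW (b : A.seriesP.Ev) (T : A.seriesP.W → A.seriesP.W)
    (hT : ∀ v, A.derivW (T v) = A.seriesP.rho b (T v) + T (A.derivW v))
    (h0 : ∀ v, A.atZero.mapW (T v) = 0) (v : A.seriesP.W) : T v = 0 := by
  have h3 : ∀ v, (T v).2.2 = 0 := fun v => congrArg (fun x => x.2.2) (h0 v)
  -- The induction runs over all `v` at once, because the equation for `T v` also involves `T
  -- (derivW v)`. The term with `dE b` drops out since the scalar component of `T v` is zero.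
  have key : ∀ n v, (T v).1.1 n = 0 ∧ (T v).2.1.1 n = 0 := by
    intro n
    induction n using Nat.strong_induction_on with
    | _ n ih =>
      intro v
      cases n with
      | zero =>
        exact ⟨congrArg (fun x => x.1) (h0 v), congrArg (fun x => x.2.1) (h0 v)⟩
      | succ n =>
        have hn : ((n : k) + 1) ≠ 0 := by exact_mod_cast Nat.succ_ne_zero n
        constructor
        · have h1 : ((n : k) + 1) • (T v).1.1 (n + 1) =
              (∑ p ∈ HasAntidiagonal.antidiagonal n, A.lieEE (b.1 p.1) ((T v).1.1 p.2)) +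
                (T (A.derivW v)).1.1 n := congrArg (fun x => x.1.1 n) (hT v)
          rw [(ih n (by omega) _).1, add_zero, sum_eq_zero fun p hp => ?_] at h1
          · exact (smul_eq_zero.1 h1).resolve_left hn
          · have := HasAntidiagonal.mem_antidiagonal.1 hp
            rw [(ih p.2 (by omega) v).1, map_zero]
        · have h1 : ((n : k) + 1) • (T v).2.1.1 (n + 1) =
              (∑ p ∈ HasAntidiagonal.antidiagonal n, A.lieEO (b.1 p.1) ((T v).2.1.1 p.2)) -
                (T v).2.2 • A.dE (b.1 n) +
                (T (A.derivW v)).2.1.1 n := congrArg (fun x => x.2.1.1 n) (hT v)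
          rw [(ih n (by omega) _).2, add_zero, h3, zero_smul, sub_zero,
            sum_eq_zero fun p hp => ?_] at h1
          · exact (smul_eq_zero.1 h1).resolve_left hn
          · have := HasAntidiagonal.mem_antidiagonal.1 hp
            rw [(ih p.2 (by omega) v).2, map_zero]
  exact Prod.ext (Subtype.ext (funext fun n => (key n v).1))
    (Prod.ext (Subtype.ext (funext fun n => (key n v).2)) (h3 v))

/-- The equation `(e^{ad w} - 1) / ad w (w') = b`, `w(0) = 0` has a unique solution. -/
lemma existsUnique_phi_deriv (b : A.seriesP.Ev) :
    ∃! w : A.seriesP.Ev, w.1 0 = 0 ∧ A.seriesP.phi w (deriv A.filE w) = b := by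
  -- Splitting off the constant term `1` of `φ` gives `w' = b - (φ - 1)(w) w'`; integration from `0`
  -- makes this a fixed point equation that includes the initial condition.
  have hfix : ∀ w : A.seriesP.Ev, (integral A.filE (b - A.seriesP.adSum w (phiS k - 1)
      (deriv A.filE w)) = w) ↔ (w.1 0 = 0 ∧ A.seriesP.phi w (deriv A.filE w) = b) := by
    intro w
    constructor
    · intro h
      have h0 : w.1 0 = 0 := by rw [← h]; rfl
      refine ⟨h0, ?_⟩
      have h1 := congrArg (deriv A.filE) h
      rw [deriv_integral] at h1
      exact (A.seriesP.phi_eq_add _ _).trans (sub_eq_iff_eq_add.1 h1).symm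
    · rintro ⟨h0, h1⟩
      rw [phi_eq_add] at h1
      rw [← h1, add_sub_cancel_right, integral_deriv _ h0]
  have := exists_fixedPoint A.seriesP.limitE A.seriesP.antiE
    (fun w => integral A.filE (b - A.seriesP.adSum w (phiS k - 1) (deriv A.filE w)))
    (fun i n => coeffIn A.filE (A.chain i n))
    (fun i => by ext; simp [coeffIn, chain, DGLA.lcs])
    (fun i n => coeffIn_mono _ le_sup_right)
    (fun i => by
      obtain ⟨N, h1, -⟩ := A.nilpotent i
      exact ⟨N, fun n hn => coeffIn_mono _ (sup_le ((A.lcs_antitone hn).1.trans h1) le_rfl)⟩)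
    (fun i n x y hxy => ?_)
  · simpa only [hfix] using this
  · rw [← map_sub, sub_sub_sub_cancel_left]
    refine integral_mem _ (neg_sub (A.seriesP.adSum x _ _) _ ▸ neg_mem ?_)
    -- Contraction: `[x, p] - [y, q] = [x - y, p] + [y, p - q]`, so each bracket moves a difference
    -- one step down the lower central series modulo `𝔤_i`.
    have hterm : ∀ j, (A.seriesP.lieEE x ^ (j + 1)) (deriv A.filE x) -
        (A.seriesP.lieEE y ^ (j + 1)) (deriv A.filE y) ∈ coeffIn A.filE (A.chain i (n + 1)) := by
      have step : ∀ p q : A.seriesP.Ev, p - q ∈ coeffIn A.filE (A.chain i n) →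
          A.seriesP.lieEE x p - A.seriesP.lieEE y q ∈ coeffIn A.filE (A.chain i (n + 1)) := by
        intro p q hpq
        have : A.seriesP.lieEE x p - A.seriesP.lieEE y q =
            A.seriesP.lieEE (x - y) p + A.seriesP.lieEE y (p - q) := by
          simp only [map_sub, LinearMap.sub_apply]
          abel
        rw [this]
        exact add_mem
          (seqMul_mem A.lieEE A.idealEE' A.idealEE (J₂ := ⊤)
            (fun a ha c _ => A.lie_mem_chain_left i n c ha) hxy (fun _ => trivial))
          (seqMul_mem A.lieEE A.idealEE' A.idealEE (J₁ := ⊤)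
            (fun a _ c hc => A.lie_mem_chain_right i n a hc) (fun _ => trivial) hpq)
      intro j
      induction j with
      | zero =>
        simp only [zero_add, pow_one]
        refine step _ _ ?_
        rw [← map_sub]
        exact deriv_mem _ hxy
      | succ j ih =>
        rw [pow_succ' _ (j + 1), pow_succ' _ (j + 1), Module.End.mul_apply, Module.End.mul_apply]
        exact step _ _ (coeffIn_mono _ (A.chain_anti i n) ih)
    refine ((opSum_isSum A.seriesP.limitE A.seriesP.antiE (A.seriesP.topNil_ad x) _ _).sub
      (opSum_isSum A.seriesP.limitE A.seriesP.antiE (A.seriesP.topNil_ad y) _ _)).mem (i := i)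
      (coeffIn_mono _ le_sup_right) fun j => ?_
    rw [← smul_sub]
    cases j with
    -- The constant coefficient of `φ - 1` is zero, so no term without a bracket occurs.
    | zero => simp [-PowerSeries.coeff_zero_eq_constantCoeff]
    | succ j => exact Submodule.smul_mem _ _ (hterm j)

lemma seriesP_phi_mon (x : A.Ev) :
    A.seriesP.phi (mon A.filE 1 x) (mon A.filE 0 x) = mon A.filE 0 x :=
  phi_self _ (by rw [seriesP_lie_mon, lieEE_self, map_zero])

/-- Both sides satisfy `(T v)' = ρ(b) T v + T v'` and agree at `z = 0`. For the product, moving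
`ρ(y)` across `e^(zx)` by `expW_rho` produces the logarithmic derivative `b = x + e^(z ad x) y`. -/
lemma expW_eq_of_phi_deriv {x y : A.Ev} {w : A.seriesP.Ev} (h0 : w.1 0 = 0)
    (h : A.seriesP.phi w (deriv A.filE w) = A.bchDeriv x y) (v : A.seriesP.W) :
    A.seriesP.expW w v =
      A.seriesP.expW (mon A.filE 1 x) (A.seriesP.expW (mon A.filE 1 y) v) := by
  have hd : ∀ (x : A.Ev) (v : A.seriesP.W), A.derivW (A.seriesP.expW (mon A.filE 1 x) v) =
      A.seriesP.rho (mon A.filE 0 x) (A.seriesP.expW (mon A.filE 1 x) v) +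
        A.seriesP.expW (mon A.filE 1 x) (A.derivW v) := by
    intro x v
    have := A.derivW_expW (mon A.filE 1 x) v
    rwa [deriv_mon_one, seriesP_phi_mon] at this
  refine sub_eq_zero.1 (A.eq_zero_of_derivW (A.bchDeriv x y) (fun v => A.seriesP.expW w v -
    A.seriesP.expW (mon A.filE 1 x) (A.seriesP.expW (mon A.filE 1 y) v)) (fun v => ?_)
    (fun v => ?_) v)
  · rw [map_sub, derivW_expW, h, hd, hd, map_add, expW_rho, map_sub, bchDeriv, map_add]
    simp only [LinearMap.add_apply]
    abel
  · rw [map_sub, mapW_atZero_expW _ _ h0, mapW_atZero_expW _ _ (by simp [mon_apply]),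
      mapW_atZero_expW _ _ (by simp [mon_apply]), sub_self]

end PronilpotentDGLA

/-! ### Dynkin words and their recursion -/

namespace DGLA

open Finset

variable {k : Type u} [Field k] (A : DGLA.{u, v} k)

lemma nested_replicate_append (x : A.Ev) (r : ℕ) {l : List A.Ev} (hl : l ≠ []) :
    A.nested (List.replicate r x ++ l) = (A.lieEE x ^ r) (A.nested l) := by
  induction r with
  | zero => rfl
  | succ r ih =>
    rw [pow_succ', Module.End.mul_apply, ← ih]
    obtain ⟨a, l', h⟩ : ∃ a l', List.replicate r x ++ l = a :: l' :=
      List.exists_cons_of_ne_nil (by simp [hl])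
    rw [List.replicate_succ, List.cons_append, h]
    rfl

lemma nested_replicate [CharZero k] (x : A.Ev) (r : ℕ) :
    A.nested (List.replicate (r + 2) x) = 0 := by
  have hx : A.lieEE x x = 0 := by
    have h := A.skew x x
    rw [eq_neg_iff_add_eq_zero, ← two_smul k] at h
    exact (smul_eq_zero.1 h).resolve_left two_ne_zero
  have h := A.nested_replicate_append x (r + 1) (l := [x]) (by simp)
  rw [← List.replicate_succ'] at h
  rw [h, pow_succ, Module.End.mul_apply]
  exact (congrArg _ hx).trans (map_zero _)

/-- The block `x^r y^s` of a Dynkin word. -/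
abbrev block (x y : A.Ev) (a : ℕ × ℕ) : List A.Ev :=
  List.replicate a.1 x ++ List.replicate a.2 y

/-- The weight `r! s!` of a block. -/
abbrev weight (k : Type u) [Field k] (a : ℕ × ℕ) : k := (a.1.factorial : k) * (a.2.factorial : k)

/-- The sum over all Dynkin words of degree `n` with `m` blocks. -/
def dynkin (x y : A.Ev) (K m n : ℕ) : A.Ev :=
  ∑ p ∈ Fintype.piFinset fun _ : Fin m => range (K + 1) ×ˢ range (K + 1),
    if (∀ i, 0 < (p i).1 + (p i).2) ∧ ∑ i, ((p i).1 + (p i).2) = n then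
      (∏ i, weight k (p i))⁻¹ • A.nested (List.ofFn fun i => A.block x y (p i)).flatten else 0

lemma bchTerm_eq (n : ℕ) (x y : A.Ev) : A.bchTerm n x y =
    ∑ m ∈ Icc 1 n, ((-1 : k) ^ (m + 1) / (m : k)) • (n : k)⁻¹ • A.dynkin x y n m n := by
  refine sum_congr rfl fun m _ => congrArg _ ?_
  rw [dynkin, ← sum_filter, smul_sum]
  simp only [smul_smul, mul_inv]

lemma sum_piFinset_succ {M : Type*} [AddCommMonoid M] {m : ℕ} (s : Finset (ℕ × ℕ))
    (F : (Fin (m + 1) → ℕ × ℕ) → M) :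
    ∑ p ∈ Fintype.piFinset fun _ : Fin (m + 1) => s, F p =
      ∑ a ∈ s, ∑ q ∈ Fintype.piFinset fun _ : Fin m => s, F (Fin.cons a q) := by
  rw [← sum_product']
  refine sum_nbij' (fun p => (p 0, Fin.tail p)) (fun a => Fin.cons a.1 a.2) ?_ ?_ ?_ ?_ ?_
  · intro p hp
    rw [Fintype.mem_piFinset] at hp
    exact mem_product.2 ⟨hp 0, Fintype.mem_piFinset.2 fun i => hp i.succ⟩
  · intro a ha
    obtain ⟨h1, h2⟩ := mem_product.1 ha
    rw [Fintype.mem_piFinset] at h2 ⊢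
    exact Fin.cases h1 h2
  · intro p _; exact Fin.cons_self_tail p
  · intro a _; rfl
  · intro p _; rw [Fin.cons_self_tail]

lemma sum_box {M : Type*} [AddCommMonoid M] {n K : ℕ} (h : n ≤ K) (F : ℕ × ℕ → M) :
    ∑ a ∈ range (K + 1) ×ˢ range (K + 1), (if a.1 + a.2 = n then F a else 0) =
      ∑ a ∈ HasAntidiagonal.antidiagonal n, F a := by
  rw [← sum_filter]
  refine sum_congr ?_ fun _ _ => rfl
  ext a
  simp
  omega

/-- A nested bracket vanishes when its last two entries coincide, so among the words `x^r y^s` only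
`x^n y` and, for `n = 0`, the single letter `x` survive. The result is the coefficient of `zⁿ` in
`bchDeriv`. -/
lemma dynkin_one [CharZero k] (x y : A.Ev) {K n : ℕ} (h : n + 1 ≤ K) :
    A.dynkin x y K 1 (n + 1) =
      (if n = 0 then x else 0) + ((n.factorial : k))⁻¹ • (A.lieEE x ^ n) y := by
  have h1 : A.dynkin x y K 1 (n + 1) = ∑ a ∈ HasAntidiagonal.antidiagonal (n + 1),
      (weight k a)⁻¹ • A.nested (A.block x y a) := by
    rw [← sum_box h, dynkin, sum_piFinset_succ]
    refine sum_congr rfl fun a _ => ?_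
    rw [Fintype.piFinset_of_isEmpty, univ_unique, sum_singleton]
    by_cases ha : a.1 + a.2 = n + 1
    · rw [if_pos ha, if_pos (by simp [ha]; omega)]
      simp
    · rw [if_neg ha, if_neg (by simp [ha])]
  rw [h1, Finset.Nat.sum_antidiagonal_succ', sum_eq_single (n, 0)]
  · congr 1
    · cases n with
      | zero => simp [nested, block]
      | succ n =>
        rw [if_neg (by omega), block, List.replicate_zero, List.append_nil, nested_replicate,
          smul_zero]
    · rw [block, zero_add, nested_replicate_append _ _ _ (by simp)]
      simp [nested]
  · rintro ⟨p, q⟩ hp hne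
    have := HasAntidiagonal.mem_antidiagonal.1 hp
    obtain ⟨q, rfl⟩ : ∃ j, q = j + 1 :=
      ⟨q - 1, by have : q ≠ 0 := fun h => hne (by simp at this; ext <;> simp <;> omega); omega⟩
    rw [block, nested_replicate_append _ _ _ (by simp), nested_replicate, map_zero, smul_zero]
  · simp

lemma dynkin_zero (x y : A.Ev) (K m : ℕ) : A.dynkin x y K (m + 1) 0 = 0 := by
  refine sum_eq_zero fun p _ => if_neg ?_
  rintro ⟨h1, h2⟩
  have := h1 0
  have := sum_eq_zero_iff.1 h2 0 (mem_univ _)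
  omega

/-- The first block `x^r y^s` acts as `(ad x)^r (ad y)^s` on the bracket of the remaining word,
which is nonempty because at least one block is left. The bound `K` on the exponents is kept apart
from `n` so that the recursion can lower the degree without changing the index set. -/
lemma dynkin_succ (x y : A.Ev) {K n m : ℕ} (h : n ≤ K) : A.dynkin x y K (m + 2) n =
    ∑ p ∈ HasAntidiagonal.antidiagonal n, if p.1 = 0 then 0 else
      ∑ a ∈ HasAntidiagonal.antidiagonal p.1, (weight k a)⁻¹ •
        (A.lieEE x ^ a.1) ((A.lieEE y ^ a.2) (A.dynkin x y K (m + 1) p.2)) := by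
  have hA : ∀ a : ℕ × ℕ, (∑ q ∈ Fintype.piFinset fun _ : Fin (m + 1) =>
      range (K + 1) ×ˢ range (K + 1),
      if (∀ i, 0 < ((Fin.cons a q : Fin (m + 2) → ℕ × ℕ) i).1 + ((Fin.cons a q : Fin (m + 2) → ℕ × ℕ) i).2) ∧
          ∑ i, (((Fin.cons a q : Fin (m + 2) → ℕ × ℕ) i).1 + ((Fin.cons a q : Fin (m + 2) → ℕ × ℕ) i).2) = n then
        (∏ i, weight k ((Fin.cons a q : Fin (m + 2) → ℕ × ℕ) i))⁻¹ • A.nested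
          (List.ofFn fun i => A.block x y ((Fin.cons a q : Fin (m + 2) → ℕ × ℕ) i)).flatten else 0) =
      if a.1 + a.2 ∈ range (n + 1) then if a.1 + a.2 = 0 then 0 else (weight k a)⁻¹ •
        (A.lieEE x ^ a.1) ((A.lieEE y ^ a.2) (A.dynkin x y K (m + 1) (n - (a.1 + a.2)))) else 0 := by
    intro a
    by_cases h1 : a.1 + a.2 = 0
    · simp only [if_pos h1, ite_self]
      refine sum_eq_zero fun q _ => if_neg fun hq => ?_
      have := hq.1 0
      rw [Fin.cons_zero] at this
      omega
    by_cases h2 : a.1 + a.2 ∈ range (n + 1)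
    · rw [if_pos h2, if_neg h1, dynkin, map_sum, map_sum, smul_sum]
      have h2 := mem_range.1 h2
      refine sum_congr rfl fun q _ => ?_
      simp only [Fin.forall_fin_succ (n := m + 1), Fin.sum_univ_succ (n := m + 1),
        Fin.prod_univ_succ (n := m + 1), List.ofFn_succ (n := m + 1), Fin.cons_zero, Fin.cons_succ,
        List.flatten_cons]
      by_cases hq : (∀ i, 0 < (q i).1 + (q i).2) ∧
          ∑ i, ((q i).1 + (q i).2) = n - (a.1 + a.2)
      · have hne : (List.ofFn fun i => A.block x y (q i)).flatten ≠ [] := by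
          have := hq.1 0
          rw [List.ofFn_succ, List.flatten_cons]
          exact List.append_ne_nil_of_left_ne_nil (by simp [block]; omega) _
        rw [if_pos hq, if_pos ⟨⟨by omega, hq.1⟩, by omega⟩, block, List.append_assoc,
          nested_replicate_append _ _ _ (List.append_ne_nil_of_right_ne_nil _ hne),
          nested_replicate_append _ _ _ hne, mul_inv, map_smul, map_smul, smul_smul]
      · rw [if_neg hq, if_neg (fun h' => hq ⟨h'.1.2, by omega⟩), map_zero, map_zero, smul_zero]
    · rw [if_neg h2]
      have h2 := mt mem_range.2 h2
      refine sum_eq_zero fun q _ => if_neg fun hq => ?_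
      have := hq.2
      rw [Fin.sum_univ_succ, Fin.cons_zero] at this
      omega
  rw [dynkin, sum_piFinset_succ, sum_congr rfl fun a _ => hA a,
    Finset.Nat.sum_antidiagonal_eq_sum_range_succ_mk]
  -- The sum over first blocks is regrouped by their degree `i`; the box is large enough to contain
  -- each antidiagonal.
  have hB : ∀ i ∈ range n.succ, (if i = 0 then 0 else
      ∑ a ∈ HasAntidiagonal.antidiagonal i, (weight k a)⁻¹ •
        (A.lieEE x ^ a.1) ((A.lieEE y ^ a.2) (A.dynkin x y K (m + 1) (n - i)))) =
      ∑ a ∈ range (K + 1) ×ˢ range (K + 1), if a.1 + a.2 = i then (if i = 0 then 0 else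
        (weight k a)⁻¹ •
        (A.lieEE x ^ a.1) ((A.lieEE y ^ a.2) (A.dynkin x y K (m + 1) (n - i)))) else 0 := by
    intro i hi
    rw [sum_box (by simp at hi; omega)]
    split <;> simp
  rw [sum_congr rfl hB, sum_comm]
  exact sum_congr rfl fun a _ => by rw [sum_ite_eq]

end DGLA

/-! ### Dynkin's series as the logarithm of `e^(zx) e^(zy)` -/

namespace PronilpotentDGLA

open Filtered Finset

variable {k : Type u} [Field k] (A : PronilpotentDGLA.{u, v, w} k)

lemma expExp_apply (x y z : A.Ev) (i : ℕ) : A.expExp x y i z =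
    ∑ a ∈ HasAntidiagonal.antidiagonal i,
      (DGLA.weight k a)⁻¹ • (A.lieEE x ^ a.1) ((A.lieEE y ^ a.2) z) := by
  simp [expExp, LinearMap.sum_apply]

/-- As `w` is divisible by `z`, the operator `(ad w)^m` produces multiples of `z^m`. This disposes
of the error term of the truncated logarithm. -/
lemma seriesP_lie_pow_coeff {w : A.seriesP.Ev} (h0 : w.1 0 = 0) (a : A.seriesP.Ev) {m n : ℕ}
    (h : n < m) : ((A.seriesP.lieEE w ^ m) a).1 n = 0 := by
  induction m generalizing n with
  | zero => omega
  | succ m ih =>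
    rw [pow_succ', Module.End.mul_apply]
    refine (seqMul_apply A.lieEE A.idealEE' A.idealEE _ _ n).trans (sum_eq_zero fun p hp => ?_)
    have := HasAntidiagonal.mem_antidiagonal.1 hp
    by_cases hp1 : p.1 = 0
    · rw [hp1, h0, map_zero, LinearMap.zero_apply]
    · rw [ih (show p.2 < m by omega), map_zero]

lemma adSum_logS (w : A.Ev) (N : ℕ) : A.adSum w (logS k N) =
    ∑ m ∈ range N, ((-1 : k) ^ m / ((m + 1 : ℕ) : k)) • (A.expAd w - 1) ^ m := by
  have h : A.adSum w (expS k - 1) = A.expAd w - 1 := by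
    rw [eq_sub_iff_add_eq, expAd]
    conv_rhs => rw [show expS k = (expS k - 1) + 1 by ring]
    rw [adSum, adSum, opSum_add, opSum_one]
  simp only [logS, adSum, opSum_sum, opSum_smul, opSum_pow]
  rw [← h]

variable [CharZero k]

/-- Applying `e^(z ad x) e^(z ad y) - 1` prepends one nonempty block, while `bchDeriv` supplies the
last block. Words of degree `n + 1` meet the coefficient of `zⁿ` because `bchDeriv` is a logarithmic
derivative and has lost one power of `z`. -/
lemma dynkin_eq_coeff (x y : A.Ev) {K m n : ℕ} (h : n + 1 ≤ K) :
    A.dynkin x y K (m + 1) (n + 1) = (((A.seriesP.expAd (mon A.filE 1 x) *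
      A.seriesP.expAd (mon A.filE 1 y) - 1) ^ m) (A.bchDeriv x y)).1 n := by
  induction m generalizing n with
  | zero => exact (A.dynkin_one x y h).trans (A.bchDeriv_coeff x y n).symm
  | succ m ih =>
    rw [pow_succ', Module.End.mul_apply]
    set c := ((A.seriesP.expAd (mon A.filE 1 x) * A.seriesP.expAd (mon A.filE 1 y) - 1) ^ m)
      (A.bchDeriv x y)
    have h1 : (((A.seriesP.expAd (mon A.filE 1 x) * A.seriesP.expAd (mon A.filE 1 y) - 1)) c).1 n =
        ∑ p ∈ HasAntidiagonal.antidiagonal n, A.expExp x y p.1 (c.1 p.2) - c.1 n :=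
      congrArg (· - c.1 n) (A.seriesP_expAd_expAd_mon x y c n)
    rw [h1, DGLA.dynkin_succ _ _ _ h, eq_sub_iff_add_eq, Finset.Nat.sum_antidiagonal_succ',
      DGLA.dynkin_zero]
    simp only [map_zero, smul_zero, sum_const_zero, ite_self, zero_add]
    cases n with
    | zero => simp [expExp]
    | succ n =>
      -- The summand with an empty first block is the one removed by subtracting `1`.
      rw [Finset.Nat.sum_antidiagonal_succ, Finset.Nat.sum_antidiagonal_succ, if_pos rfl, zero_add,
        add_comm]
      refine congrArg₂ _ (by simp [expExp]) (sum_congr rfl fun p hp => ?_)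
      have := HasAntidiagonal.mem_antidiagonal.1 hp
      rw [if_neg (Nat.succ_ne_zero _), expExp_apply, ih (by omega)]

/-- The Dynkin series solves the differential equation of `log (e^{zx} e^{zy})`. -/
lemma coeff_eq_bchTerm {x y : A.Ev} {w : A.seriesP.Ev} (h0 : w.1 0 = 0)
    (h : A.seriesP.phi w (deriv A.filE w) = A.bchDeriv x y) (n : ℕ) :
    w.1 n = A.bchTerm n x y := by
  have hg : A.seriesP.expAd w =
      A.seriesP.expAd (mon A.filE 1 x) * A.seriesP.expAd (mon A.filE 1 y) := by
    ext1 a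
    have := A.expW_eq_of_phi_deriv h0 h (a, 0, 0)
    rw [expW_inl, expW_inl, expW_inl] at this
    exact congrArg (fun v => v.1) this
  cases n with
  | zero => exact h0.trans (by simp [DGLA.bchTerm])
  | succ n =>
    -- The truncated logarithm applied to `φ(w) w' = b` gives `w'` plus a term in the image of `(ad
    -- w)^(n+1)`, invisible in the coefficient of `zⁿ`. By `hg`, the logarithm depends only on `e^(z
    -- ad x) e^(z ad y)`.
    obtain ⟨r, hr⟩ := phiS_mul_logS k (n + 1)
    have h1 := congrArg (fun p => A.seriesP.adSum w p (deriv A.filE w)) hr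
    simp only [mul_comm (phiS k), adSum, opSum_mul, opSum_add, opSum_one, opSum_X_pow] at h1
    have h2 : A.seriesP.adSum w (logS k (n + 1)) (A.bchDeriv x y) = deriv A.filE w +
        (A.seriesP.lieEE w ^ (n + 1)) (A.seriesP.adSum w r (deriv A.filE w)) := by
      rw [← h]; exact h1
    have h3 := congrArg (coeffMap A.filE n) h2
    rw [map_add, coeffMap_apply _ n ((A.seriesP.lieEE w ^ (n + 1)) _),
      A.seriesP_lie_pow_coeff h0 _ (Nat.lt_succ_self n), add_zero, adSum_logS, hg] at h3
    rw [LinearMap.sum_apply, map_sum] at h3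
    simp only [LinearMap.smul_apply, map_smul, coeffMap_apply, deriv_apply] at h3
    have hn : ((n + 1 : ℕ) : k) ≠ 0 := Nat.cast_ne_zero.2 (Nat.succ_ne_zero n)
    rw [← Nat.cast_succ] at h3
    rw [← inv_smul_smul₀ hn (w.1 (n + 1)), ← h3, DGLA.bchTerm_eq, smul_sum]
    -- The power `m` of the operator corresponds to `m + 1` blocks, and the factor `1 / (n + 1)` in
    -- Dynkin's formula comes from integrating `w'`.
    refine sum_nbij' (fun m => m + 1) (fun m => m - 1) (fun m hm => by simp at hm ⊢; omega)
      (fun m hm => by simp at hm ⊢; omega) (fun m _ => rfl)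
      (fun m hm => by simp at hm ⊢; omega) fun m _ => ?_
    rw [A.dynkin_eq_coeff x y le_rfl, smul_comm, pow_succ _ (m + 1), pow_succ]
    simp

/-- `e^{x • y} = e^x e^y` on `𝔤⁰ ⊕ 𝔤¹ ⊕ k`. -/
lemma expW_bch (x y : A.Ev) (v : A.W) : A.expW (A.bch x y) v = A.expW x (A.expW y v) := by
  obtain ⟨w, ⟨h0, h⟩, -⟩ := A.existsUnique_phi_deriv (A.bchDeriv x y)
  have h1 := congrArg A.atOne.mapW (A.expW_eq_of_phi_deriv h0 h
    (mon A.filE 0 v.1, mon A.filO 0 v.2.1, v.2.2))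
  have hw : A.atOne.mapE w = A.bch x y :=
    congrArg (tsum A.filE) (funext fun n => A.coeff_eq_bchTerm h0 h n)
  have hm : ∀ (n : ℕ) (x : A.Ev), A.atOne.mapE (mon A.filE n x) = x :=
    fun n x => sumMap_mon A.limitE A.antiE n x
  have hv : A.atOne.mapW (mon A.filE 0 v.1, mon A.filO 0 v.2.1, v.2.2) = v :=
    Prod.ext (hm 0 _) (Prod.ext (sumMap_mon A.limitO A.antiO 0 _) rfl)
  rw [Hom.mapW_expW, Hom.mapW_expW, Hom.mapW_expW, hv, hw, hm, hm] at h1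
  exact h1

lemma gauge_bch (x y : A.Ev) (ξ : A.Od) : A.gauge (A.bch x y) ξ = A.gauge x (A.gauge y ξ) := by
  have h := A.expW_bch x y (0, ξ, 1)
  rw [expW_apply_one, expW_apply_one, expW_apply_one] at h
  exact congrArg (fun v => v.2.1) h

end PronilpotentDGLA

/-! ### Naturality of Dynkin's series and its variation by coboundaries -/

namespace DGLA

variable {k : Type u} [Field k]

/-- The Dynkin word with the given exponents, as a word in two letters. -/
def word {m : ℕ} (p : Fin m → ℕ × ℕ) : List Bool :=
  (List.ofFn fun i => List.replicate (p i).1 true ++ List.replicate (p i).2 false).flatten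

/-- With words in two abstract letters, the coefficients and index sets no longer depend on `x` and
`y`, so two such sums can be compared term by term. -/
lemma bchTerm_word (A : DGLA.{u, v} k) (n : ℕ) (x y : A.Ev) : A.bchTerm n x y =
    ∑ m ∈ Finset.Icc 1 n, ((-1 : k) ^ (m + 1) / (m : k)) •
    ∑ p ∈ (Fintype.piFinset fun _ : Fin m =>
        Finset.range (n + 1) ×ˢ Finset.range (n + 1)) with
        (∀ i, 0 < (p i).1 + (p i).2) ∧ ∑ i, ((p i).1 + (p i).2) = n,
      ((n : k) * ∏ i, (((p i).1.factorial : k) * ((p i).2.factorial : k)))⁻¹ •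
        A.nested ((word p).map fun b => cond b x y) := by
  simp [bchTerm, word, List.map_flatten, List.map_ofFn, Function.comp_def]

lemma map_nested {A : DGLA.{u, v} k} {B : DGLA.{u, v'} k} (f : A.Ev →ₗ[k] B.Ev)
    (hf : ∀ x y, f (A.lieEE x y) = B.lieEE (f x) (f y)) (l : List A.Ev) :
    f (A.nested l) = B.nested (l.map f) := by
  induction l with
  | nil => exact map_zero f
  | cons x l ih =>
    cases l with
    | nil => rfl
    | cons y l => exact (hf _ _).trans (congrArg _ ih)

lemma map_bchTerm {A : DGLA.{u, v} k} {B : DGLA.{u, v'} k} (f : A.Ev →ₗ[k] B.Ev)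
    (hf : ∀ x y, f (A.lieEE x y) = B.lieEE (f x) (f y)) (n : ℕ) (x y : A.Ev) :
    f (A.bchTerm n x y) = B.bchTerm n (f x) (f y) := by
  simp only [bchTerm_word, map_sum, map_smul, map_nested f hf, List.map_map, Function.comp_def]
  have h : ∀ b : Bool, f (cond b x y) = cond b (f x) (f y) := fun b => by cases b <;> rfl
  simp only [h]

lemma length_word {m n : ℕ} {p : Fin m → ℕ × ℕ} (h : ∑ i, ((p i).1 + (p i).2) = n) :
    (word p).length = n := by
  rw [← h]
  simp [word, List.length_flatten, List.map_ofFn, Function.comp_def, List.sum_ofFn]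

/-- Replacing cocycles by cohomologous cocycles changes an iterated bracket by a coboundary. -/
lemma nested_sub_mem (A : DGLA.{u, v} k) {σ : Type*} (g g' : σ → A.Ev) (hg : ∀ b, A.dE (g b) = 0)
    (hg' : ∀ b, A.dE (g' b) = 0) (h : ∀ b, ∃ u, A.dO u = g b - g' b) (l : List σ) :
    A.nested (l.map g) - A.nested (l.map g') ∈ (A.lcs (l.length - 1)).2.map A.dO := by
  induction l with
  | nil => exact ⟨0, Submodule.zero_mem _, by simp [nested]⟩
  | cons b l ih =>
    obtain ⟨u, hu⟩ := h b
    cases l with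
    | nil => exact ⟨u, trivial, hu⟩
    | cons c l =>
      obtain ⟨w, hw, hw'⟩ := ih
      set N := A.nested ((c :: l).map g)
      set N' := A.nested ((c :: l).map g')
      have hN' : A.dE N' = 0 := PronilpotentDGLA.dE_nested _ _ (by simpa using ⟨hg' c, fun a _ => hg' a⟩)
      have hmem : N' ∈ (A.lcs l.length).1 := by
        have := A.nested_mem_lcs ((c :: l).map g')
        rwa [List.length_map, List.length_cons, Nat.add_sub_cancel] at this
      -- Write `[g b, N] - [g' b, N'] = [g b, N - N'] + [g b - g' b, N']`. As `g b` and `N'` are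
      -- cocycles, the summands are `d[g b, w]` and `-d[N', u]`.
      refine ⟨A.lieEO (g b) w - A.lieEO N' u, Submodule.sub_mem _
        (Submodule.subset_span (Or.inl ⟨_, w, hw, rfl⟩))
        (Submodule.subset_span (Or.inr ⟨N', hmem, u, rfl⟩)), ?_⟩
      have e1 : A.nested ((b :: c :: l).map g) = A.lieEE (g b) N := rfl
      have e2 : A.nested ((b :: c :: l).map g') = A.lieEE (g' b) N' := rfl
      rw [e1, e2, map_sub, A.leibEO, A.leibEO, hg, hN', hu, hw', map_zero, LinearMap.zero_apply,
        LinearMap.zero_apply, map_sub, map_sub, A.skew N' (g b), A.skew N' (g' b)]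
      abel

/-- Locating the primitives in the lower central series is what allows them to be summed over all
degrees. -/
lemma bchTerm_sub_mem (A : DGLA.{u, v} k) {x x' y y' : A.Z0} (hx : ∃ u, A.dO u = x - x')
    (hy : ∃ u, A.dO u = y - y') (n : ℕ) :
    A.bchTerm n x y - A.bchTerm n x' y' ∈ (A.lcs (n - 1)).2.map A.dO := by
  rw [bchTerm_word, bchTerm_word, ← Finset.sum_sub_distrib]
  refine Submodule.sum_mem _ fun m _ => ?_
  rw [← smul_sub, ← Finset.sum_sub_distrib]
  refine Submodule.smul_mem _ _ (Submodule.sum_mem _ fun p hp => ?_)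
  rw [← smul_sub, ← length_word (Finset.mem_filter.1 hp).2.2]
  refine Submodule.smul_mem _ _ (A.nested_sub_mem _ _ ?_ ?_ ?_ _)
  · rintro (_ | _); exacts [y.2, x.2]
  · rintro (_ | _); exacts [y'.2, x'.2]
  · rintro (_ | _); exacts [hy, hx]

end DGLA

/-! ### The Baker–Campbell–Hausdorff product on cohomology, and an auxiliary dgla -/

namespace PronilpotentDGLA

open Filtered Finset

variable {k : Type u} [Field k]

/-- Naturality of the Baker–Campbell–Hausdorff product. -/
lemma map_bch {A : PronilpotentDGLA.{u, v, w} k} {B : PronilpotentDGLA.{u, v', w'} k}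
    (f : A.Ev →ₗ[k] B.Ev) (hc : Cont A.filE B.filE f)
    (hf : ∀ x y, f (A.lieEE x y) = B.lieEE (f x) (f y)) (x y : A.Ev) :
    f (A.bch x y) = B.bch (f x) (f y) := by
  have h := (A.bch_isSum x y).map hc
  simp only [DGLA.map_bchTerm f hf] at h
  exact h.unique B.limitE (B.bch_isSum _ _)

variable (A : PronilpotentDGLA.{u, v, w} k)

/-- The primitives of the homogeneous components form a null sequence, and the continuous
differential may be applied to their sum termwise. -/
lemma bch_sub_mem {x x' y y' : A.Z0} (hx : ∃ u, A.dO u = x - x') (hy : ∃ u, A.dO u = y - y') :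
    ∃ u, A.dO u = A.bch x y - A.bch x' y' := by
  choose u hu hu' using A.bchTerm_sub_mem hx hy
  have hnull : u ∈ nullSeq A.filO := fun i => by
    obtain ⟨N, hN⟩ := A.nilpotent i
    exact ⟨N + 1, fun n hn => hN.2 ((A.lcs_antitone (by omega)).2 (hu n))⟩
  refine ⟨tsum A.filO u, ((isSum_tsum A.limitO A.antiO hnull).map A.cont_dO).unique A.limitE ?_⟩
  simp only [hu']
  exact (A.bch_isSum _ _).sub (A.bch_isSum _ _)

/-- The dgla `𝔤⁰[z] ⊕ 𝔤⁰[z] dz` with the bracket of `𝔤⁰` and the differential `d/dz`. -/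
abbrev evenFormsDGLA : DGLA.{u, v} k where
    Ev := nullSeq A.filE
    Od := nullSeq A.filE
    lieEE := A.seriesP.lieEE
    lieEO := A.seriesP.lieEE
    lieOO := 0
    skew := A.seriesP.skew
    symm := fun _ _ => rfl
    jacEEE := A.seriesP.jacEEE
    jacEEO := A.seriesP.jacEEE
    jacEOO := fun x u v => by simp
    jacOOO := fun u v w => by simp
    dE := deriv A.filE
    dO := 0
    dO_dE := fun _ => rfl
    dE_dO := fun _ => map_zero _
    leibEE := fun x y => by
      rw [← A.seriesP.skew]
      exact deriv_seqMul A.lieEE A.idealEE' A.idealEE x y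
    leibEO := fun x u => by simp
    leibOO := fun u v => by simp

lemma evenFormsDGLA_lcs (n : ℕ) : (A.evenFormsDGLA.lcs n).1 ≤ (A.seriesP.lcs n).1 ∧
    (A.evenFormsDGLA.lcs n).2 ≤ (A.seriesP.lcs n).1 := by
  induction n with
  | zero => exact ⟨le_top, le_top⟩
  | succ n ih =>
    constructor <;> refine Submodule.span_le.2 ?_
    · rintro z (⟨x, y, hy, rfl⟩ | ⟨x, y, hy, rfl⟩)
      · exact Submodule.subset_span (Or.inl ⟨x, y, ih.1 hy, rfl⟩)
      · exact Submodule.zero_mem _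
    · rintro z (⟨x, y, hy, rfl⟩ | ⟨y, hy, x, rfl⟩)
      · exact Submodule.subset_span (Or.inl ⟨x, y, ih.2 hy, rfl⟩)
      · exact (A.seriesP.skew y x) ▸ Submodule.neg_mem _
          (Submodule.subset_span (Or.inl ⟨x, y, ih.1 hy, rfl⟩))

/-- The pronilpotent dgla `𝔤⁰[z] ⊕ 𝔤⁰[z] dz`. -/
abbrev evenForms : PronilpotentDGLA.{u, v, w} k :=
  { A.evenFormsDGLA with
    ι := A.ι
    filE := A.seriesP.filE
    filO := A.seriesP.filE
    antiE := A.seriesP.antiE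
    antiO := A.seriesP.antiE
    idealEE := A.seriesP.idealEE
    idealEO := A.seriesP.idealEE
    idealEO' := A.seriesP.idealEE'
    idealOO := fun i _ _ _ => Submodule.zero_mem _
    dE_mem := fun i _ hx => deriv_mem _ hx
    dO_mem := fun i _ _ => Submodule.zero_mem _
    nilpotent := fun i => by
      obtain ⟨N, h, -⟩ := A.seriesP.nilpotent i
      exact ⟨N, (A.evenFormsDGLA_lcs N).1.trans h, (A.evenFormsDGLA_lcs N).2.trans h⟩
    limitE := A.seriesP.limitE
    limitO := A.seriesP.limitE }

/-- The bracket with `0` vanishes, so the gauge series starts from `-y'`. The orbit of `0` thus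
records `φ(y) y'`, which determines every `y` with `y(0) = 0`. -/
lemma evenForms_gauge (y : A.seriesP.Ev) :
    (A.evenForms.gauge y 0 : A.seriesP.Ev) = -A.seriesP.phi y (deriv A.filE y) := by
  have h : IsSum A.seriesP.filE (fun n => (-1 : k) • ((phiS k).coeff n •
      (A.seriesP.lieEE y ^ n) (deriv A.filE y))) (-1 • A.seriesP.phi y (deriv A.filE y)) := by
    have := (opSum_isSum A.seriesP.limitE A.seriesP.antiE (A.seriesP.topNil_ad y) (phiS k)
      (deriv A.filE y)).smul (-1)
    convert this using 1
    simp only [neg_one_smul]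
    rfl
  have h' : IsSum A.seriesP.filE (fun n => (((n + 1).factorial : k))⁻¹ •
      (A.seriesP.lieEE y ^ n) (A.seriesP.lieEE y 0 - deriv A.filE y))
      (A.evenForms.gauge y 0 - 0) := A.evenForms.gauge_isSum y 0
  have e : ∀ n, (((n + 1).factorial : k))⁻¹ •
      (A.seriesP.lieEE y ^ n) (A.seriesP.lieEE y 0 - deriv A.filE y) =
      (-1 : k) • ((phiS k).coeff n • (A.seriesP.lieEE y ^ n) (deriv A.filE y)) := by
    intro n
    rw [map_zero, zero_sub, map_neg, smul_neg, coeff_phiS]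
    exact (neg_one_smul k _).symm
  simp only [e] at h'
  have := h'.unique A.seriesP.limitE h
  rwa [sub_zero, neg_one_smul] at this

/-! ### The group `exp(H⁰)` -/

lemma expCls_eq_iff (x y : A.Z0) : A.expCls x = A.expCls y ↔ ∃ u, A.dO u = x.1 - y.1 := by
  rw [expCls, expCls, ExpH0.mk.injEq, Submodule.Quotient.eq]
  rfl

lemma expCls_surjective : Function.Surjective A.expCls := fun g => by
  obtain ⟨x, hx⟩ := Submodule.Quotient.mk_surjective _ g.log
  exact ⟨x, ExpH0.ext hx⟩

variable [CharZero k]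

/-- The Baker–Campbell–Hausdorff product of commuting elements. -/
lemma bch_of_lie_eq_zero {x y : A.Ev} (h : A.lieEE x y = 0) : A.bch x y = x + y := by
  -- For commuting `x` and `y` the logarithmic derivative is the constant `x + y`, so `z (x + y)`
  -- solves the equation.
  have hb : A.seriesP.phi (mon A.filE 1 (x + y)) (deriv A.filE (mon A.filE 1 (x + y))) =
      A.bchDeriv x y := by
    rw [deriv_mon_one, seriesP_phi_mon, map_add, bchDeriv, expAd, opSum_of_apply_eq_zero]
    · simp
    · rw [seriesP_lie_mon, h, map_zero]
  have h1 := A.coeff_eq_bchTerm (by simp [mon_apply]) hb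
  exact (congrArg (tsum A.filE) (funext fun n => (h1 n).symm)).trans
    (sumMap_mon A.limitE A.antiE 1 (x + y))

@[simp] lemma zero_bch (x : A.Ev) : A.bch 0 x = x := by
  rw [bch_of_lie_eq_zero _ (by simp), zero_add]

@[simp] lemma neg_bch (x : A.Ev) : A.bch (-x) x = 0 := by
  rw [bch_of_lie_eq_zero _ (by simp [lieEE_self]), neg_add_cancel]

@[simp] lemma bch_neg (x : A.Ev) : A.bch x (-x) = 0 := by
  rw [bch_of_lie_eq_zero _ (by simp [lieEE_self]), add_neg_cancel]

/-- Associativity of the Baker–Campbell–Hausdorff product. -/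
lemma bch_assoc (x y z : A.Ev) : A.bch (A.bch x y) z = A.bch x (A.bch y z) := by
  set X := mon A.filE 1 x
  set Y := mon A.filE 1 y
  set Z := mon A.filE 1 z
  have h0 : ∀ p q : A.seriesP.Ev, p.1 0 = 0 → q.1 0 = 0 → (A.seriesP.bch p q).1 0 = 0 := by
    intro p q hp hq
    have := map_bch A.atZero.mapE A.atZero.contE A.atZero.map_lieEE p q
    refine this.trans ?_
    rw [show A.atZero.mapE p = 0 from hp, show A.atZero.mapE q = 0 from hq, zero_bch]
  have hX : X.1 0 = 0 := by simp [X, mon_apply]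
  have hY : Y.1 0 = 0 := by simp [Y, mon_apply]
  have hZ : Z.1 0 = 0 := by simp [Z, mon_apply]
  -- Both bracketings act on `0` as `e^X e^Y e^Z`. The product of series is also the product in
  -- `evenForms`, since it depends only on the Lie algebra of even elements. The factor `z` in `X`,
  -- `Y`, `Z` provides the initial condition for uniqueness.
  have hg : A.evenForms.gauge (A.seriesP.bch (A.seriesP.bch X Y) Z) 0 =
      A.evenForms.gauge (A.seriesP.bch X (A.seriesP.bch Y Z)) 0 := by
    have hb : ∀ p q : A.seriesP.Ev, A.seriesP.bch p q = A.evenForms.bch p q :=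
      map_bch (A := A.seriesP) (B := A.evenForms) LinearMap.id (fun i => ⟨i, fun _ h => h⟩)
        fun _ _ => rfl
    rw [hb, hb, hb, hb, gauge_bch, gauge_bch, gauge_bch, gauge_bch]
  rw [evenForms_gauge, evenForms_gauge, neg_inj] at hg
  have hS := (A.existsUnique_phi_deriv _).unique ⟨h0 _ _ (h0 _ _ hX hY) hZ, hg⟩
    ⟨h0 _ _ hX (h0 _ _ hY hZ), rfl⟩
  have h1 := congrArg A.atOne.mapE hS
  have hm : ∀ x : A.Ev, A.atOne.mapE (mon A.filE 1 x) = x :=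
    fun x => sumMap_mon A.limitE A.antiE 1 x
  simpa only [map_bch A.atOne.mapE A.atOne.contE A.atOne.map_lieEE, X, Y, Z, hm] using h1

/-- The group structure on `exp(H⁰)` given by the Baker–Campbell–Hausdorff product. -/
lemma exists_group : ∃ _ : Group A.ExpH0,
    ∀ x y : A.Z0, A.expCls x * A.expCls y = A.expCls (A.bchZ x y) := by
  let r := Function.surjInv A.expCls_surjective
  have hr : ∀ g, A.expCls (r g) = g := Function.surjInv_eq A.expCls_surjective
  let _ : Mul A.ExpH0 := ⟨fun g h => A.expCls (A.bchZ (r g) (r h))⟩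
  let _ : One A.ExpH0 := ⟨A.expCls 0⟩
  let _ : Inv A.ExpH0 := ⟨fun g => A.expCls (-r g)⟩
  -- The product was defined through chosen representatives; cohomologous cocycles have cohomologous
  -- products.
  have hmul : ∀ x y : A.Z0, A.expCls x * A.expCls y = A.expCls (A.bchZ x y) := fun x y =>
    (A.expCls_eq_iff _ _).2 (A.bch_sub_mem ((A.expCls_eq_iff _ _).1 (hr _))
      ((A.expCls_eq_iff _ _).1 (hr _)))
  refine ⟨Group.ofLeftAxioms (fun a b c => ?_) (fun a => ?_) (fun a => ?_), hmul⟩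
  · rw [← hr a, ← hr b, ← hr c]
    simp only [hmul]
    exact congrArg A.expCls (Subtype.ext (A.bch_assoc _ _ _))
  · conv_lhs => rw [← hr a]
    refine (hmul 0 (r a)).trans ((congrArg A.expCls (Subtype.ext (A.zero_bch _))).trans (hr a))
  · have : A.expCls (-r a) * A.expCls (r a) = A.expCls 0 :=
      (hmul _ _).trans (congrArg A.expCls (Subtype.ext (A.neg_bch _)))
    rwa [hr a] at this

end PronilpotentDGLA

namespace PronilpotentDGLA

open Filtered Finset

variable {k : Type u} [Field k] (A : PronilpotentDGLA.{u, v, w} k)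

/-! ### Gauge equivalence and homotopy -/

lemma gauge_zero (ξ : A.Od) : A.gauge 0 ξ = ξ := by
  have h := A.expW_apply_one 0 ξ
  rw [expW_zero] at h
  exact (congrArg (fun v => v.2.1) h).symm

/-- Each term of the gauge series is a multiple of a power of `ad y` applied to `[y, ξ] - dy = -d^ξ
y`. -/
lemma gauge_of_twistE_eq_zero {y : A.Ev} {ξ : A.Od} (h : A.twistE ξ y = 0) : A.gauge y ξ = ξ := by
  have h' : A.lieEO y ξ - A.dE y = 0 := by rw [← neg_sub, ← DGLA.twistE_apply, h, neg_zero]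
  have hs := A.gauge_isSum y ξ
  simp only [h', map_zero, smul_zero] at hs
  exact sub_eq_zero.1 (hs.unique A.limitO fun i => ⟨0, fun n _ => by simp⟩)

lemma topNil_lieEO (y : A.Ev) : TopNil A.filO (A.lieEO y) where
  stable i v hv := A.idealEO i y v hv
  nil i := by
    obtain ⟨N, -, h⟩ := A.nilpotent i
    exact ⟨N, fun n hn v => h ((A.lcs_antitone hn).2 (A.lieEO_pow_mem_lcs y v n))⟩

/-- The path `z ↦ e^{zy} · ξ`. -/
noncomputable def gaugePath (y : A.Ev) (ξ : A.Od) : A.seriesP.Od :=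
  A.seriesP.gauge (mon A.filE 1 y) (mon A.filO 0 ξ)

lemma gaugePath_zero (y : A.Ev) (ξ : A.Od) : (A.gaugePath y ξ).1 0 = ξ := by
  refine (A.atZero.map_gauge _ _).trans ?_
  have h1 : A.atZero.mapE (mon A.filE 1 y) = 0 := by simp [atZero, mon_apply]
  have h2 : A.atZero.mapO (mon A.filO 0 ξ) = ξ := by simp [atZero, mon_apply]
  rw [h1, h2, gauge_zero]

lemma gaugePath_one (y : A.Ev) (ξ : A.Od) : A.atOne.mapO (A.gaugePath y ξ) = A.gauge y ξ := by
  refine (A.atOne.map_gauge _ _).trans ?_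
  exact congrArg₂ A.gauge (sumMap_mon A.limitE A.antiE 1 y) (sumMap_mon A.limitO A.antiO 0 ξ)

variable [CharZero k]

lemma gauge_neg_gauge (y : A.Ev) (ξ : A.Od) : A.gauge (-y) (A.gauge y ξ) = ξ := by
  rw [← gauge_bch, neg_bch, gauge_zero]

/-- An even element whose gauge action fixes `ξ` is a cocycle for `d^ξ`. -/
lemma twistE_eq_zero_of_gauge {y : A.Ev} {ξ : A.Od} (h : A.gauge y ξ = ξ) : A.twistE ξ y = 0 := by
  have h1 : opSum A.limitO A.antiO (A.topNil_lieEO y) (phiS k) (A.lieEO y ξ - A.dE y) = 0 := by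
    refine opSum_eq _ _ _ ?_
    have := A.gauge_isSum y ξ
    rw [h, sub_self] at this
    simpa only [coeff_phiS] using this
  -- The hypothesis reads `φ(ad y) (-d^ξ y) = 0`, and `φ(ad y)` is cancelled by its inverse power
  -- series.
  obtain ⟨q, hq⟩ := (isUnit_phiS k).exists_left_inv
  have h2 := congrArg (fun p => opSum A.limitO A.antiO (A.topNil_lieEO y) p
    (A.lieEO y ξ - A.dE y)) hq
  simp only [opSum_mul, opSum_one, Module.End.mul_apply, h1, map_zero, Module.End.one_apply] at h2
  rw [DGLA.twistE_apply, ← neg_sub, ← h2, neg_zero]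

/-- This is the odd component of `derivW_expW` at `(0, ξ, 1)`, a vector with derivative zero because
`ξ` is constant in `z`. -/
lemma deriv_gauge (w : A.seriesP.Ev) (ξ : A.Od) :
    deriv A.filO (A.seriesP.gauge w (mon A.filO 0 ξ)) =
      A.seriesP.lieEO (A.seriesP.phi w (deriv A.filE w)) (A.seriesP.gauge w (mon A.filO 0 ξ)) -
        A.seriesP.dE (A.seriesP.phi w (deriv A.filE w)) := by
  have h := A.derivW_expW w (0, mon A.filO 0 ξ, 1)
  have h0 : A.derivW (0, mon A.filO 0 ξ, 1) = 0 := by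
    simp only [derivW_apply, map_zero, deriv_mon_zero]
    rfl
  rw [h0, map_zero, add_zero, expW_apply_one, derivW_apply, rho_apply, one_smul] at h
  exact congrArg (fun v => v.2.1) h

lemma deriv_gaugePath (y : A.Ev) (ξ : A.Od) :
    deriv A.filO (A.gaugePath y ξ) = A.seriesP.lieEO (mon A.filE 0 y) (A.gaugePath y ξ) -
      A.seriesP.dE (mon A.filE 0 y) := by
  have h := A.deriv_gauge (mon A.filE 1 y) ξ
  rwa [deriv_mon_one, seriesP_phi_mon] at h

/-- The curvature is constantly zero along a path tangent to the gauge orbits which starts at a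
Maurer–Cartan element. -/
lemma maurerCartan_of_deriv_eq {a : A.seriesP.Od} {b : A.seriesP.Ev}
    (h : deriv A.filO a = A.seriesP.lieEO b a - A.seriesP.dE b)
    (h0 : A.dO (a.1 0) + (2 : k)⁻¹ • A.lieOO (a.1 0) (a.1 0) = 0) :
    A.seriesP.dO a + (2 : k)⁻¹ • A.seriesP.lieOO a a = 0 := by
  -- The curvature `F = da + ½[a, a]` satisfies the linear equation `F' = [b, F]` and vanishes at `z
  -- = 0`.
  refine eq_zero_of_deriv_eq A.lieEE A.idealEE' A.idealEE (b := b) ?_ ?_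
  · have e1 : deriv A.filE (A.seriesP.dO a) = A.seriesP.dO (deriv A.filO a) :=
      (seqMap_deriv A.filO A.dO A.cont_dO a).symm
    have e2 : deriv A.filE (A.seriesP.lieOO a a) = A.seriesP.lieOO (deriv A.filO a) a +
        A.seriesP.lieOO a (deriv A.filO a) := deriv_seqMul A.lieOO A.idealOO' A.idealOO a a
    have e3 := A.seriesP.jacEOO b a a
    rw [A.seriesP.symm (deriv A.filO a) a, ← two_smul k] at e2
    rw [A.seriesP.symm (A.seriesP.lieEO b a) a, ← two_smul k] at e3
    rw [map_add, map_smul, e1, e2, smul_smul, inv_mul_cancel₀ two_ne_zero, one_smul, h]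
    refine Eq.trans ?_ (map_add (A.seriesP.lieEE b) _ _).symm
    rw [map_smul, e3, smul_smul, inv_mul_cancel₀ two_ne_zero, one_smul, map_sub, map_sub,
      A.seriesP.dO_dE, A.seriesP.leibEO, A.seriesP.symm (A.seriesP.dE b) a]
    abel
  · refine Eq.trans ?_ h0
    exact congrArg (fun z => A.dO (a.1 0) + (2 : k)⁻¹ • z)
      (seqMul_zero A.lieOO A.idealOO' A.idealOO a a)

lemma gaugePath_mem_MC (y : A.Ev) (ξ : A.MC) :
    A.seriesP.dO (A.gaugePath y ξ.1) +
      (2 : k)⁻¹ • A.seriesP.lieOO (A.gaugePath y ξ.1) (A.gaugePath y ξ.1) = 0 :=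
  A.maurerCartan_of_deriv_eq (A.deriv_gaugePath y ξ.1) (by rw [gaugePath_zero]; exact ξ.2)

/-- The gauge action on Maurer–Cartan elements. -/
noncomputable def gaugeMC (y : A.Ev) (ξ : A.MC) : A.MC :=
  ⟨A.gauge y ξ.1, by
    have h := (A.atOne.mapMC ⟨_, A.gaugePath_mem_MC y ξ⟩).2
    rwa [show (A.atOne.mapMC ⟨_, A.gaugePath_mem_MC y ξ⟩).1 = A.gauge y ξ.1 from
      A.gaugePath_one y ξ.1] at h⟩

/-- Gauge equivalent Maurer–Cartan elements are homotopic. -/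
lemma homotopic_gaugeMC (y : A.Ev) (ξ : A.MC) : A.Homotopic ξ (A.gaugeMC y ξ) := by
  -- The `dz` component of the Maurer–Cartan equation for `a + b dz` is `db - a' - [b, a] = 0`; the
  -- equation `a' = [y, a] - dy` of the gauge path forces `b = -y`.
  refine ⟨⟨(A.gaugePath y ξ.1, -mon A.filE 0 y), Prod.ext (A.gaugePath_mem_MC y ξ) ?_⟩,
    A.gaugePath_zero y ξ.1, A.gaugePath_one y ξ.1⟩
  have h := A.deriv_gaugePath y ξ.1
  set a := A.gaugePath y ξ.1
  change A.seriesP.dE (-mon A.filE 0 y) - deriv A.filO a + (2 : k)⁻¹ •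
    (-(A.seriesP.lieEO (-mon A.filE 0 y) a + A.seriesP.lieEO (-mon A.filE 0 y) a)) = 0
  rw [h, ← two_smul k, smul_neg, smul_smul, inv_mul_cancel₀ two_ne_zero, one_smul, map_neg,
    map_neg, LinearMap.neg_apply]
  abel

/-- Homotopic Maurer–Cartan elements are gauge equivalent. -/
lemma exists_gauge_of_homotopic {ξ η : A.MC} (h : A.Homotopic ξ η) : ∃ y, A.gauge y ξ.1 = η.1 := by
  obtain ⟨⟨⟨a, b⟩, hMC⟩, h0, h1⟩ := h
  have h0 : a.1 0 = ξ.1 := h0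
  have h1 : A.atOne.mapO a = η.1 := h1
  have h2 : A.seriesP.dE b - deriv A.filO a + (2 : k)⁻¹ •
    (-(A.seriesP.lieEO b a + A.seriesP.lieEO b a)) = 0 := congrArg (fun v => v.2) hMC
  rw [← two_smul k, smul_neg, smul_smul, inv_mul_cancel₀ two_ne_zero, one_smul] at h2
  -- With `φ(w) w' = -b`, the path `e^w · ξ` satisfies the equation `a' = db - [b, a]` of the
  -- homotopy. Their difference solves a homogeneous linear equation with zero initial value.
  obtain ⟨w, ⟨hw0, hw⟩, -⟩ := A.existsUnique_phi_deriv (-b)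
  have hg := A.deriv_gauge w ξ.1
  rw [hw] at hg
  set g := A.seriesP.gauge w (mon A.filO 0 ξ.1)
  have hg0 : g.1 0 = ξ.1 := by
    refine (A.atZero.map_gauge _ _).trans ?_
    have h2 : A.atZero.mapO (mon A.filO 0 ξ.1) = ξ.1 := by simp [atZero, mon_apply]
    rw [show A.atZero.mapE w = 0 from hw0, h2, gauge_zero]
  have hga : g = a := by
    refine sub_eq_zero.1 (eq_zero_of_deriv_eq A.lieEO A.idealEO' A.idealEO (b := -b) (a := g - a)
      ?_ (sub_eq_zero.2 (hg0.trans h0.symm)))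
    refine Eq.trans ?_ (map_sub (A.seriesP.lieEO (-b)) g a).symm
    have h3 : deriv A.filO a = A.seriesP.dE b - A.seriesP.lieEO b a := by
      rw [← sub_eq_zero, ← neg_eq_zero, ← h2]
      abel
    rw [map_sub, hg, h3]
    simp only [map_neg, LinearMap.neg_apply]
    abel
  refine ⟨A.atOne.mapE w, ?_⟩
  rw [← h1, ← hga]
  refine Eq.trans ?_ (A.atOne.map_gauge _ _).symm
  exact congrArg _ (sumMap_mon A.limitO A.antiO 0 ξ.1).symm

/-- Two Maurer–Cartan elements define the same class if and only if they are gauge equivalent. -/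
lemma cls_eq_iff (ξ η : A.MC) : A.cls ξ = A.cls η ↔ ∃ y, A.gauge y ξ.1 = η.1 := by
  constructor
  · intro h
    have h' := Quot.eqvGen_exact h
    clear h
    induction h' with
    | rel _ _ h => exact A.exists_gauge_of_homotopic h
    | refl _ => exact ⟨0, A.gauge_zero _⟩
    | symm ξ η _ ih =>
      obtain ⟨y, hy⟩ := ih
      exact ⟨-y, by rw [← hy, gauge_neg_gauge]⟩
    | trans ξ η ζ _ _ ih1 ih2 =>
      obtain ⟨y, hy⟩ := ih1
      obtain ⟨y', hy'⟩ := ih2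
      exact ⟨A.bch y' y, by rw [gauge_bch, hy, hy']⟩
  · rintro ⟨y, hy⟩
    have : η = A.gaugeMC y ξ := Subtype.ext hy.symm
    rw [this]
    exact Quot.sound (A.homotopic_gaugeMC y ξ)

end PronilpotentDGLA

namespace PronilpotentDGLA

open Filtered Finset

variable {k : Type u} [Field k] [CharZero k]

/-! ### The action on the moduli set of the twisted kernel -/

section action

variable {A : PronilpotentDGLA.{u, v, w} k} {B : PronilpotentDGLA.{u, v', w'} k} (f : Hom A B)
  (ξ : A.MC)

lemma map_lift (η : (twistedKer f ξ).MC) : f.mapO (lift f ξ η).1 = f.mapO ξ.1 := by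
  change f.mapO ((show LinearMap.ker f.mapO from η.1).1 + ξ.1) = _
  rw [map_add, LinearMap.mem_ker.1 (show LinearMap.ker f.mapO from η.1).2, zero_add]

/-- For `η = ζ - ξ`, the curvature of `η` in `𝔤^ξ` is the difference of the curvatures of `ζ` and
`ξ` in `𝔤`. -/
lemma exists_lift_eq (ζ : A.MC) (h : f.mapO ζ.1 = f.mapO ξ.1) :
    ∃ η : (twistedKer f ξ).MC, lift f ξ η = ζ := by
  have hmem : ζ.1 - ξ.1 ∈ LinearMap.ker f.mapO := by rw [LinearMap.mem_ker, map_sub, h, sub_self]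
  refine ⟨⟨⟨ζ.1 - ξ.1, hmem⟩, Subtype.ext ?_⟩, Subtype.ext (sub_add_cancel _ _)⟩
  change A.dO (ζ.1 - ξ.1) + A.lieOO ξ.1 (ζ.1 - ξ.1) +
    (2 : k)⁻¹ • A.lieOO (ζ.1 - ξ.1) (ζ.1 - ξ.1) = 0
  have h1 : A.dO ξ.1 = -((2 : k)⁻¹ • A.lieOO ξ.1 ξ.1) := eq_neg_of_add_eq_zero_left ξ.2
  have h2 : A.dO ζ.1 = -((2 : k)⁻¹ • A.lieOO ζ.1 ζ.1) := eq_neg_of_add_eq_zero_left ζ.2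
  have h3 : (2 : k)⁻¹ • A.lieOO (ζ.1 - ξ.1) (ζ.1 - ξ.1) = (2 : k)⁻¹ • A.lieOO ζ.1 ζ.1 -
      A.lieOO ξ.1 ζ.1 + (2 : k)⁻¹ • A.lieOO ξ.1 ξ.1 := by
    have : A.lieOO (ζ.1 - ξ.1) (ζ.1 - ξ.1) =
        A.lieOO ζ.1 ζ.1 - (2 : k) • A.lieOO ξ.1 ζ.1 + A.lieOO ξ.1 ξ.1 := by
      simp only [map_sub, LinearMap.sub_apply, A.symm ζ.1 ξ.1, two_smul]; abel
    rw [this, smul_add, smul_sub, smul_smul, inv_mul_cancel₀ two_ne_zero, one_smul]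
  have h4 : A.lieOO ξ.1 ξ.1 = (2 : k)⁻¹ • A.lieOO ξ.1 ξ.1 + (2 : k)⁻¹ • A.lieOO ξ.1 ξ.1 := by
    rw [← two_smul k, smul_smul, mul_inv_cancel₀ two_ne_zero, one_smul]
  rw [h3, map_sub, map_sub, h1, h2]
  generalize (2 : k)⁻¹ • A.lieOO ξ.1 ξ.1 = q at h4 ⊢
  rw [h4]
  abel

/-- The identity `[c, η] - d^ξ c = [c, η + ξ] - dc` makes the two gauge series agree term by term.
-/
lemma lift_gauge (c : A.Ev) (hc : f.mapE c = 0) (η : (twistedKer f ξ).MC) :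
    (lift f ξ ((twistedKer f ξ).gaugeMC ⟨c, hc⟩ η)).1 = A.gauge c (lift f ξ η).1 := by
  have h := ((twistedKer f ξ).gauge_isSum ⟨c, hc⟩ η.1).map (J := A.filO)
    (f := (LinearMap.ker f.mapO).subtype) fun i => ⟨i, fun _ hx => hx⟩
  have hp : ∀ (n : ℕ) (u : LinearMap.ker f.mapO),
      ((((twistedKer f ξ).lieEO ⟨c, hc⟩ ^ n) u : LinearMap.ker f.mapO) : A.Od) =
        (A.lieEO c ^ n) u.1 := by
    intro n
    induction n with
    | zero => intro u; rfl
    | succ n ih =>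
      intro u
      rw [pow_succ, pow_succ, Module.End.mul_apply, Module.End.mul_apply]
      exact ih _
  have h2 := A.gauge_isSum c (lift f ξ η).1
  have e : ∀ n : ℕ, (LinearMap.ker f.mapO).subtype (((n + 1).factorial : k)⁻¹ •
      ((twistedKer f ξ).lieEO ⟨c, hc⟩ ^ n) ((twistedKer f ξ).lieEO ⟨c, hc⟩ η.1 -
        (twistedKer f ξ).dE ⟨c, hc⟩)) = ((n + 1).factorial : k)⁻¹ •
      (A.lieEO c ^ n) (A.lieEO c (lift f ξ η).1 - A.dE c) := by
    intro n
    rw [map_smul]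
    refine congrArg _ ((hp n _).trans (congrArg _ ?_))
    change A.lieEO c (inclO f ξ η.1) - (A.dE c - A.lieEO c ξ.1) =
      A.lieEO c (inclO f ξ η.1 + ξ.1) - A.dE c
    rw [map_add]
    abel
  simp only [e] at h
  have h3 := h.unique A.limitO h2
  have h4 : (inclO f ξ ((twistedKer f ξ).gauge ⟨c, hc⟩ η.1) - inclO f ξ η.1) =
      A.gauge c (lift f ξ η).1 - (inclO f ξ η.1 + ξ.1) := h3
  change inclO f ξ ((twistedKer f ξ).gauge ⟨c, hc⟩ η.1) + ξ.1 = _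
  rw [sub_eq_iff_eq_add.1 h4]
  abel

lemma lift_injective : Function.Injective (lift f ξ) := fun η η' h => by
  have : inclO f ξ η.1 + ξ.1 = inclO f ξ η'.1 + ξ.1 := congrArg Subtype.val h
  exact Subtype.ext (Subtype.ext (add_right_cancel this))

/-- Two Maurer–Cartan elements of the twisted kernel define the same class if and only if their
images in `MC(𝔤)` are related by the gauge action of the kernel. -/
lemma cls_twistedKer_eq_iff (η η' : (twistedKer f ξ).MC) :
    (twistedKer f ξ).cls η = (twistedKer f ξ).cls η' ↔
      ∃ c, f.mapE c = 0 ∧ A.gauge c (lift f ξ η).1 = (lift f ξ η').1 := by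
  rw [cls_eq_iff]
  constructor
  · rintro ⟨⟨c, hc⟩, h⟩
    refine ⟨c, hc, ?_⟩
    rw [← lift_gauge f ξ c hc η]
    exact congrArg (fun η => (lift f ξ η).1)
      (Subtype.ext h : (twistedKer f ξ).gaugeMC ⟨c, hc⟩ η = η')
  · rintro ⟨c, hc, h⟩
    refine ⟨⟨c, hc⟩, ?_⟩
    rw [← lift_gauge f ξ c hc η] at h
    exact congrArg Subtype.val (lift_injective f ξ (Subtype.ext h))

/-- As `f y` is a cocycle of `𝔥^ξ₀`, the element `e^(f y)` fixes `ξ₀`, so `e^y · (η + ξ)` still lies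
over `ξ₀`. -/
lemma exists_lift_eq_gauge (y : A.Ev) (η : (twistedKer f ξ).MC)
    (hy : B.twistE (f.mapO ξ.1) (f.mapE y) = 0) :
    ∃ η' : (twistedKer f ξ).MC, (lift f ξ η').1 = A.gauge y (lift f ξ η).1 := by
  obtain ⟨η', h⟩ := exists_lift_eq f ξ (A.gaugeMC y (lift f ξ η)) (by
    refine (f.map_gauge y _).trans ?_
    rw [map_lift, B.gauge_of_twistE_eq_zero hy])
  exact ⟨η', congrArg Subtype.val h⟩

/-- The product involves only the bracket and the filtration, which twisting leaves unchanged. -/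
lemma map_bch_twist (ζ : B.MC) (x y : A.Ev) :
    f.mapE (A.bch x y) = (B.twist ζ).bch (f.mapE x) (f.mapE y) :=
  map_bch (B := B.twist ζ) f.mapE f.contE f.map_lieEE x y

/-- The action of `exp(H⁰)` is well defined. -/
lemma cls_gauge_eq (hfO : Function.Surjective f.mapO) {y y' : A.Ev}
    {y₀ y₀' : (B.twist (f.mapMC ξ)).Z0} (hy : f.mapE y = y₀.1) (hy' : f.mapE y' = y₀'.1)
    (h₀ : (B.twist (f.mapMC ξ)).expCls y₀ = (B.twist (f.mapMC ξ)).expCls y₀')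
    {η η' θ θ' : (twistedKer f ξ).MC} (hη : (twistedKer f ξ).cls η = (twistedKer f ξ).cls η')
    (hθ : (lift f ξ θ).1 = A.gauge y (lift f ξ η).1)
    (hθ' : (lift f ξ θ').1 = A.gauge y' (lift f ξ η').1) :
    (twistedKer f ξ).cls θ = (twistedKer f ξ).cls θ' := by
  obtain ⟨c, hc, hcη⟩ := (cls_twistedKer_eq_iff f ξ _ _).1 hη
  -- Since `y₀` and `y₀'` are cohomologous, `y₀' • (-y₀)` differs by a coboundary from `y₀ • (-y₀) =
  -- 0`. Its primitive is then lifted to `𝔤`, and `e = d^(θ + ξ) u'` lifts the coboundary while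
  -- fixing `θ + ξ`.
  obtain ⟨u, hu⟩ := (B.twist (f.mapMC ξ)).bch_sub_mem (y := -y₀) (y' := -y₀)
    ((expCls_eq_iff _ _ _).1 h₀.symm) ⟨0, by rw [map_zero, sub_self]⟩
  rw [Submodule.coe_neg, bch_neg, sub_zero] at hu
  obtain ⟨u', rfl⟩ := hfO u
  set e := A.twistO (lift f ξ θ).1 u'
  have hfe : f.mapE e = (B.twist (f.mapMC ξ)).bch y₀'.1 (-y₀.1) := by
    rw [← hu]
    change f.mapE (A.dO u' + A.lieOO (lift f ξ θ).1 u') =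
      B.dO (f.mapO u') + B.lieOO (f.mapO ξ.1) (f.mapO u')
    rw [map_add, f.map_dO, f.map_lieOO, map_lift]
  have he : A.gauge e (lift f ξ θ).1 = (lift f ξ θ).1 :=
    A.gauge_of_twistE_eq_zero ((A.toDGLA.twist (lift f ξ θ)).dE_dO u')
  -- From right to left, the factors fix `θ + ξ`, take it back to `η + ξ`, move it to `η' + ξ` and
  -- then to `θ' + ξ`. The correction by `-e` puts the product into the kernel of `f`.
  refine (cls_twistedKer_eq_iff f ξ _ _).2
    ⟨A.bch (A.bch y' (A.bch c (-y))) (-e), ?_, ?_⟩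
  · simp only [map_bch_twist f (f.mapMC ξ), map_neg, hfe, hc, hy, hy', zero_bch, bch_neg]
  · have he' : A.gauge (-e) (lift f ξ θ).1 = (lift f ξ θ).1 := by
      conv_lhs => rw [← he]
      exact A.gauge_neg_gauge _ _
    rw [gauge_bch, he', gauge_bch, gauge_bch, hθ, gauge_neg_gauge, hcη, ← hθ']

/-- Independence of all choices is part of the statement, so any function selected from it satisfies
the action formula for every representative and every lift. -/
lemma existsUnique_act (hfE : Function.Surjective f.mapE) (hfO : Function.Surjective f.mapO)
    (g : (B.twist (f.mapMC ξ)).ExpH0) (m : (twistedKer f ξ).MCmod) :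
    ∃ m', ∀ (y : A.Ev) (y₀ : (B.twist (f.mapMC ξ)).Z0) (η η' : (twistedKer f ξ).MC),
      f.mapE y = y₀.1 → (B.twist (f.mapMC ξ)).expCls y₀ = g → (twistedKer f ξ).cls η = m →
      (lift f ξ η').1 = A.gauge y (lift f ξ η).1 → (twistedKer f ξ).cls η' = m' := by
  obtain ⟨y₀, rfl⟩ := expCls_surjective _ g
  obtain ⟨η, rfl⟩ := Quot.mk_surjective m
  obtain ⟨y, hy⟩ := hfE y₀.1
  obtain ⟨η', h⟩ := exists_lift_eq_gauge f ξ y η (by rw [hy]; exact y₀.2)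
  exact ⟨(twistedKer f ξ).cls η', fun y' y₀' θ θ' h1 h2 h3 h4 =>
    cls_gauge_eq f ξ hfO h1 hy h2 h3 h4 h⟩

end action

end PronilpotentDGLA

/-- Let `f : 𝔤 ↠ 𝔥` be a surjection of pronilpotent dglas, `ξ₀ ∈ MC(𝔥)` and `ξ ∈ MC(𝔤)` with
`f(ξ) = ξ₀`.  The Baker–Campbell–Hausdorff product on even cocycles of `𝔥^ξ₀` makes
`exp(H⁰(𝔥^ξ₀))` a group; this group acts on `MCmod(𝔨^ξ)` by `e^[f y] ⋆ [η] = [e^y · (η + ξ) - ξ]`;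
and `[η] ↦ [η + ξ]` induces a bijection of the orbit set with the fibre of
`MCmod(𝔤) → MCmod(𝔥)` over `[ξ₀]`. -/
theorem theoremA9 {k : Type u} [Field k] [CharZero k]
    (𝔤 : PronilpotentDGLA.{u, v, w} k) (𝔥 : PronilpotentDGLA.{u, v', w'} k)
    (f : PronilpotentDGLA.Hom 𝔤 𝔥)
    (hfE : Function.Surjective f.mapE) (hfO : Function.Surjective f.mapO)
    (ξ₀ : 𝔥.MC) (ξ : 𝔤.MC) (hξ : f.mapMC ξ = ξ₀) :
    ∃ G : Group (𝔥.twist ξ₀).ExpH0,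
      (∀ x y : (𝔥.twist ξ₀).Z0,
        (𝔥.twist ξ₀).expCls x * (𝔥.twist ξ₀).expCls y =
          (𝔥.twist ξ₀).expCls ((𝔥.twist ξ₀).bchZ x y)) ∧
      ∃ A : MulAction (𝔥.twist ξ₀).ExpH0 (PronilpotentDGLA.twistedKer f ξ).MCmod,
        (∀ (y : 𝔤.Ev) (y₀ : (𝔥.twist ξ₀).Z0), f.mapE y = y₀.1 →
          ∀ η : (PronilpotentDGLA.twistedKer f ξ).MC,
            ∃ η' : (PronilpotentDGLA.twistedKer f ξ).MC,
              (PronilpotentDGLA.lift f ξ η').1 = 𝔤.gauge y (PronilpotentDGLA.lift f ξ η).1 ∧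
              (𝔥.twist ξ₀).expCls y₀ • (PronilpotentDGLA.twistedKer f ξ).cls η =
                (PronilpotentDGLA.twistedKer f ξ).cls η') ∧
        ∃ e : MulAction.orbitRel.Quotient (𝔥.twist ξ₀).ExpH0
              (PronilpotentDGLA.twistedKer f ξ).MCmod ≃
            {m : 𝔤.MCmod // f.mapMCmod m = 𝔥.cls ξ₀},
          ∀ η : (PronilpotentDGLA.twistedKer f ξ).MC,
            (e (Quotient.mk _ ((PronilpotentDGLA.twistedKer f ξ).cls η))).1 =
              𝔤.cls (PronilpotentDGLA.lift f ξ η) := by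
  subst hξ
  obtain ⟨G, hmul⟩ := (𝔥.twist (f.mapMC ξ)).exists_group
  choose act hact using PronilpotentDGLA.existsUnique_act f ξ hfE hfO
  -- The group is known only through its product; `e^0` is idempotent and hence the unit.
  have hone : (1 : (𝔥.twist (f.mapMC ξ)).ExpH0) = (𝔥.twist (f.mapMC ξ)).expCls 0 :=
    (mul_eq_left.1 ((hmul 0 0).trans
      (congrArg _ (Subtype.ext ((𝔥.twist (f.mapMC ξ)).zero_bch 0))))).symm
  let M : MulAction (𝔥.twist (f.mapMC ξ)).ExpH0 (PronilpotentDGLA.twistedKer f ξ).MCmod :=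
    { smul := act
      one_smul := fun m => by
        obtain ⟨η, rfl⟩ := Quot.mk_surjective m
        exact (hact 1 _ 0 0 η η (map_zero _) hone.symm rfl (𝔤.gauge_zero _).symm).symm
      mul_smul := fun g h m => by
        obtain ⟨x, rfl⟩ := PronilpotentDGLA.expCls_surjective _ g
        obtain ⟨z, rfl⟩ := PronilpotentDGLA.expCls_surjective _ h
        obtain ⟨η, rfl⟩ := Quot.mk_surjective m
        obtain ⟨a, ha⟩ := hfE x.1
        obtain ⟨b, hb⟩ := hfE z.1
        obtain ⟨η₁, h₁⟩ := PronilpotentDGLA.exists_lift_eq_gauge f ξ b η (by rw [hb]; exact z.2)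
        obtain ⟨η₂, h₂⟩ := PronilpotentDGLA.exists_lift_eq_gauge f ξ a η₁ (by rw [ha]; exact x.2)
        have e₁ := hact _ _ b z η η₁ hb rfl rfl h₁
        have e₂ := hact _ _ a x η₁ η₂ ha rfl rfl h₂
        -- The product `a • b` lifts `x • z` and acts as `e^a` after `e^b`, so it may be used to
        -- compute the action of `e^[x] e^[z]`.
        have e₃ := hact _ _ (𝔤.bch a b) ((𝔥.twist (f.mapMC ξ)).bchZ x z) η η₂
          ((PronilpotentDGLA.map_bch_twist f (f.mapMC ξ) a b).trans (by rw [ha, hb]; rfl))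
          (hmul x z).symm rfl (by rw [𝔤.gauge_bch, ← h₁, h₂])
        exact (e₃.symm.trans e₂).trans (congrArg _ e₁) }
  let F : (PronilpotentDGLA.twistedKer f ξ).MCmod →
      {m : 𝔤.MCmod // f.mapMCmod m = 𝔥.cls (f.mapMC ξ)} :=
    Quot.lift (fun η => ⟨𝔤.cls (PronilpotentDGLA.lift f ξ η),
        congrArg 𝔥.cls (Subtype.ext (PronilpotentDGLA.map_lift f ξ η))⟩) fun η η' h => by
      obtain ⟨c, -, hc⟩ := (PronilpotentDGLA.cls_twistedKer_eq_iff f ξ η η').1 (Quot.sound h)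
      exact Subtype.ext ((𝔤.cls_eq_iff _ _).2 ⟨c, hc⟩)
  have hF : ∀ m m', (MulAction.orbitRel (𝔥.twist (f.mapMC ξ)).ExpH0 _).r m m' ↔ F m = F m' := by
    intro m m'
    obtain ⟨η, rfl⟩ := Quot.mk_surjective m
    obtain ⟨η', rfl⟩ := Quot.mk_surjective m'
    constructor
    · rintro ⟨g, hg⟩
      obtain ⟨x, rfl⟩ := PronilpotentDGLA.expCls_surjective _ g
      obtain ⟨a, ha⟩ := hfE x.1
      obtain ⟨θ, h⟩ := PronilpotentDGLA.exists_lift_eq_gauge f ξ a η' (by rw [ha]; exact x.2)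
      have e : (PronilpotentDGLA.twistedKer f ξ).cls θ = (PronilpotentDGLA.twistedKer f ξ).cls η :=
        (hact _ _ a x η' θ ha rfl rfl h).trans hg
      refine (congrArg F e).symm.trans (Subtype.ext ?_)
      exact ((𝔤.cls_eq_iff _ _).2 ⟨a, h.symm⟩).symm
    · intro h
      obtain ⟨y, hy⟩ := (𝔤.cls_eq_iff _ _).1 (congrArg Subtype.val h).symm
      -- Both lifts lie over `ξ₀`, so `e^(f y)` fixes `ξ₀`. Therefore `f y` is a cocycle of `𝔥^ξ₀`
      -- and its class carries one class to the other.
      have hy₀ := congrArg f.mapO hy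
      rw [f.map_gauge, PronilpotentDGLA.map_lift, PronilpotentDGLA.map_lift] at hy₀
      exact ⟨(𝔥.twist (f.mapMC ξ)).expCls ⟨f.mapE y, 𝔥.twistE_eq_zero_of_gauge hy₀⟩,
        (hact _ _ y _ η' η rfl rfl rfl hy.symm).symm⟩
  refine ⟨G, hmul, M, ?_, Equiv.ofBijective
    (Quotient.lift F fun m m' h => (hF m m').1 h) ⟨?_, ?_⟩, fun η => rfl⟩
  · intro y y₀ hy η
    obtain ⟨η', h⟩ := PronilpotentDGLA.exists_lift_eq_gauge f ξ y η (by rw [hy]; exact y₀.2)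
    exact ⟨η', h, (hact _ _ y y₀ η η' hy rfl rfl h).symm⟩
  · intro m m'
    induction m using Quotient.inductionOn
    induction m' using Quotient.inductionOn
    exact fun h => Quotient.sound ((hF _ _).2 h)
  · rintro ⟨m, hm⟩
    obtain ⟨ζ, rfl⟩ := Quot.mk_surjective m
    -- A gauge transformation from `f(ζ)` to `ξ₀` lifts to `𝔤` and moves `ζ`, within its class,
    -- strictly over `ξ₀`.
    obtain ⟨y₀, h₀⟩ := (𝔥.cls_eq_iff (f.mapMC ζ) (f.mapMC ξ)).1 hm
    obtain ⟨y, rfl⟩ := hfE y₀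
    obtain ⟨η, hη⟩ := PronilpotentDGLA.exists_lift_eq f ξ (𝔤.gaugeMC y ζ)
      ((f.map_gauge y ζ.1).trans h₀)
    refine ⟨Quotient.mk _ ((PronilpotentDGLA.twistedKer f ξ).cls η), Subtype.ext ?_⟩
    exact ((𝔤.cls_eq_iff ζ (PronilpotentDGLA.lift f ξ η)).2 ⟨y, congrArg Subtype.val hη.symm⟩).symm
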